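/- Let $M$ be a Fr\"olicher space that is microlinear and Weil exponentiable. For $p\ge 0$ write $\mathcal W_{D^p}=\mathbb R[X_1,\dots,X_p]/(X_1^2,\dots,X_p^2)$ (and $D=D^1$), write $M\otimes W$ for the Weil prolongation of $M$ by a Weil algebra $W$, and put $E_p=[M\otimes\mathcal W_{D^p}\to M]$, the Fr\"olicher space of smooth maps. Infinitesimal notation $\mathcal W_{f}$ denotes the homomorphism of Weil algebras that corresponds to a map $f$ of infinitesimal objects. Let $\delta^p\in E_p$ be the canonical projection. An $(n,p)$-icon on $M$ is an element of $E_p\otimes\mathcal W_{D^n}$ whose image under the canonical projection to $E_p$ is $\delta^p$. For $\eta_1\in E_p$, $\eta_2\in E_q$ define $\eta_1*\eta_2\in E_{p+q}$ as the composite $M\otimes\mathcal W_{D^{p+q}}=(M\otimes\mathcal W_{D^q})\otimes\mathcal W_{D^p}\xrightarrow{\eta_2\otimes\mathrm{id}}M\otimes\mathcal W_{D^p}\xrightarrow{\eta_1}M$ and $\eta_1\,\tilde*\,\eta_2\in E_{p+q}$ as $M\otimes\mathcal W_{D^{p+q}}=(M\otimes\mathcal W_{D^p})\otimes\mathcal W_{D^q}\xrightarrow{\eta_1\otimes\mathrm{id}}M\otimes\mathcal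 W_{D^q}\xrightarrow{\eta_2}M$, where in $D^{p+q}=D^p\times D^q$ the first $p$ variables belong to $\eta_1$ and the last $q$ to $\eta_2$. For $\xi_1\in E_p\otimes\mathcal W_{D^m}$ and $\xi_2\in E_q\otimes\mathcal W_{D^n}$, let $\xi_1\circledast\xi_2$ and $\xi_1\,\tilde\circledast\,\xi_2$ in $E_{p+q}\otimes\mathcal W_{D^{m+n}}$ be the images under $*\otimes\mathrm{id}$ and $\tilde*\otimes\mathrm{id}$ of the element of $(E_p\times E_q)\otimes\mathcal W_{D^{m+n}}$ whose components are the images of $\xi_1$ and $\xi_2$ under $(d_1,\dots,d_{m+n})\mapsto(d_1,\dots,d_m)$ and $(d_1,\dots,d_{m+n})\mapsto(d_{m+1},\dots,d_{m+n})$. Let $D(2)=\{(d_1,d_2)\in D^2\mid d_1d_2=0\}$ and $D^2\oplus D=\{(d_1,d_2,e)\in D^3\mid d_1e=d_2e=0\}$. The strong difference $\gamma_1\overset{\cdot}{-}\gamma_2\in X\otimes\mathcal W_D$ of $\gamma_1,\gamma_2\in X\otimes\mathcal W_{D^2}$ that agree on $D(2)$ is the restriction along $d\mapsto(0,0,d)$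 of the unique $\gamma\in X\otimes\mathcal W_{D^2\oplus D}$ that restricts to $\gamma_1$ along $(d_1,d_2)\mapsto(d_1,d_2,d_1d_2)$ and to $\gamma_2$ along $(d_1,d_2)\mapsto(d_1,d_2,0)$. For a $(1,p)$-icon $\xi_1$ and a $(1,q)$-icon $\xi_2$ put $[\xi_1,\xi_2]_L=\xi_1\,\tilde\circledast\,\xi_2\overset{\cdot}{-}\xi_1\circledast\xi_2\in E_{p+q}\otimes\mathcal W_D$. Let $\sigma_{p,q}$ be the permutation of $\{1,\dots,p+q\}$ with $i\mapsto q+i$ for $i\le p$ and $p+j\mapsto j$ for $1\le j\le q$. For $\eta\in E_n$ and a permutation $\sigma$ of $\{1,\dots,n\}$ let $\eta^\sigma=\eta\circ(\mathrm{id}_M\otimes\mathcal W_{(d_1,\dots,d_n)\mapsto(d_{\sigma(1)},\dots,d_{\sigma(n)})})$, and let $\xi\mapsto\xi^\sigma$ be the map that $\eta\mapsto\eta^\sigma$ induces on $E_n\otimes\mathcal W_D$. Addition and $0$ refer to the tangent space of $E_{p+q+r}$ at $\delta^{p+q+r}$. Theorem. The convolutions $*,\tilde*:E_p\times E_q\to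 E_{p+q}$ are smooth. For a $(1,p)$-icon $\xi_1$ and a $(1,q)$-icon $\xi_2$ on $M$ the strong difference that defines $[\xi_1,\xi_2]_L$ is meaningful, and $[\xi_1,\xi_2]_L$ is a $(1,p+q)$-icon. Any two $(1,p)$-icons have a well-defined sum (the diagonal of the unique element of $E_p\otimes\mathcal W_{D(2)}$ with these icons as axes), which is again a $(1,p)$-icon. Moreover, for every $(1,p)$-icon $\xi_1$, $(1,q)$-icon $\xi_2$ and $(1,r)$-icon $\xi_3$ on $M$, $$[\xi_1,[\xi_2,\xi_3]_L]_L+\bigl([\xi_2,[\xi_3,\xi_1]_L]_L\bigr)^{\sigma_{p,q+r}}+\bigl([\xi_3,[\xi_1,\xi_2]_L]_L\bigr)^{\sigma_{p+q,r}}=0 .$$ -/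

import Mathlib

open CategoryTheory CategoryTheory.Limits
open scoped ContDiff

universe u v w

namespace Frolicher

/-! ### Frölicher spaces -/

/-- A Frölicher space: a set with structure curves and structure functions which determine each
other. -/
structure Frol where
  carrier : Type u
  curves : Set (ℝ → carrier)
  functions : Set (carrier → ℝ)
  mem_curves_iff : ∀ c, c ∈ curves ↔ ∀ f ∈ functions, ContDiff ℝ ∞ (f ∘ c)
  mem_functions_iff : ∀ f, f ∈ functions ↔ ∀ c ∈ curves, ContDiff ℝ ∞ (f ∘ c)

instance : CoeSort Frol.{u} (Type u) := ⟨Frol.carrier⟩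

/-- The Frölicher structure generated by a set of curves. -/
def Frol.ofCurves (X : Type u) (C : Set (ℝ → X)) : Frol.{u} where
  carrier := X
  curves := {c | ∀ f : X → ℝ, (∀ b ∈ C, ContDiff ℝ ∞ (f ∘ b)) → ContDiff ℝ ∞ (f ∘ c)}
  functions := {f | ∀ b ∈ C, ContDiff ℝ ∞ (f ∘ b)}
  mem_curves_iff _ := Iff.rfl
  mem_functions_iff _ := ⟨fun hf _ hc => hc _ hf, fun h b hb => h b fun _ hf => hf b hb⟩

/-- The Frölicher structure generated by a set of functions. -/
def Frol.ofFunctions (X : Type u) (F : Set (X → ℝ)) : Frol.{u} where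
  carrier := X
  curves := {c | ∀ f ∈ F, ContDiff ℝ ∞ (f ∘ c)}
  functions := {f | ∀ c : ℝ → X, (∀ g ∈ F, ContDiff ℝ ∞ (g ∘ c)) → ContDiff ℝ ∞ (f ∘ c)}
  mem_curves_iff _ := ⟨fun hc _ hf => hf _ hc, fun h f hf => h f fun _ hc => hc f hf⟩
  mem_functions_iff _ := Iff.rfl

/-- Smooth maps of Frölicher spaces: they carry structure curves to structure curves. -/
def IsSmooth (X : Frol.{u}) (Y : Frol.{v}) (f : X → Y) : Prop :=
  ∀ c ∈ X.curves, f ∘ c ∈ Y.curves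

theorem IsSmooth.id (X : Frol.{u}) : IsSmooth X X (fun x => x) := fun _ hc => hc

theorem IsSmooth.comp {X : Frol.{u}} {Y : Frol.{v}} {Z : Frol.{w}} {g : Y → Z} {f : X → Y}
    (hg : IsSmooth Y Z g) (hf : IsSmooth X Y f) : IsSmooth X Z (fun x => g (f x)) :=
  fun c hc => hg _ (hf c hc)

theorem Frol.const_mem (X : Frol.{u}) (x : X) : (fun _ : ℝ => x) ∈ X.curves :=
  (X.mem_curves_iff _).2 fun _ _ => contDiff_const

theorem Frol.comp_mem (X : Frol.{u}) {c : ℝ → X} (hc : c ∈ X.curves) {a : ℝ → ℝ}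
    (ha : ContDiff ℝ ∞ a) : (fun t => c (a t)) ∈ X.curves :=
  (X.mem_curves_iff _).2 fun f hf => ((X.mem_curves_iff c).1 hc f hf).comp ha

theorem isSmooth_const (X : Frol.{u}) (Y : Frol.{v}) (y : Y) : IsSmooth X Y (fun _ => y) :=
  fun _ _ => Y.const_mem y

theorem IsSmooth.comp_functions {X : Frol.{u}} {Y : Frol.{v}} {f : X → Y} (hf : IsSmooth X Y f)
    {h : Y → ℝ} (hh : h ∈ Y.functions) : (fun x => h (f x)) ∈ X.functions :=
  (X.mem_functions_iff _).2 fun c hc => (Y.mem_functions_iff h).1 hh _ (hf c hc)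

theorem Frol.mem_ofCurves {X : Type u} {C : Set (ℝ → X)} {c : ℝ → X} (hc : c ∈ C) :
    c ∈ (Frol.ofCurves X C).curves := fun _ hf => hf c hc

theorem isSmooth_ofCurves {X : Type u} {C : Set (ℝ → X)} {Y : Frol.{v}} {f : X → Y}
    (h : ∀ c ∈ C, f ∘ c ∈ Y.curves) : IsSmooth (Frol.ofCurves X C) Y f := fun _ hc =>
  (Y.mem_curves_iff _).2 fun g hg => hc (g ∘ f) fun b hb => (Y.mem_curves_iff _).1 (h b hb) g hg

/-- The category `FS` of Frölicher spaces and smooth maps. -/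
instance : Category Frol.{u} where
  Hom X Y := {f : X → Y // IsSmooth X Y f}
  id X := ⟨fun x => x, IsSmooth.id X⟩
  comp f g := ⟨fun x => g.1 (f.1 x), g.2.comp f.2⟩

/-- The binary product of Frölicher spaces. -/
def Frol.prod (X : Frol.{u}) (Y : Frol.{v}) : Frol.{max u v} :=
  Frol.ofFunctions (X × Y)
    ({k | ∃ f ∈ X.functions, k = fun z => f z.1} ∪ {k | ∃ g ∈ Y.functions, k = fun z => g z.2})

theorem Frol.pair_mem {X : Frol.{u}} {Y : Frol.{v}} {a : ℝ → X} {b : ℝ → Y}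
    (ha : a ∈ X.curves) (hb : b ∈ Y.curves) : (fun t => (a t, b t)) ∈ (X.prod Y).curves := by
  rintro _ (⟨f, hf, rfl⟩ | ⟨g, hg, rfl⟩)
  · exact (X.mem_curves_iff a).1 ha f hf
  · exact (Y.mem_curves_iff b).1 hb g hg

theorem IsSmooth.pair {X : Frol.{u}} {Y : Frol.{v}} {Z : Frol.{w}} {f : Z → X} {g : Z → Y}
    (hf : IsSmooth Z X f) (hg : IsSmooth Z Y g) : IsSmooth Z (X.prod Y) (fun z => (f z, g z)) :=
  fun c hc => Frol.pair_mem (hf c hc) (hg c hc)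

/-- The curves `c` in the set of smooth maps `Y → X` for which `(s, y) ↦ c s y` is smooth. -/
def expCurves (Y : Frol.{u}) (X : Frol.{v}) : Set (ℝ → {f : Y → X // IsSmooth Y X f}) :=
  {c | ∀ a : ℝ → ℝ, ContDiff ℝ ∞ a → ∀ b ∈ Y.curves, (fun t => (c (a t)).1 (b t)) ∈ X.curves}

/-- The function space `[Y → X] = X ^ Y`. -/
def Frol.exp (Y : Frol.{u}) (X : Frol.{v}) : Frol.{max u v} :=
  Frol.ofCurves {f : Y → X // IsSmooth Y X f} (expCurves Y X)

theorem isSmooth_eval (Y : Frol.{u}) (X : Frol.{v}) (y : Y) :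
    IsSmooth (Y.exp X) X (fun f => f.1 y) :=
  isSmooth_ofCurves fun _ hc => hc (fun t => t) contDiff_id _ (Y.const_mem y)

theorem isSmooth_postcomp (Z : Frol.{w}) {X : Frol.{u}} {Y : Frol.{v}} {f : X → Y}
    (hf : IsSmooth X Y f) :
    IsSmooth (Z.exp X) (Z.exp Y) (fun g => ⟨fun z => f (g.1 z), hf.comp g.2⟩) :=
  isSmooth_ofCurves fun _ hc => Frol.mem_ofCurves fun a ha b hb => hf _ (hc a ha b hb)

theorem isSmooth_precomp {Z : Frol.{w}} {Y : Frol.{v}} (X : Frol.{u}) {f : Z → Y}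
    (hf : IsSmooth Z Y f) :
    IsSmooth (Y.exp X) (Z.exp X) (fun g => ⟨fun z => g.1 (f z), g.2.comp hf⟩) :=
  isSmooth_ofCurves fun _ hc => Frol.mem_ofCurves fun a ha b hb => hc a ha _ (hf b hb)

theorem isSmooth_constMap (Y : Frol.{u}) (X : Frol.{v}) :
    IsSmooth X (Y.exp X) (fun x => ⟨fun _ => x, isSmooth_const Y X x⟩) :=
  fun _ hc => Frol.mem_ofCurves fun _ ha _ _ => X.comp_mem hc ha

/-- `ℝⁿ` as a Frölicher space; the structure curves are the `C^∞` curves. -/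
def Rn (n : ℕ) : Frol.{0} :=
  Frol.ofFunctions (Fin n → ℝ) {k | ∃ i, k = fun x => x i}

theorem mem_Rn_curves {n : ℕ} {c : ℝ → Fin n → ℝ} : c ∈ (Rn n).curves ↔ ContDiff ℝ ∞ c := by
  rw [contDiff_pi]
  constructor
  · intro h i
    exact h _ ⟨i, rfl⟩
  · rintro h _ ⟨i, rfl⟩
    exact h i

theorem isSmooth_of_contDiff {m n : ℕ} {φ : (Fin m → ℝ) → (Fin n → ℝ)} (hφ : ContDiff ℝ ∞ φ) :
    IsSmooth (Rn m) (Rn n) φ :=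
  fun _ hc => mem_Rn_curves.2 (hφ.comp (mem_Rn_curves.1 hc))

/-! ### Weil algebras -/

/-- The algebra `C^∞(ℝⁿ)` of smooth real functions on `ℝⁿ`. -/
def smoothRing (n : ℕ) : Subalgebra ℝ ((Fin n → ℝ) → ℝ) where
  carrier := (Rn n).functions
  mul_mem' hf hg := fun c hc => (hf c hc).mul (hg c hc)
  add_mem' hf hg := fun c hc => (hf c hc).add (hg c hc)
  algebraMap_mem' r := fun _ _ => (contDiff_const : ContDiff ℝ ∞ fun _ : ℝ => r)

/-- The `i`-th coordinate function on `ℝⁿ`. -/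
def coord {n : ℕ} (i : Fin n) : smoothRing n :=
  ⟨fun x => x i, fun _ hc => hc _ ⟨i, rfl⟩⟩

/-- Composition with a smooth map, as a homomorphism `C^∞(ℝⁿ) → C^∞(ℝᵐ)`. -/
def pull {m n : ℕ} (φ : Rn m → Rn n) (hφ : IsSmooth (Rn m) (Rn n) φ) :
    smoothRing n →ₐ[ℝ] smoothRing m where
  toFun f := ⟨fun x => f.1 (φ x), hφ.comp_functions f.2⟩
  map_one' := rfl
  map_mul' _ _ := rfl
  map_zero' := rfl
  map_add' _ _ := rfl
  commutes' _ := rfl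

theorem mem_of_eq_zero {n : ℕ} (I : Ideal (smoothRing n)) {f : smoothRing n}
    (h : ∀ x, f.1 x = 0) : f ∈ I := by
  have : f = 0 := Subtype.ext (funext h)
  rw [this]
  exact I.zero_mem

theorem mem_of_eq_mul {n : ℕ} {I : Ideal (smoothRing n)} {f g : smoothRing n} (k : smoothRing n)
    (hg : g ∈ I) (h : ∀ x, f.1 x = k.1 x * g.1 x) : f ∈ I := by
  have : f = k * g := Subtype.ext (funext h)
  rw [this]
  exact I.mul_mem_left k hg

/-- A Weil algebra `W = C^∞(ℝⁿ) / I`, given by a presentation: the elements of `I` vanish at the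
origin and the coordinates are nilpotent modulo `I`. So the quotient is a finite dimensional local
`ℝ`-algebra with residue field `ℝ`, and every such algebra arises in this way. -/
structure Weil where
  n : ℕ
  I : Ideal (smoothRing n)
  vanish : ∀ f ∈ I, f.1 0 = 0
  nilp : ∀ i : Fin n, ∃ k : ℕ, coord i ^ k ∈ I

/-- The underlying algebra of a Weil algebra. -/
abbrev Weil.alg (W : Weil) : Type := smoothRing W.n ⧸ W.I

/-- A smooth substitution `φ : ℝᵐ → ℝⁿ` inducing a homomorphism
`V = C^∞(ℝⁿ) / I → C^∞(ℝᵐ) / J = W`. -/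
structure Subst (V W : Weil) where
  φ : Rn W.n → Rn V.n
  smooth : IsSmooth (Rn W.n) (Rn V.n) φ
  le : V.I ≤ W.I.comap (pull φ smooth)

/-- The homomorphism induced by a substitution. -/
def Subst.hom {V W : Weil} (s : Subst V W) : V.alg →ₐ[ℝ] W.alg :=
  Ideal.quotientMapₐ W.I (pull s.φ s.smooth) s.le

theorem Subst.map_zero {V W : Weil} (s : Subst V W) : s.φ (0 : Fin W.n → ℝ) = (0 : Fin V.n → ℝ) := by
  funext i
  obtain ⟨k, hk⟩ := V.nilp i
  have h : (s.φ (0 : Fin W.n → ℝ) i) ^ k = 0 := W.vanish _ (s.le hk)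
  by_contra hne
  exact pow_ne_zero k hne h

def Subst.id (W : Weil) : Subst W W where
  φ := fun x => x
  smooth := IsSmooth.id _
  le := fun _ hf => hf

def Subst.comp {U V W : Weil} (s : Subst U V) (t : Subst V W) : Subst U W where
  φ := fun x => s.φ (t.φ x)
  smooth := s.smooth.comp t.smooth
  le := fun _ hf => t.le (s.le hf)

theorem Subst.hom_id (W : Weil) : (Subst.id W).hom = AlgHom.id ℝ W.alg := by
  apply AlgHom.ext
  intro x
  obtain ⟨f, rfl⟩ := Ideal.Quotient.mk_surjective x
  rfl

theorem Subst.hom_comp {U V W : Weil} (s : Subst U V) (t : Subst V W) :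
    (s.comp t).hom = t.hom.comp s.hom := by
  apply AlgHom.ext
  intro x
  obtain ⟨f, rfl⟩ := Ideal.Quotient.mk_surjective x
  rfl

/-- The category `W` of Weil algebras. Every homomorphism between Weil algebras is induced by a
smooth substitution. -/
instance : Category Weil where
  Hom V W := {θ : V.alg →ₐ[ℝ] W.alg // ∃ s : Subst V W, s.hom = θ}
  id W := ⟨AlgHom.id ℝ W.alg, Subst.id W, Subst.hom_id W⟩
  comp f g := ⟨g.1.comp f.1, by
    obtain ⟨_, s, rfl⟩ := f
    obtain ⟨_, t, rfl⟩ := g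
    exact ⟨s.comp t, Subst.hom_comp s t⟩⟩

/-- The forgetful functor from Weil algebras to commutative `ℝ`-algebras. -/
def Weil.toAlg : Weil ⥤ CommAlgCat.{0} ℝ where
  obj W := CommAlgCat.of ℝ W.alg
  map θ := CommAlgCat.ofHom θ.1
  map_id _ := rfl
  map_comp _ _ := rfl

/-! ### Weil prolongations -/

/-- Two smooth maps `f, g : ℝⁿ → X` are equivalent modulo `I` if `f 0 = g 0` and `h ∘ f - h ∘ g`
lies in `I` for every structure function `h`. -/
def weilSetoid (X : Frol.{u}) (W : Weil) : Setoid ((Rn W.n).exp X) where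
  r f g := f.1 (0 : Fin W.n → ℝ) = g.1 (0 : Fin W.n → ℝ) ∧
    ∀ (h : X → ℝ) (hh : h ∈ X.functions),
      ((⟨fun x => h (f.1 x), f.2.comp_functions hh⟩ : smoothRing W.n) -
        ⟨fun x => h (g.1 x), g.2.comp_functions hh⟩) ∈ W.I
  iseqv :=
    { refl := fun f => ⟨rfl, fun _ _ => by rw [sub_self]; exact W.I.zero_mem⟩
      symm := fun {f g} H => ⟨H.1.symm, fun h hh => by
        rw [← neg_sub]; exact W.I.neg_mem (H.2 h hh)⟩
      trans := fun {f g k} H K => ⟨H.1.trans K.1, fun h hh => by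
        have := W.I.add_mem (H.2 h hh) (K.2 h hh)
        rwa [sub_add_sub_cancel] at this⟩ }

/-- The class of a smooth map `ℝⁿ → X`. -/
def jet {X : Frol.{u}} (W : Weil) (f : (Rn W.n).exp X) : Quotient (weilSetoid X W) :=
  Quotient.mk _ f

/-- The Weil prolongation `X ⊗ W`, as a quotient of the Frölicher space `[ℝⁿ → X]`. -/
def prol (X : Frol.{u}) (W : Weil) : Frol.{u} :=
  Frol.ofCurves (Quotient (weilSetoid X W)) {c | ∃ b ∈ ((Rn W.n).exp X).curves, c = jet W ∘ b}

theorem isSmooth_jet (X : Frol.{u}) (W : Weil) : IsSmooth ((Rn W.n).exp X) (prol X W) (jet W) :=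
  fun b hb => Frol.mem_ofCurves ⟨b, hb, rfl⟩

theorem isSmooth_prol {X : Frol.{u}} {W : Weil} {Y : Frol.{v}} {f : prol X W → Y}
    (h : IsSmooth ((Rn W.n).exp X) Y (fun g => f (jet W g))) : IsSmooth (prol X W) Y f := by
  apply isSmooth_ofCurves
  rintro _ ⟨b, hb, rfl⟩
  exact h b hb

/-- The canonical projection `X ⊗ W → X`. -/
def foot {X : Frol.{u}} {W : Weil} : prol X W → X :=
  Quotient.lift (fun f => f.1 (0 : Fin W.n → ℝ)) fun _ _ H => H.1

theorem isSmooth_foot (X : Frol.{u}) (W : Weil) : IsSmooth (prol X W) X foot :=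
  isSmooth_prol (isSmooth_eval (Rn W.n) X (0 : Fin W.n → ℝ))

/-- The inclusion `X → X ⊗ W` of constants. -/
def zeroProl {X : Frol.{u}} (W : Weil) (x : X) : prol X W :=
  jet W ⟨fun _ => x, isSmooth_const _ X x⟩

/-- The map `f ⊗ id_W : X ⊗ W → Y ⊗ W` for smooth `f : X → Y`. -/
def prolMap {X : Frol.{u}} {Y : Frol.{v}} (W : Weil) (f : X → Y) (hf : IsSmooth X Y f) :
    prol X W → prol Y W :=
  Quotient.lift (fun g => jet W ⟨fun x => f (g.1 x), hf.comp g.2⟩) fun _ _ H =>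
    Quotient.sound ⟨congrArg f H.1, fun _ hh => H.2 _ (hf.comp_functions hh)⟩

theorem isSmooth_prolMap {X : Frol.{u}} {Y : Frol.{v}} (W : Weil) {f : X → Y}
    (hf : IsSmooth X Y f) : IsSmooth (prol X W) (prol Y W) (prolMap W f hf) :=
  isSmooth_prol ((isSmooth_jet Y W).comp (isSmooth_postcomp (Rn W.n) hf))

/-- The map `id_X ⊗ s : X ⊗ V → X ⊗ W` for the homomorphism `V → W` induced by `s`. -/
def prolSubst (X : Frol.{u}) {V W : Weil} (s : Subst V W) : prol X V → prol X W :=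
  Quotient.lift (fun g => jet W ⟨fun x => g.1 (s.φ x), g.2.comp s.smooth⟩) fun f g H =>
    Quotient.sound ⟨by
      change f.1 (s.φ (0 : Fin W.n → ℝ)) = g.1 (s.φ (0 : Fin W.n → ℝ))
      rw [s.map_zero]; exact H.1, fun h hh => s.le (H.2 h hh)⟩

theorem isSmooth_prolSubst (X : Frol.{u}) {V W : Weil} (s : Subst V W) :
    IsSmooth (prol X V) (prol X W) (prolSubst X s) :=
  isSmooth_prol ((isSmooth_jet X W).comp (isSmooth_precomp X s.smooth))

theorem prolSubst_congr (X : Frol.{u}) {V W : Weil} {s t : Subst V W} (h : s.hom = t.hom) :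
    prolSubst X s = prolSubst X t := by
  funext x
  induction x using Quotient.inductionOn with
  | h g =>
    refine Quotient.sound ⟨?_, fun k hk => ?_⟩
    · change g.1 (s.φ (0 : Fin W.n → ℝ)) = g.1 (t.φ (0 : Fin W.n → ℝ))
      rw [s.map_zero, t.map_zero]
    · have := DFunLike.congr_fun h
        (Ideal.Quotient.mk V.I ⟨fun x => k (g.1 x), g.2.comp_functions hk⟩)
      exact Ideal.Quotient.eq.1 this

/-- The functor `X ⊗ · : W ⥤ FS`. -/
noncomputable def prolFunctor (X : Frol.{u}) : Weil ⥤ Frol.{u} where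
  obj W := prol X W
  map θ := ⟨prolSubst X θ.2.choose, isSmooth_prolSubst X _⟩
  map_id W := by
    apply Subtype.ext
    change prolSubst X _ = _
    rw [prolSubst_congr X (t := Subst.id W)]
    · funext x
      induction x using Quotient.inductionOn with
      | h g => rfl
    · rw [Exists.choose_spec (p := fun s : Subst W W => s.hom = (𝟙 W : W ⟶ W).1), Subst.hom_id]
      rfl
  map_comp {U V W} f g := by
    apply Subtype.ext
    change prolSubst X _ = _
    rw [prolSubst_congr X (t := f.2.choose.comp g.2.choose)]
    · funext x
      induction x using Quotient.inductionOn with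
      | h k => rfl
    · rw [Exists.choose_spec (p := fun s : Subst U W => s.hom = (f ≫ g).1), Subst.hom_comp,
        f.2.choose_spec, g.2.choose_spec]
      rfl

/-- `X` is microlinear: `X ⊗ ·` turns every finite limit diagram of Weil algebras into a limit
diagram of Frölicher spaces. As usual, a limit diagram of Weil algebras is a diagram of Weil
algebras that is a limit in the category of `ℝ`-algebras. -/
def Microlinear (X : Frol.{u}) : Prop :=
  ∀ (J : Type) [SmallCategory J] [FinCategory J] (K : J ⥤ Weil) (c : Cone K),
    Nonempty (IsLimit (Weil.toAlg.mapCone c)) → Nonempty (IsLimit ((prolFunctor X).mapCone c))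

/-! ### Tensor products and Weil exponentiability -/

def projL {m n : ℕ} : Rn (m + n) → Rn m := fun x i => x (Fin.castAdd n i)

def projR {m n : ℕ} : Rn (m + n) → Rn n := fun x i => x (Fin.natAdd m i)

theorem isSmooth_projL {m n : ℕ} : IsSmooth (Rn (m + n)) (Rn m) projL :=
  isSmooth_of_contDiff (contDiff_pi.2 fun i => contDiff_apply ℝ ℝ (Fin.castAdd n i))

theorem isSmooth_projR {m n : ℕ} : IsSmooth (Rn (m + n)) (Rn n) projR :=
  isSmooth_of_contDiff (contDiff_pi.2 fun i => contDiff_apply ℝ ℝ (Fin.natAdd m i))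

/-- `W₁ ⊗_∞ W₂ = C^∞(ℝᵐ × ℝⁿ) / (I₁, I₂)`. -/
def Weil.tensor (W₁ W₂ : Weil) : Weil where
  n := W₁.n + W₂.n
  I := W₁.I.map (pull projL isSmooth_projL) ⊔ W₂.I.map (pull projR isSmooth_projR)
  vanish := by
    let e : smoothRing (W₁.n + W₂.n) →+* ℝ :=
      (Pi.evalRingHom (fun _ => ℝ) (0 : Fin (W₁.n + W₂.n) → ℝ)).comp
        (smoothRing (W₁.n + W₂.n)).val.toRingHom
    have : W₁.I.map (pull projL isSmooth_projL) ⊔ W₂.I.map (pull projR isSmooth_projR) ≤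
        RingHom.ker e := by
      refine sup_le (Ideal.map_le_iff_le_comap.2 fun f hf => ?_)
        (Ideal.map_le_iff_le_comap.2 fun f hf => ?_)
      · exact W₁.vanish f hf
      · exact W₂.vanish f hf
    exact fun f hf => this hf
  nilp := by
    intro i
    refine Fin.addCases (fun i => ?_) (fun i => ?_) i
    · obtain ⟨k, hk⟩ := W₁.nilp i
      exact ⟨k, Ideal.mem_sup_left (Ideal.mem_map_of_mem (pull projL isSmooth_projL) hk)⟩
    · obtain ⟨k, hk⟩ := W₂.nilp i
      exact ⟨k, Ideal.mem_sup_right (Ideal.mem_map_of_mem (pull projR isSmooth_projR) hk)⟩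

theorem append_mem {m n : ℕ} {a : ℝ → Rn m} {b : ℝ → Rn n} (ha : a ∈ (Rn m).curves)
    (hb : b ∈ (Rn n).curves) :
    (fun t => (Fin.append (a t) (b t) : Fin (m + n) → ℝ)) ∈ (Rn (m + n)).curves := by
  rintro _ ⟨i, rfl⟩
  refine Fin.addCases (fun i => ?_) (fun i => ?_) i
  · have e : (fun t => (Fin.append (a t) (b t) : Fin (m + n) → ℝ) (Fin.castAdd n i)) =
        fun t => (a t : Fin m → ℝ) i := funext fun t => Fin.append_left _ _ _
    exact (congrArg (ContDiff ℝ ∞) e).mpr (ha _ ⟨i, rfl⟩)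
  · have e : (fun t => (Fin.append (a t) (b t) : Fin (m + n) → ℝ) (Fin.natAdd m i)) =
        fun t => (b t : Fin n → ℝ) i := funext fun t => Fin.append_right _ _ _
    exact (congrArg (ContDiff ℝ ∞) e).mpr (hb _ ⟨i, rfl⟩)

theorem isSmooth_appendL {m n : ℕ} (v : Rn n) :
    IsSmooth (Rn m) (Rn (m + n)) (fun x => (Fin.append x v : Fin (m + n) → ℝ)) :=
  fun _ hc => append_mem hc ((Rn n).const_mem v)

/-- For `f : ℝᵐ⁺ⁿ → X`, the smooth map `ℝⁿ → X ⊗ W₁` that sends `v` to the class of `f(·, v)`. -/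
def slice {X : Frol.{u}} (W₁ W₂ : Weil) (f : (Rn (W₁.tensor W₂).n).exp X) :
    (Rn W₂.n).exp (prol X W₁) :=
  ⟨fun v => jet W₁ ⟨fun x => f.1 (Fin.append x v : Fin (W₁.n + W₂.n) → ℝ),
      f.2.comp (isSmooth_appendL v)⟩,
    fun _ hc => (isSmooth_jet X W₁) _ (Frol.mem_ofCurves fun _ ha _ hb =>
      f.2 _ (append_mem hb ((Rn W₂.n).comp_mem hc ha)))⟩

/-- `X` is Weil exponentiable: `(X ⊗ W₁) ^ Y ⊗ W₂ = (X ⊗ (W₁ ⊗_∞ W₂)) ^ Y` naturally, for all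
Frölicher spaces `Y` and all Weil algebras `W₁`, `W₂`. The canonical identification is evaluation
at the points of `Y`, where the class of `f : ℝᵐ × ℝⁿ → X` is identified with the class of
`v ↦ [f(·, v)]`. -/
def WeilExponentiable (X : Frol.{u}) : Prop :=
  ∀ (Y : Frol.{u}) (W₁ W₂ : Weil),
    ∃ e : prol (Y.exp (prol X W₁)) W₂ ≃ Y.exp (prol X (W₁.tensor W₂)),
      IsSmooth _ _ e ∧ IsSmooth _ _ e.symm ∧
      ∀ (ξ : prol (Y.exp (prol X W₁)) W₂) (y : Y) (f : (Rn (W₁.tensor W₂).n).exp X),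
        (e ξ).1 y = jet (W₁.tensor W₂) f ↔
          prolMap (X := Y.exp (prol X W₁)) W₂ (fun η => η.1 y) (isSmooth_eval Y (prol X W₁) y) ξ = jet W₂ (slice W₁ W₂ f)

/-- The identification `X ⊗ (W₁ ⊗_∞ W₂) → (X ⊗ W₁) ⊗ W₂` (meant for Weil exponentiable `X`, where
it does not depend on the representative). -/
noncomputable def split {X : Frol.{u}} (W₁ W₂ : Weil) (x : prol X (W₁.tensor W₂)) :
    prol (prol X W₁) W₂ :=
  jet W₂ (slice W₁ W₂ (Quotient.out x))

theorem isSmooth_split {X : Frol.{u}} (hX : WeilExponentiable X) (W₁ W₂ : Weil) :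
    IsSmooth (prol X (W₁.tensor W₂)) (prol (prol X W₁) W₂) (split W₁ W₂) := by
  let Y : Frol.{u} := Frol.ofCurves PUnit Set.univ
  obtain ⟨e, -, he', h⟩ := hX Y W₁ W₂
  have key : split W₁ W₂ = fun x : prol X (W₁.tensor W₂) =>
      prolMap (X := Y.exp (prol X W₁)) W₂ (fun η => η.1 PUnit.unit) (isSmooth_eval Y (prol X W₁) PUnit.unit)
        (e.symm ⟨fun _ => x, isSmooth_const _ _ x⟩) := by
    funext x
    let k : Y.exp (prol X (W₁.tensor W₂)) := ⟨fun _ => x, isSmooth_const _ _ x⟩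
    have hk : (e (e.symm k)).1 PUnit.unit = x :=
      congrArg (fun g : Y.exp (prol X (W₁.tensor W₂)) => g.1 PUnit.unit) (e.apply_symm_apply k)
    exact ((h (e.symm k) PUnit.unit (Quotient.out x)).1
      (hk.trans (Quotient.out_eq x).symm)).symm
  rw [key]
  exact (isSmooth_prolMap W₂ _).comp (he'.comp (isSmooth_constMap Y _))

/-- The identification `(A ⊗ W) × (B ⊗ W) = (A × B) ⊗ W` (it does not depend on the choice of
representatives, since `· ⊗ W` preserves products). -/
noncomputable def prolPair {A : Frol.{u}} {B : Frol.{v}} {W : Weil} (a : prol A W) (b : prol B W) :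
    prol (A.prod B) W :=
  jet W ⟨fun x => ((Quotient.out a).1 x, (Quotient.out b).1 x),
    (Quotient.out a).2.pair (Quotient.out b).2⟩

/-! ### Infinitesimal objects -/

/-- The Weil algebra presented by a set of relations including all squares of coordinates. -/
def Weil.ofGens (n : ℕ) (S : Set (smoothRing n)) (h0 : ∀ f ∈ S, f.1 0 = 0)
    (hS : ∀ i, coord i * coord i ∈ S) : Weil where
  n := n
  I := Ideal.span S
  vanish := by
    let e : smoothRing n →+* ℝ :=
      (Pi.evalRingHom (fun _ => ℝ) (0 : Fin n → ℝ)).comp (smoothRing n).val.toRingHom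
    have : Ideal.span S ≤ RingHom.ker e := Ideal.span_le.2 fun f hf => h0 f hf
    exact fun f hf => this hf
  nilp i := ⟨2, by rw [pow_two]; exact Ideal.subset_span (hS i)⟩

/-- `W_{D^n}`: the relations are `d_i ^ 2 = 0`. -/
def D (n : ℕ) : Weil :=
  Weil.ofGens n {f | ∃ i, f = coord i * coord i}
    (by rintro _ ⟨i, rfl⟩; exact mul_zero (0 : ℝ)) (fun i => ⟨i, rfl⟩)

/-- `W_{D(2)}`: the relations are `d_i d_j = 0`. -/
def DTwo : Weil :=
  Weil.ofGens 2 {f | ∃ i j, f = coord i * coord j}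
    (by rintro _ ⟨i, j, rfl⟩; exact mul_zero (0 : ℝ)) (fun i => ⟨i, i, rfl⟩)

/-- `W_{D^2 ⊕ D}` with `D^2 ⊕ D = {(d₁, d₂, e) ∈ D^3 | d₁ e = d₂ e = 0}`. -/
def DPlus : Weil :=
  Weil.ofGens 3 ({f | ∃ i, f = coord i * coord i} ∪ {coord 0 * coord 2, coord 1 * coord 2})
    (by rintro _ (⟨i, rfl⟩ | rfl | rfl) <;> exact mul_zero (0 : ℝ)) (fun i => Or.inl ⟨i, rfl⟩)

/-- A substitution between algebras given by relations. -/
def Subst.ofGens {m n : ℕ} {S : Set (smoothRing n)} {T : Set (smoothRing m)} {h0 hS h0' hT}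
    (φ : (Fin m → ℝ) → (Fin n → ℝ)) (hφ : ContDiff ℝ ∞ φ)
    (h : ∀ f ∈ S, pull φ (isSmooth_of_contDiff hφ) f ∈ Ideal.span T) :
    Subst (Weil.ofGens n S h0 hS) (Weil.ofGens m T h0' hT) where
  φ := φ
  smooth := isSmooth_of_contDiff hφ
  le := Ideal.span_le.2 h

/-- The map `d ∈ D^m ↦ (d_{s(1)}, …, d_{s(n)}) ∈ D^n`, for `s : Fin n → Fin m`. -/
def coordSubst {m n : ℕ} (s : Fin n → Fin m) : Subst (D n) (D m) :=
  Subst.ofGens (m := m) (n := n) (fun x i => x (s i)) (contDiff_pi.2 fun i => contDiff_apply ℝ ℝ (s i))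
    (by rintro _ ⟨i, rfl⟩; exact Ideal.subset_span ⟨s i, rfl⟩)

/-- The map `d ∈ D^p × D^q ↦ (d_{s(1)}, …, d_{s(n)}) ∈ D^n`, for `s : Fin n → Fin (p + q)`. -/
def tensorSubst {n p q : ℕ} (s : Fin n → Fin (p + q)) : Subst (D n) ((D p).tensor (D q)) where
  φ := fun x i => x (s i)
  smooth := isSmooth_of_contDiff (contDiff_pi.2 fun i => contDiff_apply ℝ ℝ (s i))
  le := by
    have key : ∀ j : Fin (p + q),
        (coord j * coord j : smoothRing (p + q)) ∈ ((D p).tensor (D q)).I := by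
      intro j
      refine Fin.addCases (fun i => ?_) (fun i => ?_) j
      · have : (coord i * coord i : smoothRing p) ∈ (D p).I := Ideal.subset_span ⟨i, rfl⟩
        exact Ideal.mem_sup_left (Ideal.mem_map_of_mem (pull projL isSmooth_projL) this)
      · have : (coord i * coord i : smoothRing q) ∈ (D q).I := Ideal.subset_span ⟨i, rfl⟩
        exact Ideal.mem_sup_right (Ideal.mem_map_of_mem (pull projR isSmooth_projR) this)
    refine Ideal.span_le.2 ?_
    rintro _ ⟨i, rfl⟩
    exact key (s i)

/-- `d ∈ D ↦ (d, 0) ∈ D(2)`. -/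
def axisOne : Subst DTwo (D 1) :=
  Subst.ofGens (m := 1) (n := 2) (fun x => ![x 0, 0])
    (by
      refine contDiff_pi.2 fun i => ?_
      fin_cases i
      · exact contDiff_apply ℝ ℝ (0 : Fin 1)
      · exact contDiff_const)
    (by
      rintro _ ⟨i, j, rfl⟩
      fin_cases i <;> fin_cases j
      · exact Ideal.subset_span ⟨0, rfl⟩
      all_goals
        refine mem_of_eq_zero _ fun x => ?_
        first | exact mul_zero _ | exact zero_mul _)

/-- `d ∈ D ↦ (0, d) ∈ D(2)`. -/
def axisTwo : Subst DTwo (D 1) :=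
  Subst.ofGens (m := 1) (n := 2) (fun x => ![0, x 0])
    (by
      refine contDiff_pi.2 fun i => ?_
      fin_cases i
      · exact contDiff_const
      · exact contDiff_apply ℝ ℝ (0 : Fin 1))
    (by
      rintro _ ⟨i, j, rfl⟩
      fin_cases i <;> fin_cases j
      rotate_right
      · exact Ideal.subset_span ⟨0, rfl⟩
      all_goals
        refine mem_of_eq_zero _ fun x => ?_
        first | exact mul_zero _ | exact zero_mul _)

/-- `d ∈ D ↦ (d, d) ∈ D(2)`. -/
def diagonal : Subst DTwo (D 1) :=
  Subst.ofGens (m := 1) (n := 2) (fun x _ => x 0) (contDiff_pi.2 fun _ => contDiff_apply ℝ ℝ (0 : Fin 1))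
    (by rintro _ ⟨i, j, rfl⟩; exact Ideal.subset_span ⟨0, rfl⟩)

/-- The inclusion `D(2) ⊆ D^2`. -/
def inclTwo : Subst (D 2) DTwo :=
  Subst.ofGens (m := 2) (n := 2) (fun x => x) contDiff_id
    (by rintro _ ⟨i, rfl⟩; exact Ideal.subset_span ⟨i, i, rfl⟩)

/-- `(d₁, d₂) ∈ D^2 ↦ (d₁, d₂, 0) ∈ D^2 ⊕ D`. -/
def phiMap : Subst DPlus (D 2) :=
  Subst.ofGens (m := 2) (n := 3) (fun x => ![x 0, x 1, 0])
    (by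
      refine contDiff_pi.2 fun i => ?_
      fin_cases i
      · exact contDiff_apply ℝ ℝ (0 : Fin 2)
      · exact contDiff_apply ℝ ℝ (1 : Fin 2)
      · exact contDiff_const)
    (by
      rintro _ (⟨i, rfl⟩ | rfl | rfl)
      · fin_cases i
        · exact Ideal.subset_span ⟨0, rfl⟩
        · exact Ideal.subset_span ⟨1, rfl⟩
        · exact mem_of_eq_zero _ fun x => mul_zero (0 : ℝ)
      all_goals
        refine mem_of_eq_zero _ fun x => ?_
        exact mul_zero _)

/-- `(d₁, d₂) ∈ D^2 ↦ (d₁, d₂, d₁ d₂) ∈ D^2 ⊕ D`. -/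
def psiMap : Subst DPlus (D 2) :=
  Subst.ofGens (m := 2) (n := 3) (fun x => ![x 0, x 1, x 0 * x 1])
    (by
      refine contDiff_pi.2 fun i => ?_
      fin_cases i
      · exact contDiff_apply ℝ ℝ (0 : Fin 2)
      · exact contDiff_apply ℝ ℝ (1 : Fin 2)
      · exact (contDiff_apply ℝ ℝ (0 : Fin 2)).mul (contDiff_apply ℝ ℝ (1 : Fin 2)))
    (by
      have h0 : (coord 0 * coord 0 : smoothRing 2) ∈ Ideal.span {f | ∃ i, f = coord i * coord i} :=
        Ideal.subset_span ⟨0, rfl⟩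
      have h1 : (coord 1 * coord 1 : smoothRing 2) ∈ Ideal.span {f | ∃ i, f = coord i * coord i} :=
        Ideal.subset_span ⟨1, rfl⟩
      rintro _ (⟨i, rfl⟩ | rfl | rfl)
      · fin_cases i
        · exact h0
        · exact h1
        · refine mem_of_eq_mul (coord 1 * coord 1) h0 fun x => ?_
          change (x 0 * x 1) * (x 0 * x 1) = (x 1 * x 1) * (x 0 * x 0)
          ring
      · refine mem_of_eq_mul (coord 1) h0 fun x => ?_
        change x 0 * (x 0 * x 1) = x 1 * (x 0 * x 0)
        ring
      · refine mem_of_eq_mul (coord 0) h1 fun x => ?_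
        change x 1 * (x 0 * x 1) = x 0 * (x 1 * x 1)
        ring)

/-- `d ∈ D ↦ (0, 0, d) ∈ D^2 ⊕ D`. -/
def epsMap : Subst DPlus (D 1) :=
  Subst.ofGens (m := 1) (n := 3) (fun x => ![0, 0, x 0])
    (by
      refine contDiff_pi.2 fun i => ?_
      fin_cases i
      · exact contDiff_const
      · exact contDiff_const
      · exact contDiff_apply ℝ ℝ (0 : Fin 1))
    (by
      rintro _ (⟨i, rfl⟩ | rfl | rfl)
      · fin_cases i
        · exact mem_of_eq_zero _ fun x => mul_zero (0 : ℝ)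
        · exact mem_of_eq_zero _ fun x => mul_zero (0 : ℝ)
        · exact Ideal.subset_span ⟨0, rfl⟩
      all_goals
        refine mem_of_eq_zero _ fun x => ?_
        first | exact mul_zero _ | exact zero_mul _)

/-! ### Addition of tangent vectors and strong differences -/

/-- `γ ∈ X ⊗ W_{D(2)}` has the tangent vectors `t₁` and `t₂` as its axes. -/
def IsAddWitness {X : Frol.{u}} (t₁ t₂ : prol X (D 1)) (γ : prol X DTwo) : Prop :=
  prolSubst X axisOne γ = t₁ ∧ prolSubst X axisTwo γ = t₂

open Classical in
/-- The sum `t₁ + t₂` of tangent vectors `t₁`, `t₂`: the diagonal of the `γ ∈ X ⊗ W_{D(2)}` with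
axes `t₁` and `t₂` (it exists and is unique if `X` is microlinear and `t₁`, `t₂` have the same foot
point; otherwise a placeholder). -/
noncomputable def tadd {X : Frol.{u}} (t₁ t₂ : prol X (D 1)) : prol X (D 1) :=
  if h : ∃ γ, IsAddWitness t₁ t₂ γ then prolSubst X diagonal h.choose else t₁

/-- `γ ∈ X ⊗ W_{D^2 ⊕ D}` restricts to `γ₁` along `ψ` and to `γ₂` along `φ`. -/
def IsDiffWitness {X : Frol.{u}} (γ₁ γ₂ : prol X (D 2)) (γ : prol X DPlus) : Prop :=
  prolSubst X psiMap γ = γ₁ ∧ prolSubst X phiMap γ = γ₂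

open Classical in
/-- The strong difference `γ₁ ∸ γ₂` of `γ₁, γ₂ ∈ X ⊗ W_{D^2}`: the restriction to `e` of the
`γ ∈ X ⊗ W_{D^2 ⊕ D}` that restricts to `γ₁` along `(d₁, d₂) ↦ (d₁, d₂, d₁ d₂)` and to `γ₂` along
`(d₁, d₂) ↦ (d₁, d₂, 0)` (it exists and is unique if `X` is microlinear and `γ₁`, `γ₂` agree on
`D(2)`; otherwise a placeholder). -/
noncomputable def strongDiff {X : Frol.{u}} (γ₁ γ₂ : prol X (D 2)) : prol X (D 1) :=
  if h : ∃ γ, IsDiffWitness γ₁ γ₂ γ then prolSubst X epsMap h.choose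
  else zeroProl (D 1) (foot γ₁)

/-! ### Convolutions, icons and the Lie bracket -/

/-- The space `[M ⊗ W_{D^p} → M]`. -/
def E (M : Frol.{u}) (p : ℕ) : Frol.{u} := (prol M (D p)).exp M

/-- The Dirac distribution `δ_M^p`. -/
def dirac (M : Frol.{u}) (p : ℕ) : E M p := ⟨foot, isSmooth_foot M (D p)⟩

/-- An element `ξ ∈ [M ⊗ W_{D^p} → M] ⊗ W_{D^n}` over the Dirac distribution is an `(n, p)`-icon. -/
def IsIcon {M : Frol.{u}} {n p : ℕ} (ξ : prol (E M p) (D n)) : Prop := foot ξ = dirac M p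

/-- The operation `η ↦ η^s`, precomposition with
`M ⊗ W_{d ∈ D^m ↦ (d_{s(1)}, …, d_{s(n)}) ∈ D^n}`. -/
def relabel {M : Frol.{u}} {m n : ℕ} (s : Fin n → Fin m) (η : E M m) : E M n :=
  ⟨fun x => η.1 (prolSubst M (coordSubst s) x), η.2.comp (isSmooth_prolSubst M (coordSubst s))⟩

theorem isSmooth_relabel {M : Frol.{u}} {m n : ℕ} (s : Fin n → Fin m) :
    IsSmooth (E M m) (E M n) (relabel s) :=
  isSmooth_precomp M (isSmooth_prolSubst M (coordSubst s))

/-- The operation `ξ ↦ ξ^s` on `[M ⊗ W_{D^m} → M] ⊗ W_{D^k}`. -/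
def iconRelabel {M : Frol.{u}} {m n k : ℕ} (s : Fin n → Fin m) (ξ : prol (E M m) (D k)) :
    prol (E M n) (D k) :=
  prolMap (D k) (relabel s) (isSmooth_relabel s) ξ

/-- The convolution `η₁ ∗ η₂`:
`M ⊗ W_{D^{p+q}} = (M ⊗ W_{D^q}) ⊗ W_{D^p} ⟶ M ⊗ W_{D^p} ⟶ M` given by `η₂ ⊗ id` and `η₁`. -/
noncomputable def conv {M : Frol.{u}} (hM : WeilExponentiable M) {p q : ℕ} (η₁ : E M p)
    (η₂ : E M q) : E M (p + q) :=
  ⟨fun x => η₁.1 (prolMap (D p) η₂.1 η₂.2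
      (split (D q) (D p) (prolSubst M (tensorSubst (finAddFlip : Fin (p + q) ≃ Fin (q + p))) x))),
    η₁.2.comp ((isSmooth_prolMap (D p) η₂.2).comp
      ((isSmooth_split hM (D q) (D p)).comp (isSmooth_prolSubst M _)))⟩

/-- The convolution `η₁ ∗~ η₂`:
`M ⊗ W_{D^{p+q}} = (M ⊗ W_{D^p}) ⊗ W_{D^q} ⟶ M ⊗ W_{D^q} ⟶ M` given by `η₁ ⊗ id` and `η₂`. -/
noncomputable def convT {M : Frol.{u}} (hM : WeilExponentiable M) {p q : ℕ} (η₁ : E M p)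
    (η₂ : E M q) : E M (p + q) :=
  ⟨fun x => η₂.1 (prolMap (D q) η₁.1 η₁.2
      (split (D p) (D q) (prolSubst M (tensorSubst fun i => i) x))),
    η₂.2.comp ((isSmooth_prolMap (D q) η₁.2).comp
      ((isSmooth_split hM (D p) (D q)).comp (isSmooth_prolSubst M _)))⟩

open Classical in
/-- `f ⊗ id_W` for a map `f` whose smoothness is decided classically (a placeholder value if `f` is
not smooth). -/
noncomputable def prolMapOf {X : Frol.{u}} {Y : Frol.{v}} (W : Weil) (f : X → Y) (x : prol X W) :
    prol Y W :=
  if hf : IsSmooth X Y f then prolMap W f hf x else zeroProl W (f (foot x))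

/-- The pair of the images of `ξ₁`, `ξ₂` under `(d₁, …, d_{m+n}) ↦ (d₁, …, d_m)` and
`(d₁, …, d_{m+n}) ↦ (d_{m+1}, …, d_{m+n})`, in `(A × B) ⊗ W_{D^{m+n}}`. -/
noncomputable def joint {A : Frol.{u}} {B : Frol.{v}} {m n : ℕ} (ξ₁ : prol A (D m))
    (ξ₂ : prol B (D n)) : prol (A.prod B) (D (m + n)) :=
  prolPair (prolSubst A (coordSubst (Fin.castAdd n)) ξ₁) (prolSubst B (coordSubst (Fin.natAdd m)) ξ₂)

/-- The map `ξ₁ ⊛ ξ₂`. -/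
noncomputable def star {M : Frol.{u}} (hM : WeilExponentiable M) {p q m n : ℕ}
    (ξ₁ : prol (E M p) (D m)) (ξ₂ : prol (E M q) (D n)) : prol (E M (p + q)) (D (m + n)) :=
  prolMapOf (X := (E M p).prod (E M q)) (D (m + n)) (fun η => conv hM η.1 η.2) (joint ξ₁ ξ₂)

/-- The map `ξ₁ ⊛~ ξ₂`. -/
noncomputable def starT {M : Frol.{u}} (hM : WeilExponentiable M) {p q m n : ℕ}
    (ξ₁ : prol (E M p) (D m)) (ξ₂ : prol (E M q) (D n)) : prol (E M (p + q)) (D (m + n)) :=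
  prolMapOf (X := (E M p).prod (E M q)) (D (m + n)) (fun η => convT hM η.1 η.2) (joint ξ₁ ξ₂)

/-- The Lie bracket `[ξ₁, ξ₂]_L = (ξ₁ ⊛~ ξ₂) ∸ (ξ₁ ⊛ ξ₂)`. -/
noncomputable def lieBracket {M : Frol.{u}} (hM : WeilExponentiable M) {p q : ℕ}
    (ξ₁ : prol (E M p) (D 1)) (ξ₂ : prol (E M q) (D 1)) : prol (E M (p + q)) (D 1) :=
  strongDiff (X := E M (p + q)) (starT hM ξ₁ ξ₂) (star hM ξ₁ ξ₂)

/-- The permutation `σ_{p,q}`: `i ↦ q + i` for `i ≤ p` and `p + j ↦ j` for `j ≤ q`, as a map from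
the positions in `D^{p+q}` to those in `D^{q+p}`. -/
def sigma (p q : ℕ) : Fin (p + q) → Fin (q + p) := finAddFlip

/-- `σ_{p,q+r}`, which carries the order `(q, r, p)` of three blocks of variables to
`(p, q, r)`. -/
def sigmaOne (p q r : ℕ) (i : Fin (p + (q + r))) : Fin (q + (r + p)) :=
  Fin.cast (Nat.add_assoc q r p) (sigma p (q + r) i)

/-- `σ_{p+q,r}`, which carries the order `(r, p, q)` of three blocks of variables to
`(p, q, r)`. -/
def sigmaTwo (p q r : ℕ) (i : Fin (p + (q + r))) : Fin (r + (p + q)) :=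
  sigma (p + q) r (Fin.cast (Nat.add_assoc p q r).symm i)

end Frolicher

/-!
The proof reduces the Jacobi identity to a cancellation of third derivatives of real functions.

*Curves in function spaces.* `[Y → X]` carries the structure generated by the curves `c` for which
`(s, y) ↦ c s y` is smooth. All structure curves have this property (`curves_exp`), so that Frölicher
spaces are cartesian closed. For a structure curve `c`, the function `F(s, t) = h(c(s)(b(t)))` becomes
smooth in `s` after applying to it any of the functionals `g ↦ ∑ wₙ g⁽ᵏ⁾(tₙ)` in the second variable.
A Banach–Steinhaus argument on `ℓ¹` then bounds the derivatives in `s` and in `t` locally, and a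
function of two variables whose pure derivatives of all orders are locally bounded is smooth, which is
seen on its double Fourier series (`contDiff_of_separate`). The same criterion gives Boman's theorem
in two variables (`boman`). Smoothness of both convolutions follows.

*The two limit diagrams.* `W_{D(2)}` and `W_{D² ⊕ D}` are pullbacks of algebras, by Hadamard's lemma
(`isWeilPullback_DTwo`, `isWeilPullback_DPlus`). Microlinearity of `M` turns them into pullbacks of
prolongations of `M`, and Weil exponentiability carries these over to `[Y → M]` pointwise
(`existsUnique_prol_exp`). As the Dirac distribution satisfies `η ∗ δ = η ∗~ δ` and
`δ ∗ η = δ ∗~ η`, the functions `Φ(a(s) ∗~ b(t)) - Φ(a(s) ∗ b(t))` vanish on both axes for icons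
represented by curves `a`, `b`; so the two convolutions of icons agree on `D(2)` and the bracket is
defined.

*The Jacobi identity.* A tangent vector is determined by its foot point and by the derivatives of the
structure functions along it (`tangent_ext`). In these terms sums of tangent vectors are sums of
derivatives, and a strong difference is a difference of mixed second derivatives (`der_lieBracket`).
An iterated bracket of icons represented by curves is therefore an alternating sum of third
derivatives of `Φ` on the four iterated convolutions (`der_lieBracket_lieBracket`). Written out on
representatives, each of the twelve iterated convolutions that occur applies the three operators in
one of the six possible orders, so they coincide in pairs up to relabelling of the variables
(`convT_convT_eq` and its companions), and the paired terms carry opposite signs.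
-/

namespace Frolicher

/-! ### Separate smoothness in two real variables -/

/-- The character `s ↦ exp (2 π i m s)`. -/
noncomputable def expChar (m : ℤ) (s : ℝ) : ℂ := Complex.exp ((2 * Real.pi * m * s : ℝ) * Complex.I)

/-- The `m`-th Fourier coefficient over `[0, 1]`. -/
noncomputable def fcoef (φ : ℝ → ℂ) (m : ℤ) : ℂ := ∫ s in (0 : ℝ)..1, expChar (-m) s * φ s

theorem norm_expChar (m : ℤ) (s : ℝ) : ‖expChar m s‖ = 1 := Complex.norm_exp_ofReal_mul_I _

theorem hasDerivAt_expChar (m : ℤ) (s : ℝ) :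
    HasDerivAt (expChar m) ((2 * Real.pi * m : ℝ) * Complex.I * expChar m s) s := by
  have h1 : HasDerivAt (fun s : ℝ => ((2 * Real.pi * m * s : ℝ) : ℂ) * Complex.I)
      ((2 * Real.pi * m : ℝ) * Complex.I) s := by
    have := ((hasDerivAt_id s).const_mul (2 * Real.pi * m)).ofReal_comp.mul_const Complex.I
    simpa using this
  exact h1.cexp.congr_deriv (mul_comm _ _)

theorem contDiff_expChar (m : ℤ) : ContDiff ℝ ∞ (expChar m) := by
  unfold expChar
  have h : ContDiff ℝ ∞ fun s : ℝ => (((2 * Real.pi * m * s : ℝ) : ℂ)) :=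
    Complex.ofRealCLM.contDiff.comp (contDiff_const.mul contDiff_id)
  exact (h.mul contDiff_const).cexp

theorem norm_iteratedDeriv_expChar (m : ℤ) (k : ℕ) (s : ℝ) :
    ‖iteratedDeriv k (expChar m) s‖ = |2 * Real.pi * m| ^ k := by
  have : iteratedDeriv k (expChar m) =
      fun s => ((2 * Real.pi * m : ℝ) * Complex.I) ^ k * expChar m s := by
    induction k with
    | zero => funext s; simp
    | succ k ih =>
      rw [iteratedDeriv_succ, ih]
      funext s
      rw [((hasDerivAt_expChar m s).const_mul _).deriv]
      ring
  rw [this, norm_mul, norm_pow, norm_mul, norm_expChar, Complex.norm_I, Complex.norm_real]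
  simp

theorem contDiff_iteratedDeriv {E : Type*} [NormedAddCommGroup E] [NormedSpace ℝ E] {f : ℝ → E}
    (hf : ContDiff ℝ ∞ f) (k : ℕ) : ContDiff ℝ ∞ (iteratedDeriv k f) := by
  rw [iteratedDeriv_eq_iterate]
  exact hf.iterate_deriv k

theorem norm_fcoef_le {φ : ℝ → ℂ} {C : ℝ} (h : ∀ s, ‖φ s‖ ≤ C) (m : ℤ) : ‖fcoef φ m‖ ≤ C := by
  have := intervalIntegral.norm_integral_le_of_norm_le_const (a := (0 : ℝ)) (b := 1)
    (f := fun s => expChar (-m) s * φ s) (C := C) (fun s _ => by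
      rw [norm_mul, norm_expChar, one_mul]; exact h s)
  simpa [fcoef] using this

/-- Integration by parts, for functions supported in the interior of `[0, 1]`. -/
theorem fcoef_deriv {φ : ℝ → ℂ} (hφ : ContDiff ℝ ∞ φ) (h0 : φ 0 = 0) (h1 : φ 1 = 0) (m : ℤ) :
    fcoef (deriv φ) m = (2 * Real.pi * m : ℝ) * Complex.I * fcoef φ m := by
  have hd : ∀ s, HasDerivAt φ (deriv φ s) s := fun s =>
    ((hφ.differentiable (by simp)) s).hasDerivAt
  have hc : Continuous (deriv φ) := hφ.continuous_deriv (by simp)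
  have := intervalIntegral.integral_mul_deriv_eq_deriv_mul (a := (0 : ℝ)) (b := 1)
    (u := expChar (-m)) (v := φ) (fun s _ => hasDerivAt_expChar (-m) s) (fun s _ => hd s)
    ((continuous_const.mul (contDiff_expChar (-m)).continuous).intervalIntegrable 0 1)
    (hc.intervalIntegrable 0 1)
  unfold fcoef
  rw [this, h0, h1, ← intervalIntegral.integral_const_mul]
  simp only [mul_zero, sub_zero, zero_sub, ← intervalIntegral.integral_neg]
  congr 1
  funext s
  push_cast
  ring

theorem iteratedDeriv_eq_zero_of_support {φ : ℝ → ℂ}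
    (hs : ∀ s, s ∉ Set.Icc (1 / 4 : ℝ) (3 / 4) → φ s = 0) (k : ℕ) {s : ℝ}
    (h : s ∉ Set.Icc (1 / 4 : ℝ) (3 / 4)) : iteratedDeriv k φ s = 0 := by
  have : φ =ᶠ[nhds s] fun _ => 0 :=
    Filter.eventually_of_mem (isClosed_Icc.isOpen_compl.mem_nhds h) fun x hx => hs x hx
  rw [this.iteratedDeriv_eq k]
  simp

/-- Repeated integration by parts: `k` bounded derivatives give decay of order `k`. -/
theorem fcoef_decay {φ : ℝ → ℂ} (hφ : ContDiff ℝ ∞ φ)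
    (hs : ∀ s, s ∉ Set.Icc (1 / 4 : ℝ) (3 / 4) → φ s = 0) (k : ℕ) {C : ℝ}
    (hC : ∀ s, ‖iteratedDeriv k φ s‖ ≤ C) (m : ℤ) : ‖fcoef φ m‖ * |(m : ℝ)| ^ k ≤ C := by
  have key : ∀ k : ℕ, fcoef (iteratedDeriv k φ) m =
      ((2 * Real.pi * m : ℝ) * Complex.I) ^ k * fcoef φ m := by
    intro k
    induction k with
    | zero => simp
    | succ k ih =>
      rw [iteratedDeriv_succ, fcoef_deriv (contDiff_iteratedDeriv hφ k)
        (iteratedDeriv_eq_zero_of_support hs k (by norm_num))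
        (iteratedDeriv_eq_zero_of_support hs k (by norm_num)), ih]
      ring
  have h1 := norm_fcoef_le hC m
  rw [key k, norm_mul, norm_pow, norm_mul, Complex.norm_I, Complex.norm_real, mul_one,
    Real.norm_eq_abs, mul_comm] at h1
  refine le_trans (mul_le_mul_of_nonneg_left (pow_le_pow_left₀ (abs_nonneg _) ?_ k)
    (norm_nonneg _)) h1
  rw [abs_mul]
  refine le_mul_of_one_le_left (abs_nonneg _) ?_
  rw [abs_of_pos (by positivity)]
  nlinarith [Real.pi_gt_three]

/-- Fourier inversion on `[0, 1)` for summable coefficients. -/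
theorem hasSum_fcoef {φ : ℝ → ℂ} (hφ : Continuous φ) (h01 : φ 0 = φ 1)
    (hsum : Summable (fcoef φ)) {s : ℝ} (hs : s ∈ Set.Ico (0 : ℝ) 1) :
    HasSum (fun m : ℤ => fcoef φ m * expChar m s) (φ s) := by
  have : Fact ((0 : ℝ) < 1) := ⟨one_pos⟩
  let f : C(AddCircle (1 : ℝ), ℂ) := ⟨AddCircle.liftIco 1 0 φ,
    AddCircle.liftIco_zero_continuous h01 hφ.continuousOn⟩
  have hco : ∀ m : ℤ, fourierCoeff f m = fcoef φ m := by
    intro m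
    have : fourierCoeff f m = fourierCoeffOn (lt_add_of_pos_right (0 : ℝ) one_pos) φ m :=
      fourierCoeff_liftIco_eq (T := 1) (a := 0) φ m
    rw [this, fourierCoeffOn_eq_integral]
    simp only [zero_add, sub_zero, div_one, one_smul, fcoef]
    congr 1
    funext s
    rw [smul_eq_mul]
    congr 1
    have := fourier_coe_apply (T := 0 + 1 - 0) (n := -m) (x := s)
    rw [this, expChar]
    congr 1
    push_cast
    ring
  have h := has_pointwise_sum_fourier_series_of_summable (f := f)
    (hsum.congr fun m => (hco m).symm) (s : AddCircle (1 : ℝ))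
  have e : f (s : AddCircle (1 : ℝ)) = φ s :=
    AddCircle.liftIco_coe_apply (p := 1) (a := 0) (by simpa using hs)
  rw [e] at h
  convert h using 2 with m
  rw [hco, smul_eq_mul, fourier_coe_apply, expChar]
  congr 2
  push_cast
  ring

theorem one_add_mul_one_add_pow_le {x y : ℤ} (k : ℕ) :
    ((1 + |(x : ℝ)|) * (1 + |(y : ℝ)|)) ^ k ≤
      1 + 4 ^ k * (|(x : ℝ)| ^ (2 * k) + |(y : ℝ)| ^ (2 * k)) := by
  have aux : ∀ a b : ℤ, |(a : ℝ)| ≤ |(b : ℝ)| → ((1 + |(a : ℝ)|) * (1 + |(b : ℝ)|)) ^ k ≤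
      1 + 4 ^ k * |(b : ℝ)| ^ (2 * k) := by
    intro a b hab
    rcases eq_or_ne b 0 with rfl | hb
    · have : |(a : ℝ)| = 0 := le_antisymm (by simpa using hab) (abs_nonneg _)
      rw [this]
      have : (0 : ℝ) ≤ 4 ^ k * |((0 : ℤ) : ℝ)| ^ (2 * k) := by positivity
      simp
    · have hb1 : (1 : ℝ) ≤ |(b : ℝ)| := by exact_mod_cast Int.one_le_abs hb
      have h : (1 + |(a : ℝ)|) * (1 + |(b : ℝ)|) ≤ 4 * |(b : ℝ)| ^ 2 := by
        nlinarith [abs_nonneg (a : ℝ)]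
      have h' : ((1 + |(a : ℝ)|) * (1 + |(b : ℝ)|)) ^ k ≤ (4 * |(b : ℝ)| ^ 2) ^ k :=
        pow_le_pow_left₀ (by positivity) h k
      rw [mul_pow 4, ← pow_mul] at h'
      linarith
  have hx : (0 : ℝ) ≤ 4 ^ k * |(x : ℝ)| ^ (2 * k) := by positivity
  have hy : (0 : ℝ) ≤ 4 ^ k * |(y : ℝ)| ^ (2 * k) := by positivity
  rcases le_total |(x : ℝ)| |(y : ℝ)| with h | h
  · linarith [aux x y h]
  · have := aux y x h
    rw [mul_comm (1 + |(y : ℝ)|)] at this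
    linarith

theorem summable_one_add_abs_inv_sq : Summable fun m : ℤ => (((1 + |(m : ℝ)|) ^ 2)⁻¹ : ℝ) := by
  have h := (Real.summable_one_div_int_pow (p := 2)).2 (by norm_num)
  have h' : Summable fun m : ℤ => (if m = 0 then (1 : ℝ) else 0) + 1 / (m : ℝ) ^ 2 :=
    (summable_of_hasFiniteSupport (Set.Finite.subset (Set.finite_singleton (0 : ℤ))
      fun m hm => by by_contra hne; simp_all)).add h
  refine Summable.of_nonneg_of_le (fun m => by positivity) (fun m => ?_) h'
  rcases eq_or_ne m 0 with rfl | hm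
  · simp
  · rw [if_neg hm, zero_add, one_div, ← sq_abs (m : ℝ)]
    have : (0 : ℝ) < |(m : ℝ)| := by positivity
    gcongr
    linarith

theorem norm_iteratedFDeriv_comp_clm_le {φ : ℝ → ℂ} (hφ : ContDiff ℝ ∞ φ) {L : ℝ × ℝ →L[ℝ] ℝ}
    (hL : ‖L‖ ≤ 1) (k : ℕ) (z : ℝ × ℝ) :
    ‖iteratedFDeriv ℝ k (fun z => φ (L z)) z‖ ≤ ‖iteratedDeriv k φ (L z)‖ := by
  have h := L.iteratedFDeriv_comp_right hφ z (i := k) (by exact_mod_cast le_top)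
  change iteratedFDeriv ℝ k (fun z => φ (L z)) z = _ at h
  rw [h, ← norm_iteratedFDeriv_eq_norm_iteratedDeriv]
  refine (ContinuousMultilinearMap.norm_compContinuousLinearMap_le _ _).trans ?_
  refine mul_le_of_le_one_right (norm_nonneg _) ?_
  rw [Finset.prod_const]
  exact pow_le_one₀ (norm_nonneg _) hL

theorem norm_iteratedFDeriv_expChar_mul_le (m n : ℤ) (k : ℕ) (z : ℝ × ℝ) :
    ‖iteratedFDeriv ℝ k (fun z : ℝ × ℝ => expChar m z.1 * expChar n z.2) z‖ ≤
      (2 * Real.pi) ^ k * ((1 + |(m : ℝ)|) * (1 + |(n : ℝ)|)) ^ k := by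
  have hfst : ∀ m : ℤ, ContDiff ℝ ∞ fun z : ℝ × ℝ => expChar m z.1 := fun m =>
    (contDiff_expChar m).comp contDiff_fst
  have hsnd : ∀ m : ℤ, ContDiff ℝ ∞ fun z : ℝ × ℝ => expChar m z.2 := fun m =>
    (contDiff_expChar m).comp contDiff_snd
  have bfst : ∀ (m : ℤ) (k : ℕ) (z : ℝ × ℝ),
      ‖iteratedFDeriv ℝ k (fun z : ℝ × ℝ => expChar m z.1) z‖ ≤ |2 * Real.pi * m| ^ k :=
    fun m k z => (norm_iteratedFDeriv_comp_clm_le (contDiff_expChar m)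
      (ContinuousLinearMap.norm_fst_le ℝ ℝ ℝ) k z).trans (norm_iteratedDeriv_expChar m k _).le
  have bsnd : ∀ (m : ℤ) (k : ℕ) (z : ℝ × ℝ),
      ‖iteratedFDeriv ℝ k (fun z : ℝ × ℝ => expChar m z.2) z‖ ≤ |2 * Real.pi * m| ^ k :=
    fun m k z => (norm_iteratedFDeriv_comp_clm_le (contDiff_expChar m)
      (ContinuousLinearMap.norm_snd_le ℝ ℝ ℝ) k z).trans (norm_iteratedDeriv_expChar m k _).le
  refine (norm_iteratedFDeriv_mul_le (hfst m) (hsnd n) z (n := k)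
    (by exact_mod_cast le_top)).trans ?_
  have hle : (|2 * Real.pi * m| + |2 * Real.pi * n|) ^ k ≤
      (2 * Real.pi) ^ k * ((1 + |(m : ℝ)|) * (1 + |(n : ℝ)|)) ^ k := by
    rw [← mul_pow, abs_mul, abs_mul _ (n : ℝ), abs_of_pos (by positivity : 0 < 2 * Real.pi)]
    refine pow_le_pow_left₀ (by positivity) ?_ k
    have := Real.pi_pos
    have hmn := mul_nonneg (abs_nonneg (m : ℝ)) (abs_nonneg (n : ℝ))
    rw [← mul_add]
    refine mul_le_mul_of_nonneg_left ?_ (by positivity)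
    nlinarith
  refine le_trans ?_ hle
  rw [add_pow]
  refine Finset.sum_le_sum fun j _ => ?_
  have := mul_le_mul (bfst m j z) (bsnd n (k - j) z) (norm_nonneg _) (by positivity)
  calc _ = (k.choose j : ℝ) * (‖iteratedFDeriv ℝ j (fun z : ℝ × ℝ => expChar m z.1) z‖ *
        ‖iteratedFDeriv ℝ (k - j) (fun z : ℝ × ℝ => expChar n z.2) z‖) := by ring
    _ ≤ (k.choose j : ℝ) * (|2 * Real.pi * m| ^ j * |2 * Real.pi * n| ^ (k - j)) := by gcongr
    _ = _ := by ring

/-- A doubly indexed trigonometric series with rapidly decreasing coefficients is smooth. -/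
theorem contDiff_doubleFourier {B : ℤ → ℤ → ℂ}
    (hB : ∀ k : ℕ, ∃ C : ℝ, ∀ m n, ‖B m n‖ * ((1 + |(m : ℝ)|) * (1 + |(n : ℝ)|)) ^ k ≤ C) :
    ContDiff ℝ ∞ fun z : ℝ × ℝ =>
      ∑' i : ℤ × ℤ, B i.1 i.2 * (expChar i.1 z.1 * expChar i.2 z.2) := by
  choose C hC using hB
  have hsum := summable_one_add_abs_inv_sq.mul_of_nonneg summable_one_add_abs_inv_sq
    (fun m => by positivity) (fun m => by positivity)
  have hfst : ∀ m : ℤ, ContDiff ℝ ∞ fun z : ℝ × ℝ => expChar m z.1 := fun m =>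
    (contDiff_expChar m).comp contDiff_fst
  have hsnd : ∀ m : ℤ, ContDiff ℝ ∞ fun z : ℝ × ℝ => expChar m z.2 := fun m =>
    (contDiff_expChar m).comp contDiff_snd
  have hterm : ∀ i : ℤ × ℤ, ContDiff ℝ ∞ fun z : ℝ × ℝ =>
      B i.1 i.2 • (expChar i.1 z.1 * expChar i.2 z.2) :=
    fun i => ((hfst i.1).mul (hsnd i.2)).const_smul (B i.1 i.2)
  have hbound : ∀ (k : ℕ) (i : ℤ × ℤ) (z : ℝ × ℝ),
      ‖iteratedFDeriv ℝ k (fun z : ℝ × ℝ => B i.1 i.2 • (expChar i.1 z.1 * expChar i.2 z.2)) z‖ ≤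
        (2 * Real.pi) ^ k * C (k + 2) *
          (((1 + |(i.1 : ℝ)|) ^ 2)⁻¹ * ((1 + |(i.2 : ℝ)|) ^ 2)⁻¹) := by
    rintro k ⟨m, n⟩ z
    have h1 := norm_iteratedFDeriv_expChar_mul_le m n k z
    have hs : ContDiffAt ℝ k (fun z : ℝ × ℝ => expChar m z.1 * expChar n z.2) z :=
      ((hfst m).mul (hsnd n)).contDiffAt.of_le (by exact_mod_cast le_top)
    rw [iteratedFDeriv_const_smul_apply' hs, norm_smul]
    have h3 := hC (k + 2) m n
    set P : ℝ := (1 + |(m : ℝ)|) * (1 + |(n : ℝ)|) with hP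
    have hPpos : 0 < P := by positivity
    have h4 : ‖B m n‖ * P ^ k ≤ C (k + 2) * (P ^ 2)⁻¹ := by
      rw [← div_eq_mul_inv, le_div_iff₀ (by positivity), mul_assoc, ← pow_add]
      exact h3
    calc _ ≤ ‖B m n‖ * ((2 * Real.pi) ^ k * P ^ k) := by gcongr
      _ = (2 * Real.pi) ^ k * (‖B m n‖ * P ^ k) := by ring
      _ ≤ (2 * Real.pi) ^ k * (C (k + 2) * (P ^ 2)⁻¹) := by gcongr
      _ = _ := by rw [hP, mul_pow (1 + |(m : ℝ)|), mul_inv]; ring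
  exact contDiff_tsum (N := (⊤ : ℕ∞)) hterm (fun k _ => hsum.mul_left _)
    (fun k i z _ => hbound k i z)

theorem summable_fcoef {φ : ℝ → ℂ} {C : ℝ}
    (h : ∀ m : ℤ, ‖fcoef φ m‖ * (1 + |(m : ℝ)|) ^ 2 ≤ C) : Summable (fcoef φ) := by
  refine Summable.of_norm_bounded (summable_one_add_abs_inv_sq.mul_left C) fun m => ?_
  rw [← div_eq_mul_inv, le_div_iff₀ (by positivity)]
  exact h m

theorem continuous_uncurry_of_separate {G : ℝ → ℝ → ℂ}
    (h1 : ∀ t, ContDiff ℝ ∞ fun s => G s t) (h2 : ∀ s, ContDiff ℝ ∞ (G s)) {C : ℝ}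
    (hC : ∀ s t, ‖iteratedDeriv 1 (fun s => G s t) s‖ ≤ C) : Continuous (Function.uncurry G) := by
  refine continuous_prod_of_continuous_lipschitzWith _ C.toNNReal (fun s => (h2 s).continuous)
    fun t => ?_
  refine lipschitzWith_of_nnnorm_deriv_le ((h1 t).differentiable (by simp)) fun s => ?_
  have := hC s t
  rw [iteratedDeriv_one] at this
  exact NNReal.le_toNNReal_of_coe_le this

/-- A function supported in the interior of the unit square all of whose pure partial derivatives
are bounded is the sum of its double Fourier series, hence smooth. -/
theorem exists_contDiff_of_separate {G : ℝ → ℝ → ℂ}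
    (h1 : ∀ t, ContDiff ℝ ∞ fun s => G s t) (h2 : ∀ s, ContDiff ℝ ∞ (G s))
    (z1 : ∀ s t, s ∉ Set.Icc (1 / 4 : ℝ) (3 / 4) → G s t = 0)
    (z2 : ∀ s t, t ∉ Set.Icc (1 / 4 : ℝ) (3 / 4) → G s t = 0)
    (b1 : ∀ k : ℕ, ∃ C : ℝ, ∀ s t, ‖iteratedDeriv k (fun s => G s t) s‖ ≤ C)
    (b2 : ∀ k : ℕ, ∃ C : ℝ, ∀ s t, ‖iteratedDeriv k (G s) t‖ ≤ C) :
    ∃ K : ℝ × ℝ → ℂ, ContDiff ℝ ∞ K ∧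
      ∀ s ∈ Set.Ico (0 : ℝ) 1, ∀ t ∈ Set.Ico (0 : ℝ) 1, G s t = K (s, t) := by
  choose C1 hC1 using b1
  choose C2 hC2 using b2
  have hcont : Continuous (Function.uncurry G) := continuous_uncurry_of_separate h1 h2 (hC1 1)
  set A : ℤ → ℝ → ℂ := fun m t => fcoef (fun s => G s t) m with hA
  set B : ℤ → ℤ → ℂ := fun m n => fcoef (A m) n with hB
  have hAc : ∀ m, Continuous (A m) := fun m => by
    refine intervalIntegral.continuous_parametric_intervalIntegral_of_continuous' ?_ 0 1
    exact ((contDiff_expChar (-m)).continuous.comp continuous_snd).mul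
      (hcont.comp continuous_swap)
  have hA0 : ∀ m t, t ∉ Set.Icc (1 / 4 : ℝ) (3 / 4) → A m t = 0 := fun m t ht => by
    simp [hA, fcoef, z2 _ t ht]
  have hAb : ∀ (k : ℕ) m t, ‖A m t‖ * |(m : ℝ)| ^ k ≤ C1 k := fun k m t =>
    fcoef_decay (h1 t) (fun s hs => z1 s t hs) k (fun s => hC1 k s t) m
  have hB1 : ∀ (k : ℕ) m n, ‖B m n‖ * |(m : ℝ)| ^ k ≤ C1 k := by
    intro k m n
    have : B m n * ((|(m : ℝ)| ^ k : ℝ) : ℂ) =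
        fcoef (fun t => A m t * ((|(m : ℝ)| ^ k : ℝ) : ℂ)) n := by
      simp only [hB, fcoef, ← intervalIntegral.integral_mul_const, mul_assoc]
    have h3 : ‖B m n * ((|(m : ℝ)| ^ k : ℝ) : ℂ)‖ ≤ C1 k := by
      rw [this]
      refine norm_fcoef_le (fun t => ?_) n
      rw [norm_mul, Complex.norm_real, Real.norm_of_nonneg (by positivity)]
      exact hAb k m t
    rwa [norm_mul, Complex.norm_real, Real.norm_of_nonneg (by positivity)] at h3
  have hswap : ∀ m n, B m n = fcoef (fun s => fcoef (G s) n) m := by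
    intro m n
    simp only [hB, hA, fcoef, ← intervalIntegral.integral_const_mul]
    rw [MeasureTheory.intervalIntegral_intervalIntegral_swap]
    · congr 1
      funext s
      congr 1
      funext t
      ring
    · have hc : Continuous (Function.uncurry fun t s : ℝ =>
          expChar (-n) t * (expChar (-m) s * G s t)) :=
        ((contDiff_expChar (-n)).continuous.comp continuous_fst).mul
          (((contDiff_expChar (-m)).continuous.comp continuous_snd).mul
            (hcont.comp continuous_swap))
      exact (hc.continuousOn.integrableOn_compact
        (isCompact_uIcc.prod isCompact_uIcc)).mono_set
          (Set.prod_mono Set.uIoc_subset_uIcc Set.uIoc_subset_uIcc)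
  have hB2 : ∀ (k : ℕ) m n, ‖B m n‖ * |(n : ℝ)| ^ k ≤ C2 k := by
    intro k m n
    have : B m n * ((|(n : ℝ)| ^ k : ℝ) : ℂ) =
        fcoef (fun s => fcoef (G s) n * ((|(n : ℝ)| ^ k : ℝ) : ℂ)) m := by
      rw [hswap]
      unfold fcoef
      simp only [← intervalIntegral.integral_mul_const, mul_assoc]
    have h3 : ‖B m n * ((|(n : ℝ)| ^ k : ℝ) : ℂ)‖ ≤ C2 k := by
      rw [this]
      refine norm_fcoef_le (fun s => ?_) m
      rw [norm_mul, Complex.norm_real, Real.norm_of_nonneg (by positivity)]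
      exact fcoef_decay (h2 s) (fun t ht => z2 s t ht) k (fun t => hC2 k s t) n
    rwa [norm_mul, Complex.norm_real, Real.norm_of_nonneg (by positivity)] at h3
  have hBk : ∀ k : ℕ, ∃ C : ℝ, ∀ m n,
      ‖B m n‖ * ((1 + |(m : ℝ)|) * (1 + |(n : ℝ)|)) ^ k ≤ C := by
    intro k
    refine ⟨C1 0 + 4 ^ k * (C1 (2 * k) + C2 (2 * k)), fun m n => ?_⟩
    have h0 := hB1 0 m n
    rw [pow_zero, mul_one] at h0
    have ha := hB1 (2 * k) m n
    have hb := hB2 (2 * k) m n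
    calc ‖B m n‖ * ((1 + |(m : ℝ)|) * (1 + |(n : ℝ)|)) ^ k
        ≤ ‖B m n‖ * (1 + 4 ^ k * (|(m : ℝ)| ^ (2 * k) + |(n : ℝ)| ^ (2 * k))) := by
          gcongr
          exact one_add_mul_one_add_pow_le k
      _ = ‖B m n‖ + 4 ^ k * (‖B m n‖ * |(m : ℝ)| ^ (2 * k) + ‖B m n‖ * |(n : ℝ)| ^ (2 * k)) := by
          ring
      _ ≤ _ := by gcongr
  have hone : ∀ (f : ℤ → ℂ) (D : ℕ → ℝ), (∀ (k : ℕ) m, ‖f m‖ * |(m : ℝ)| ^ k ≤ D k) →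
      ∀ m : ℤ, ‖f m‖ * (1 + |(m : ℝ)|) ^ 2 ≤ D 0 + 2 * D 1 + D 2 := by
    intro f D h m
    have e0 := h 0 m
    have e1 := h 1 m
    have e2 := h 2 m
    rw [pow_zero, mul_one] at e0
    rw [pow_one] at e1
    nlinarith
  refine ⟨_, contDiff_doubleFourier hBk, fun s hs t ht => ?_⟩
  have hsB : Summable fun i : ℤ × ℤ => B i.1 i.2 * (expChar i.1 s * expChar i.2 t) := by
    obtain ⟨C, hC⟩ := hBk 2
    refine Summable.of_norm_bounded ((summable_one_add_abs_inv_sq.mul_of_nonneg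
      summable_one_add_abs_inv_sq (fun m => by positivity) (fun m => by positivity)).mul_left C)
      fun i => ?_
    rw [norm_mul, norm_mul, norm_expChar, norm_expChar, mul_one, mul_one, ← mul_inv, ← mul_pow,
      ← div_eq_mul_inv, le_div_iff₀ (by positivity)]
    exact hC i.1 i.2
  have e1 : HasSum (fun m : ℤ => A m t * expChar m s) (G s t) :=
    hasSum_fcoef (h1 t).continuous
      ((z1 0 t (by norm_num)).trans (z1 1 t (by norm_num)).symm)
      (summable_fcoef (hone (fun m => A m t) C1 fun k m => hAb k m t)) hs
  have e2 : ∀ m, HasSum (fun n : ℤ => B m n * expChar n t) (A m t) := fun m =>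
    hasSum_fcoef (hAc m) ((hA0 m 0 (by norm_num)).trans (hA0 m 1 (by norm_num)).symm)
      (summable_fcoef (hone (B m) C2 fun k n => hB2 k m n)) ht
  change G s t = ∑' i : ℤ × ℤ, B i.1 i.2 * (expChar i.1 s * expChar i.2 t)
  rw [hsB.tsum_prod, ← e1.tsum_eq]
  refine tsum_congr fun m => ?_
  rw [← (e2 m).tsum_eq, ← tsum_mul_right]
  exact tsum_congr fun n => by ring

/-- Bounds for the derivatives of a family of functions on the support of a cutoff function carry over
to the products, by Leibniz's rule. -/
theorem exists_bound_iteratedDeriv_cutoff {ι : Type*} {χ : ℝ → ℝ} (hχ : ContDiff ℝ ∞ χ)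
    (hs : ∀ s, s ∉ Set.Icc (1 / 4 : ℝ) (3 / 4) → χ s = 0) {f : ι → ℝ → ℝ}
    (hf : ∀ i, ContDiff ℝ ∞ (f i))
    (hb : ∀ k : ℕ, ∃ C : ℝ, ∀ i, ∀ s ∈ Set.Icc (1 / 4 : ℝ) (3 / 4), |iteratedDeriv k (f i) s| ≤ C)
    (k : ℕ) : ∃ C : ℝ, ∀ i s, ‖iteratedDeriv k (fun s => ((χ s * f i s : ℝ) : ℂ)) s‖ ≤ C := by
  have hχb : ∀ k : ℕ, ∃ C : ℝ, ∀ s ∈ Set.Icc (1 / 4 : ℝ) (3 / 4), ‖iteratedDeriv k χ s‖ ≤ C :=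
    fun k => isCompact_Icc.exists_bound_of_continuousOn (contDiff_iteratedDeriv hχ k).continuous.continuousOn
  choose C hC using hb
  choose D hD using hχb
  have hnn : (1 / 2 : ℝ) ∈ Set.Icc (1 / 4 : ℝ) (3 / 4) := by constructor <;> norm_num
  refine ⟨∑ j ∈ Finset.range (k + 1), k.choose j * D j * |C (k - j)|, fun i s => ?_⟩
  by_cases h : s ∈ Set.Icc (1 / 4 : ℝ) (3 / 4)
  · have e : ‖iteratedDeriv k (fun s => ((χ s * f i s : ℝ) : ℂ)) s‖ =
        ‖iteratedFDeriv ℝ k (fun s => χ s * f i s) s‖ := by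
      rw [← norm_iteratedFDeriv_eq_norm_iteratedDeriv]
      exact Complex.ofRealLI.norm_iteratedFDeriv_comp_left (i := k) (x := s)
        ((hχ.mul (hf i)).contDiffAt) (by exact_mod_cast le_top)
    rw [e]
    refine (norm_iteratedFDeriv_mul_le hχ (hf i) s (n := k) (by exact_mod_cast le_top)).trans ?_
    refine Finset.sum_le_sum fun j _ => ?_
    rw [norm_iteratedFDeriv_eq_norm_iteratedDeriv, norm_iteratedFDeriv_eq_norm_iteratedDeriv]
    have h1 := hD j s h
    have h2 := (hC (k - j) i s h).trans (le_abs_self _)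
    rw [← Real.norm_eq_abs] at h2
    have h3 : 0 ≤ D j := (norm_nonneg _).trans h1
    gcongr
  · rw [iteratedDeriv_eq_zero_of_support (fun s hs' => by rw [hs s hs']; simp) k h, norm_zero]
    refine Finset.sum_nonneg fun j _ => ?_
    have h3 : 0 ≤ D j := (norm_nonneg _).trans (hD j _ hnn)
    positivity

/-- A function of two real variables is smooth if it is smooth in each variable separately and its
pure partial derivatives are locally bounded. -/
theorem contDiff_of_separate {F : ℝ → ℝ → ℝ}
    (h1 : ∀ t, ContDiff ℝ ∞ fun s => F s t) (h2 : ∀ s, ContDiff ℝ ∞ (F s))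
    (b1 : ∀ (k : ℕ) (R : ℝ), ∃ C : ℝ, ∀ s t, |s| ≤ R → |t| ≤ R →
      |iteratedDeriv k (fun s => F s t) s| ≤ C)
    (b2 : ∀ (k : ℕ) (R : ℝ), ∃ C : ℝ, ∀ s t, |s| ≤ R → |t| ≤ R → |iteratedDeriv k (F s) t| ≤ C) :
    ContDiff ℝ ∞ (Function.uncurry F) := by
  rw [contDiff_iff_contDiffAt]
  rintro ⟨s₀, t₀⟩
  let χ : ContDiffBump (1 / 2 : ℝ) := ⟨1 / 8, 1 / 4, by norm_num, by norm_num⟩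
  have hχ : ContDiff ℝ ∞ (χ : ℝ → ℝ) := χ.contDiff
  have hχ0 : ∀ s, s ∉ Set.Icc (1 / 4 : ℝ) (3 / 4) → χ s = 0 := by
    intro s hs
    refine χ.zero_of_le_dist ?_
    by_contra hlt
    rw [not_le, Real.dist_eq, abs_lt] at hlt
    have e1 : -(1 / 4 : ℝ) < s - 1 / 2 := hlt.1
    have e2 : s - 1 / 2 < (1 / 4 : ℝ) := hlt.2
    exact hs ⟨by linarith, by linarith⟩
  have hχ1 : ∀ s, |χ s| ≤ 1 := fun s => abs_le.2 ⟨by linarith [χ.nonneg (x := s)], χ.le_one⟩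
  set a := s₀ - 1 / 2
  set b := t₀ - 1 / 2
  have hR : ∀ s ∈ Set.Icc (1 / 4 : ℝ) (3 / 4), |s + a| ≤ 1 + |a| + |b| ∧ |s + b| ≤ 1 + |a| + |b| := by
    intro s hs
    have : |s| ≤ 1 := abs_le.2 ⟨by linarith [hs.1], by linarith [hs.2]⟩
    exact ⟨(abs_add_le s a).trans (by linarith [abs_nonneg b]),
      (abs_add_le s b).trans (by linarith [abs_nonneg a])⟩
  obtain ⟨K, hK, hGK⟩ := exists_contDiff_of_separate
    (G := fun s t => ((χ s * (χ t * F (s + a) (t + b)) : ℝ) : ℂ))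
    (fun t => Complex.ofRealCLM.contDiff.comp
      (hχ.mul (contDiff_const.mul ((h1 (t + b)).comp (contDiff_id.add contDiff_const)))))
    (fun s => Complex.ofRealCLM.contDiff.comp
      (contDiff_const.mul (hχ.mul ((h2 (s + a)).comp (contDiff_id.add contDiff_const)))))
    (fun s t hs => by rw [hχ0 s hs]; simp) (fun s t ht => by rw [hχ0 t ht]; simp)
    (fun k => by
      obtain ⟨C, hC⟩ := exists_bound_iteratedDeriv_cutoff hχ hχ0
        (f := fun t s => χ t * F (s + a) (t + b))
        (fun t => contDiff_const.mul ((h1 (t + b)).comp (contDiff_id.add contDiff_const)))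
        (fun k => by
          obtain ⟨C, hC⟩ := b1 k (1 + |a| + |b|)
          refine ⟨|C|, fun t s hs => ?_⟩
          rw [iteratedDeriv_const_mul_field, iteratedDeriv_comp_add_const k (fun s => F s (t + b)) a]
          by_cases ht : t ∈ Set.Icc (1 / 4 : ℝ) (3 / 4)
          · rw [abs_mul]
            have := (hC (s + a) (t + b) (hR s hs).1 (hR t ht).2).trans (le_abs_self C)
            calc _ ≤ 1 * |C| := by
                  gcongr
                  exact hχ1 t
              _ = _ := one_mul _
          · rw [hχ0 t ht]
            simp) k
      exact ⟨C, fun s t => hC t s⟩)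
    (fun k => by
      obtain ⟨C, hC⟩ := exists_bound_iteratedDeriv_cutoff hχ hχ0
        (f := fun s t => χ s * F (s + a) (t + b))
        (fun s => contDiff_const.mul ((h2 (s + a)).comp (contDiff_id.add contDiff_const)))
        (fun k => by
          obtain ⟨C, hC⟩ := b2 k (1 + |a| + |b|)
          refine ⟨|C|, fun s t ht => ?_⟩
          rw [iteratedDeriv_const_mul_field, iteratedDeriv_comp_add_const k (F (s + a)) b]
          by_cases hs : s ∈ Set.Icc (1 / 4 : ℝ) (3 / 4)
          · rw [abs_mul]
            have := (hC (s + a) (t + b) (hR s hs).1 (hR t ht).2).trans (le_abs_self C)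
            calc _ ≤ 1 * |C| := by
                  gcongr
                  exact hχ1 s
              _ = _ := one_mul _
          · rw [hχ0 s hs]
            simp) k
      refine ⟨C, fun s t => ?_⟩
      have e : (fun t => ((χ s * (χ t * F (s + a) (t + b)) : ℝ) : ℂ)) =
          fun t => ((χ t * (χ s * F (s + a) (t + b)) : ℝ) : ℂ) := by
        funext t
        rw [mul_left_comm]
      rw [e]
      exact hC s t)
  -- near the centre both cutoffs equal one, so `F` is the real part of a translate of `K`
  have hev : Function.uncurry F =ᶠ[nhds (s₀, t₀)] fun z => (K (z.1 - a, z.2 - b)).re := by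
    have hs : ∀ᶠ s in nhds s₀, s - a ∈ Metric.ball (1 / 2 : ℝ) (1 / 8) :=
      (continuous_id.sub continuous_const).continuousAt.eventually_mem
        (Metric.isOpen_ball.mem_nhds (by simp))
    have ht : ∀ᶠ t in nhds t₀, t - b ∈ Metric.ball (1 / 2 : ℝ) (1 / 8) :=
      (continuous_id.sub continuous_const).continuousAt.eventually_mem
        (Metric.isOpen_ball.mem_nhds (by simp))
    have hI : ∀ s, s ∈ Metric.ball (1 / 2 : ℝ) (1 / 8) → s ∈ Set.Ico (0 : ℝ) 1 := by
      intro s hs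
      rw [Metric.mem_ball, Real.dist_eq, abs_lt] at hs
      exact ⟨by linarith, by linarith⟩
    filter_upwards [hs.prod_nhds ht] with z hz
    have h3 := hGK _ (hI _ hz.1) _ (hI _ hz.2)
    have c1 : χ (z.1 - a) = 1 := χ.one_of_mem_closedBall (Metric.ball_subset_closedBall hz.1)
    have c2 : χ (z.2 - b) = 1 := χ.one_of_mem_closedBall (Metric.ball_subset_closedBall hz.2)
    rw [← h3, c1, c2]
    simp [Function.uncurry]
  refine ContDiffAt.congr_of_eventuallyEq ?_ hev
  have hz : ContDiff ℝ ∞ fun z : ℝ × ℝ => (z.1 - a, z.2 - b) :=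
    (contDiff_fst.sub contDiff_const).prodMk (contDiff_snd.sub contDiff_const)
  exact (Complex.reCLM.contDiff.comp (hK.comp hz)).contDiffAt

/-! ### Functions of two variables that are smooth along smooth curves -/

theorem exists_bound_iteratedFDeriv_le {f : ℝ → ℝ} (hf : ContDiff ℝ ∞ f) (hc : HasCompactSupport f)
    (n : ℕ) : ∃ M : ℝ, 0 ≤ M ∧ ∀ j ≤ n, ∀ x, ‖iteratedFDeriv ℝ j f x‖ ≤ M := by
  have h : ∀ j : ℕ, ∃ C : ℝ, ∀ x, ‖iteratedFDeriv ℝ j f x‖ ≤ C := fun j =>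
    (hf.continuous_iteratedFDeriv (m := j) (by exact_mod_cast le_top)).bounded_above_of_compact_support
      (hc.iteratedFDeriv j)
  choose C hC using h
  have hC0 : ∀ j, 0 ≤ C j := fun j => (norm_nonneg _).trans (hC j 0)
  refine ⟨∑ j ∈ Finset.range (n + 1), C j, Finset.sum_nonneg fun j _ => hC0 j, fun j hj x =>
    (hC j x).trans (Finset.single_le_sum (f := C) (fun i _ => hC0 i)
      (Finset.mem_range.2 (Nat.lt_succ_of_le hj)))⟩

/-- The special curve lemma: along the sequence `2⁻ⁿ` a smooth curve may be prescribed to be affine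
with arbitrary value and slope near each term, provided these decrease fast enough. -/
theorem special_curve : ∃ δ : ℕ → ℝ, (∀ n, 0 < δ n) ∧ ∀ c e : ℕ → ℝ, (∀ n, |c n| ≤ δ n) →
    (∀ n, |e n| ≤ δ n) → ∃ a : ℝ → ℝ, ContDiff ℝ ∞ a ∧
      ∀ n, ∀ᶠ τ in nhds ((1 / 2 : ℝ) ^ n), a τ = c n + e n * (τ - (1 / 2 : ℝ) ^ n) := by
  set T : ℕ → ℝ := fun n => (1 / 2 : ℝ) ^ n with hT
  have hTpos : ∀ n, 0 < T n := fun n => by positivity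
  let ψ : ∀ n, ContDiffBump (T n) := fun n =>
    ⟨T n / 8, T n / 4, by linarith [hTpos n], by linarith [hTpos n]⟩
  have hψ : ∀ n, ContDiff ℝ ∞ (ψ n : ℝ → ℝ) := fun n => (ψ n).contDiff
  have hθ : ∀ n, ContDiff ℝ ∞ fun τ => ψ n τ * (τ - T n) := fun n =>
    (hψ n).mul (contDiff_id.sub contDiff_const)
  have hθc : ∀ n, HasCompactSupport fun τ => ψ n τ * (τ - T n) := fun n =>
    (ψ n).hasCompactSupport.mul_right
  choose M hM0 hM using fun n => exists_bound_iteratedFDeriv_le (hψ n) (ψ n).hasCompactSupport n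
  choose N hN0 hN using fun n => exists_bound_iteratedFDeriv_le (hθ n) (hθc n) n
  have hpos : ∀ n, 0 < 1 + M n + N n := fun n => by linarith [hM0 n, hN0 n]
  refine ⟨fun n => T n / (1 + M n + N n), fun n => div_pos (hTpos n) (hpos n),
    fun c e hc he => ?_⟩
  have hf : ∀ n, ContDiff ℝ ∞ fun τ => c n • ψ n τ + e n • (ψ n τ * (τ - T n)) := fun n =>
    ((hψ n).const_smul (c n)).add ((hθ n).const_smul (e n))
  refine ⟨fun τ => ∑' n, (c n • ψ n τ + e n • (ψ n τ * (τ - T n))), ?_, fun n => ?_⟩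
  · refine contDiff_tsum_of_eventually (N := (⊤ : ℕ∞)) (v := fun _ n => T n) hf
      (fun k _ => summable_geometric_of_lt_one (by norm_num) (by norm_num)) fun k _ => ?_
    rw [Nat.cofinite_eq_atTop]
    filter_upwards [Filter.eventually_ge_atTop k] with n hn x
    have h1 : iteratedFDeriv ℝ k (fun τ => c n • ψ n τ + e n • (ψ n τ * (τ - T n))) x =
        c n • iteratedFDeriv ℝ k (ψ n : ℝ → ℝ) x +
          e n • iteratedFDeriv ℝ k (fun τ => ψ n τ * (τ - T n)) x := by
      have e1 : ContDiffAt ℝ k (ψ n : ℝ → ℝ) x :=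
        (hψ n).contDiffAt.of_le (by exact_mod_cast le_top)
      have e2 : ContDiffAt ℝ k (fun τ => ψ n τ * (τ - T n)) x :=
        (hθ n).contDiffAt.of_le (by exact_mod_cast le_top)
      rw [fun_iteratedFDeriv_add_apply (e1.const_smul (c n)) (e2.const_smul (e n)),
        iteratedFDeriv_const_smul_apply' e1, iteratedFDeriv_const_smul_apply' e2]
    rw [h1]
    refine (norm_add_le _ _).trans ?_
    rw [norm_smul, norm_smul, Real.norm_eq_abs, Real.norm_eq_abs]
    have hd : 0 ≤ T n / (1 + M n + N n) := (div_pos (hTpos n) (hpos n)).le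
    calc _ ≤ T n / (1 + M n + N n) * M n + T n / (1 + M n + N n) * N n := by
          gcongr
          · exact hc n
          · exact hM n k hn x
          · exact he n
          · exact hN n k hn x
      _ = T n / (1 + M n + N n) * (M n + N n) := by ring
      _ ≤ T n / (1 + M n + N n) * (1 + M n + N n) := by
          gcongr
          linarith
      _ = T n := div_mul_cancel₀ _ (hpos n).ne'
  · -- the supports of the bumps are disjoint, so only the `n`-th term survives near `2⁻ⁿ`
    have hnear : ∀ᶠ τ in nhds (T n), τ ∈ Metric.ball (T n) (T n / 8) :=
      Metric.isOpen_ball.eventually_mem (Metric.mem_ball_self (by linarith [hTpos n]))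
    filter_upwards [hnear] with τ hτ
    have h1 : ψ n τ = 1 := (ψ n).one_of_mem_closedBall (Metric.ball_subset_closedBall hτ)
    have h0 : ∀ m, m ≠ n → ψ m τ = 0 := by
      intro m hm
      refine (ψ m).zero_of_le_dist ?_
      change T m / 4 ≤ dist τ (T m)
      rw [Metric.mem_ball, Real.dist_eq, abs_lt] at hτ
      rw [Real.dist_eq, le_abs]
      rcases lt_or_gt_of_ne hm with h | h
      · right
        have : T n ≤ T (m + 1) := pow_le_pow_of_le_one (by norm_num) (by norm_num) h
        have e1 : T (m + 1) = T m / 2 := by simp only [hT, pow_succ]; ring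
        linarith [hTpos n, hTpos m]
      · left
        have : T m ≤ T (n + 1) := pow_le_pow_of_le_one (by norm_num) (by norm_num) h
        have e1 : T (n + 1) = T n / 2 := by simp only [hT, pow_succ]; ring
        linarith [hTpos n, hTpos m]
    change ∑' n, (c n • ψ n τ + e n • (ψ n τ * (τ - T n))) = c n + e n * (τ - T n)
    rw [tsum_eq_single n fun m hm => by rw [h0 m hm]; simp, h1]
    simp

theorem iteratedDeriv_comp_affine {g : ℝ → ℝ} (hg : ContDiff ℝ ∞ g) (k : ℕ) (s d t : ℝ) :
    iteratedDeriv k (fun τ => g (s + d * (τ - t))) t = d ^ k * iteratedDeriv k g s := by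
  have e : (fun τ => g (s + d * (τ - t))) = fun τ => (fun x => g (x + (s - d * t))) (d * τ) := by
    funext τ
    congr 1
    ring
  have hc : ContDiff ℝ k fun x => g (x + (s - d * t)) :=
    (hg.comp (contDiff_id.add contDiff_const)).of_le (by exact_mod_cast le_top)
  rw [e, iteratedDeriv_comp_const_mul hc d, iteratedDeriv_comp_add_const]
  simp only
  congr 2
  ring

/-- Otherwise there are points `(Sₙ, Tₙ)` that converge fast to `(s₀, t₀)` and at which the derivative
is large. A special curve runs through `(Sₙ, Tₙ)` at time `2⁻ⁿ`, in the direction of the first axis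
and with speed `δₙ`, and the `k`-th derivative of `F` along it is unbounded near `0`. -/
theorem locally_bounded_of_smooth_along_curves {F : ℝ → ℝ → ℝ}
    (hF : ∀ a b : ℝ → ℝ, ContDiff ℝ ∞ a → ContDiff ℝ ∞ b → ContDiff ℝ ∞ fun t => F (a t) (b t))
    (k : ℕ) (s₀ t₀ : ℝ) : ∃ ε > 0, ∃ C : ℝ, ∀ s t, |s - s₀| < ε → |t - t₀| < ε →
      |iteratedDeriv k (fun s => F s t) s| ≤ C := by
  by_contra! hcon
  obtain ⟨δ, hδ, hcurve⟩ := special_curve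
  choose S T hS hT hlarge using fun n : ℕ => hcon (δ n) (hδ n) (n / δ n ^ k)
  obtain ⟨a, ha, ha'⟩ := hcurve (fun n => S n - s₀) δ (fun n => (hS n).le)
    (fun n => (abs_of_pos (hδ n)).le)
  obtain ⟨b, hb, hb'⟩ := hcurve (fun n => T n - t₀) 0 (fun n => (hT n).le)
    (fun n => by simpa using (hδ n).le)
  set g : ℝ → ℝ := fun τ => F (s₀ + a τ) (t₀ + b τ) with hg
  have hgs : ContDiff ℝ ∞ g := hF _ _ (contDiff_const.add ha) (contDiff_const.add hb)
  have hval : ∀ n : ℕ, (n : ℝ) < |iteratedDeriv k g ((1 / 2 : ℝ) ^ n)| := by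
    intro n
    have hev : g =ᶠ[nhds ((1 / 2 : ℝ) ^ n)]
        fun τ => (fun s => F s (T n)) (S n + δ n * (τ - (1 / 2 : ℝ) ^ n)) := by
      filter_upwards [ha' n, hb' n] with τ h1 h2
      simp only [hg, h1, h2, Pi.zero_apply]
      congr 1 <;> ring
    rw [hev.iteratedDeriv_eq k,
      iteratedDeriv_comp_affine (g := fun s => F s (T n)) (hF _ _ contDiff_id contDiff_const),
      abs_mul, abs_pow,
      abs_of_pos (hδ n), mul_comm, ← div_lt_iff₀ (pow_pos (hδ n) k)]
    exact hlarge n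
  have hlim : Filter.Tendsto (fun n : ℕ => |iteratedDeriv k g ((1 / 2 : ℝ) ^ n)|) Filter.atTop
      (nhds |iteratedDeriv k g 0|) :=
    ((contDiff_iteratedDeriv hgs k).continuous.abs.tendsto 0).comp
      (tendsto_pow_atTop_nhds_zero_of_lt_one (by norm_num) (by norm_num))
  exact not_tendsto_nhds_of_tendsto_atTop
    (Filter.tendsto_atTop_mono (fun n => (hval n).le) tendsto_natCast_atTop_atTop) _ hlim

theorem bounded_of_smooth_along_curves {F : ℝ → ℝ → ℝ}
    (hF : ∀ a b : ℝ → ℝ, ContDiff ℝ ∞ a → ContDiff ℝ ∞ b → ContDiff ℝ ∞ fun t => F (a t) (b t))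
    (k : ℕ) (R : ℝ) : ∃ C : ℝ, ∀ s t, |s| ≤ R → |t| ≤ R →
      |iteratedDeriv k (fun s => F s t) s| ≤ C := by
  have hK : IsCompact (Metric.closedBall (0 : ℝ) R ×ˢ Metric.closedBall (0 : ℝ) R) :=
    (isCompact_closedBall _ _).prod (isCompact_closedBall _ _)
  obtain ⟨C, hC⟩ := hK.induction_on
    (p := fun A => ∃ C : ℝ, ∀ z ∈ A, |iteratedDeriv k (fun s => F s z.2) z.1| ≤ C)
    ⟨0, fun _ h => h.elim⟩ (fun A B hAB ⟨C, h⟩ => ⟨C, fun z hz => h z (hAB hz)⟩)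
    (fun A B ⟨C, h⟩ ⟨D, h'⟩ => ⟨max C D, fun z hz => hz.elim
      (fun h1 => (h z h1).trans (le_max_left _ _)) fun h1 => (h' z h1).trans (le_max_right _ _)⟩)
    (fun z _ => by
      obtain ⟨ε, hε, C, h⟩ := locally_bounded_of_smooth_along_curves hF k z.1 z.2
      refine ⟨Metric.ball z.1 ε ×ˢ Metric.ball z.2 ε, mem_nhdsWithin_of_mem_nhds
        (prod_mem_nhds (Metric.ball_mem_nhds _ hε) (Metric.ball_mem_nhds _ hε)), C, ?_⟩
      rintro w ⟨h1, h2⟩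
      exact h _ _ h1 h2)
  exact ⟨C, fun s t hs ht => hC (s, t) ⟨by simpa using hs, by simpa using ht⟩⟩

/-- Boman's theorem in two variables. -/
theorem boman {F : ℝ → ℝ → ℝ}
    (hF : ∀ a b : ℝ → ℝ, ContDiff ℝ ∞ a → ContDiff ℝ ∞ b → ContDiff ℝ ∞ fun t => F (a t) (b t)) :
    ContDiff ℝ ∞ (Function.uncurry F) :=
  contDiff_of_separate (fun _ => hF _ _ contDiff_id contDiff_const)
    (fun _ => hF _ _ contDiff_const contDiff_id) (bounded_of_smooth_along_curves hF)
    fun k R => by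
      obtain ⟨C, hC⟩ := bounded_of_smooth_along_curves (F := fun s t => F t s)
        (fun a b ha hb => hF b a hb ha) k R
      exact ⟨C, fun s t hs ht => hC t s ht hs⟩

/-! ### Weighted sums and uniform boundedness -/

theorem summable_abs_l1 (a : lp (fun _ : ℕ => ℝ) 1) : Summable fun n => |a n| := by
  simpa using (lp.memℓp a).summable (p := 1) (by simp)

theorem norm_l1 (a : lp (fun _ : ℕ => ℝ) 1) : ‖a‖ = ∑' n, |a n| := by
  rw [lp.norm_eq_tsum_rpow (by simp)]
  simp

theorem exists_functional_l1 {u : ℕ → ℝ} {B : ℝ} (hB : ∀ n, |u n| ≤ B) :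
    ∃ L : lp (fun _ : ℕ => ℝ) 1 →L[ℝ] ℝ, ∀ a, L a = ∑' n, a n * u n := by
  have hs : ∀ a : lp (fun _ : ℕ => ℝ) 1, Summable fun n => |a n * u n| := fun a => by
    refine Summable.of_nonneg_of_le (fun n => abs_nonneg _) (fun n => ?_)
      ((summable_abs_l1 a).mul_right B)
    rw [abs_mul]
    exact mul_le_mul_of_nonneg_left (hB n) (abs_nonneg _)
  have hlin : IsLinearMap ℝ fun a : lp (fun _ : ℕ => ℝ) 1 => ∑' n, a n * u n :=
    { map_add := fun a b => by
        rw [← (hs a).of_abs.tsum_add (hs b).of_abs]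
        exact tsum_congr fun n => by rw [lp.coeFn_add, Pi.add_apply, add_mul]
      map_smul := fun c a => by
        rw [smul_eq_mul, ← tsum_mul_left]
        exact tsum_congr fun n => by rw [lp.coeFn_smul, Pi.smul_apply, smul_eq_mul, mul_assoc] }
  have hbd : ∀ a : lp (fun _ : ℕ => ℝ) 1, ‖hlin.mk' _ a‖ ≤ B * ‖a‖ := fun a => by
    have h1 : ‖hlin.mk' _ a‖ ≤ ∑' n, |a n * u n| := norm_tsum_le_tsum_norm (hs a)
    refine h1.trans ?_
    rw [norm_l1, ← tsum_mul_left]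
    refine (hs a).tsum_le_tsum (fun n => ?_) ((summable_abs_l1 a).mul_left B)
    rw [abs_mul, mul_comm]
    exact mul_le_mul_of_nonneg_right (hB n) (abs_nonneg _)
  exact ⟨LinearMap.mkContinuous _ B hbd, fun a => rfl⟩

/-- The uniform boundedness principle for functionals on `ℓ¹` given by bounded sequences. -/
theorem uniform_bound_of_weighted_sums {ι : Type*} {u : ι → ℕ → ℝ}
    (hu : ∀ i, ∃ C : ℝ, ∀ n, |u i n| ≤ C)
    (h : ∀ a : ℕ → ℝ, Summable (fun n => |a n|) → ∃ C : ℝ, ∀ i, |∑' n, a n * u i n| ≤ C) :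
    ∃ C : ℝ, ∀ i n, |u i n| ≤ C := by
  choose B hB using hu
  choose L hL using fun i => exists_functional_l1 (hB i)
  obtain ⟨C, hC⟩ := banach_steinhaus (g := L) fun a => by
    obtain ⟨C, hC⟩ := h a (summable_abs_l1 a)
    exact ⟨C, fun i => by rw [hL, Real.norm_eq_abs]; exact hC i⟩
  refine ⟨C, fun i n => ?_⟩
  have h1 : L i (lp.single 1 n (1 : ℝ)) = u i n := by
    rw [hL, tsum_eq_single n fun m hm => by rw [lp.single_apply_ne _ _ _ hm, zero_mul],
      lp.single_apply_self, one_mul]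
  have h2 : ‖(lp.single 1 n (1 : ℝ) : lp (fun _ : ℕ => ℝ) 1)‖ = 1 := by
    rw [lp.norm_single (by simp)]
    simp
  have := (L i).le_opNorm (lp.single 1 n (1 : ℝ))
  rw [h1, h2, mul_one] at this
  exact this.trans (hC i)

theorem hasDerivAt_weighted_sum {u u' : ℕ → ℝ → ℝ} (hu : ∀ n s, HasDerivAt (u n) (u' n s) s)
    (hb : ∀ R : ℝ, ∃ C : ℝ, ∀ n s, |s| ≤ R → |u n s| ≤ C)
    (hb' : ∀ R : ℝ, ∃ C : ℝ, ∀ n s, |s| ≤ R → |u' n s| ≤ C) {a : ℕ → ℝ}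
    (ha : Summable fun n => |a n|) (s : ℝ) :
    HasDerivAt (fun s => ∑' n, a n * u n s) (∑' n, a n * u' n s) s := by
  obtain ⟨C, hC⟩ := hb' (|s| + 1)
  obtain ⟨D, hD⟩ := hb (|s| + 1)
  have hs : s ∈ Metric.ball (0 : ℝ) (|s| + 1) := by simp
  refine hasDerivAt_tsum_of_isPreconnected (u := fun n => |a n| * C) (ha.mul_right C)
    Metric.isOpen_ball (convex_ball _ _).isPreconnected (fun n y _ => (hu n y).const_mul (a n))
    (fun n y hy => ?_) hs ?_ hs
  · rw [Real.norm_eq_abs, abs_mul]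
    refine mul_le_mul_of_nonneg_left (hC n y ?_) (abs_nonneg _)
    simpa using (Metric.mem_ball.1 hy).le
  · refine Summable.of_norm_bounded (ha.mul_right D) fun n => ?_
    rw [Real.norm_eq_abs, abs_mul]
    exact mul_le_mul_of_nonneg_left (hD n s (by linarith)) (abs_nonneg _)

/-! ### Partial derivatives of smooth functions of two variables -/

theorem contDiff_deriv_left {F : ℝ → ℝ → ℝ} (hF : ContDiff ℝ ∞ (Function.uncurry F)) :
    ContDiff ℝ ∞ (Function.uncurry fun s t => deriv (fun s => F s t) s) := by
  have e : (Function.uncurry fun s t => deriv (fun s => F s t) s) =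
      fun z => fderiv ℝ (Function.uncurry F) z (1, 0) := by
    funext ⟨s, t⟩
    have h1 : HasFDerivAt (Function.uncurry F) (fderiv ℝ (Function.uncurry F) (s, t)) (s, t) :=
      (hF.differentiable (by simp) _).hasFDerivAt
    have h2 : HasDerivAt (fun s : ℝ => (s, t)) ((1 : ℝ), (0 : ℝ)) s :=
      (hasDerivAt_id s).prodMk (hasDerivAt_const s t)
    exact (h1.comp_hasDerivAt s h2).deriv
  rw [e]
  exact (hF.fderiv_right (m := ∞) (by simp)).clm_apply contDiff_const

theorem contDiff_uncurry_swap {F : ℝ → ℝ → ℝ} (hF : ContDiff ℝ ∞ (Function.uncurry F)) :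
    ContDiff ℝ ∞ (Function.uncurry fun s t => F t s) :=
  hF.comp (contDiff_snd.prodMk contDiff_fst)

theorem contDiff_deriv_right {F : ℝ → ℝ → ℝ} (hF : ContDiff ℝ ∞ (Function.uncurry F)) :
    ContDiff ℝ ∞ (Function.uncurry fun s t => deriv (F s) t) :=
  contDiff_uncurry_swap (contDiff_deriv_left (contDiff_uncurry_swap hF))

theorem contDiff_iteratedDeriv_right {F : ℝ → ℝ → ℝ} (hF : ContDiff ℝ ∞ (Function.uncurry F))
    (k : ℕ) : ContDiff ℝ ∞ (Function.uncurry fun s t => iteratedDeriv k (F s) t) := by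
  induction k with
  | zero => simpa using hF
  | succ k ih =>
    simp only [iteratedDeriv_succ]
    exact contDiff_deriv_right ih

theorem contDiff_left {F : ℝ → ℝ → ℝ} (hF : ContDiff ℝ ∞ (Function.uncurry F)) (t : ℝ) :
    ContDiff ℝ ∞ fun s => F s t :=
  hF.comp (contDiff_id.prodMk contDiff_const)

theorem contDiff_right {F : ℝ → ℝ → ℝ} (hF : ContDiff ℝ ∞ (Function.uncurry F)) (s : ℝ) :
    ContDiff ℝ ∞ (F s) :=
  hF.comp (contDiff_const.prodMk contDiff_id)

theorem exists_bound_of_continuous_uncurry {F : ℝ → ℝ → ℝ} (hF : Continuous (Function.uncurry F))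
    (R : ℝ) : ∃ C : ℝ, ∀ s t, |s| ≤ R → |t| ≤ R → |F s t| ≤ C := by
  obtain ⟨C, hC⟩ := ((isCompact_closedBall (0 : ℝ) R).prod
    (isCompact_closedBall (0 : ℝ) R)).exists_bound_of_continuousOn hF.continuousOn
  exact ⟨C, fun s t hs ht => hC (s, t) ⟨by simpa using hs, by simpa using ht⟩⟩

/-- Summation of the values at a bounded sequence of points against summable weights preserves
smooth dependence on a parameter. -/
theorem contDiff_weighted_sum {F : ℝ → ℝ → ℝ} (hF : ContDiff ℝ ∞ (Function.uncurry F))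
    {a t : ℕ → ℝ} (ha : Summable fun n => |a n|) {R : ℝ} (ht : ∀ n, |t n| ≤ R) :
    ContDiff ℝ ∞ fun s => ∑' n, a n * F s (t n) := by
  have hbd : ∀ G : ℝ → ℝ → ℝ, ContDiff ℝ ∞ (Function.uncurry G) → ∀ R' : ℝ, ∃ C : ℝ, ∀ n s,
      |s| ≤ R' → |G s (t n)| ≤ C := by
    intro G hG R'
    obtain ⟨C, hC⟩ := exists_bound_of_continuous_uncurry hG.continuous (max R R')
    exact ⟨C, fun n s hs => hC s _ (hs.trans (le_max_right _ _)) ((ht n).trans (le_max_left _ _))⟩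
  have hd : ∀ G : ℝ → ℝ → ℝ, ContDiff ℝ ∞ (Function.uncurry G) → ∀ s,
      HasDerivAt (fun s => ∑' n, a n * G s (t n))
        (∑' n, a n * deriv (fun s => G s (t n)) s) s := by
    intro G hG s
    exact hasDerivAt_weighted_sum (u := fun n s => G s (t n))
      (u' := fun n s => deriv (fun s => G s (t n)) s)
      (fun n s => ((contDiff_left hG (t n)).differentiable (by simp) s).hasDerivAt)
      (hbd G hG) (hbd _ (contDiff_deriv_left hG)) ha s
  have key : ∀ (N : ℕ) (G : ℝ → ℝ → ℝ), ContDiff ℝ ∞ (Function.uncurry G) →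
      ContDiff ℝ N fun s => ∑' n, a n * G s (t n) := by
    intro N
    induction N with
    | zero =>
      intro G hG
      rw [Nat.cast_zero, contDiff_zero]
      exact continuous_iff_continuousAt.2 fun s => (hd G hG s).continuousAt
    | succ N ih =>
      intro G hG
      rw [Nat.cast_succ, contDiff_succ_iff_deriv]
      refine ⟨fun s => (hd G hG s).differentiableAt, by simp, ?_⟩
      rw [show deriv (fun s => ∑' n, a n * G s (t n)) =
        fun s => ∑' n, a n * deriv (fun s => G s (t n)) s from funext fun s => (hd G hG s).deriv]
      exact ih _ (contDiff_deriv_left hG)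
  exact contDiff_infty.2 fun N => key N F hF

/-! ### Cartesian closedness -/

/-- Functions `g s t` whose values at any bounded sequence of points `t`, summed against summable
weights, depend smoothly on `s`. -/
structure WeaklySmooth (g : ℝ → ℝ → ℝ) : Prop where
  bounded : ∀ s R, ∃ C : ℝ, ∀ t, |t| ≤ R → |g s t| ≤ C
  smooth : ∀ (a t : ℕ → ℝ) (R : ℝ), Summable (fun n => |a n|) → (∀ n, |t n| ≤ R) →
    ContDiff ℝ ∞ fun s => ∑' n, a n * g s (t n)

theorem WeaklySmooth.contDiff_left {g : ℝ → ℝ → ℝ} (hg : WeaklySmooth g) (t : ℝ) :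
    ContDiff ℝ ∞ fun s => g s t := by
  have h := hg.smooth (Pi.single 0 1) (fun _ => t) |t|
    (summable_of_ne_finset_zero (s := {0}) fun n hn => by
      rw [Pi.single_eq_of_ne (by simpa using hn), abs_zero]) fun _ => le_rfl
  have e : (fun s => ∑' n, (Pi.single 0 1 : ℕ → ℝ) n * g s t) = fun s => g s t := by
    funext s
    rw [tsum_eq_single 0 fun n hn => by rw [Pi.single_eq_of_ne hn, zero_mul], Pi.single_eq_same,
      one_mul]
  rwa [e] at h

/-- If the difference quotients in `s` were unbounded along some sequence of points, the uniform
boundedness principle on `ℓ¹` would yield summable weights for which those of the smooth function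
`s ↦ ∑ aₙ g(s, tₙ)` are unbounded. -/
theorem WeaklySmooth.lipschitz {g : ℝ → ℝ → ℝ} (hg : WeaklySmooth g) (R : ℝ) :
    ∃ C : ℝ, ∀ s s' t, |s| ≤ R → |s'| ≤ R → |t| ≤ R → |g s t - g s' t| ≤ C * |s - s'| := by
  by_contra! hcon
  choose s s' t hs hs' ht hlarge using fun n : ℕ => hcon n
  have hne : ∀ n, 0 < |s n - s' n| := fun n => by
    rw [abs_pos, sub_ne_zero]
    intro h
    have := hlarge n
    simp [h] at this
  obtain ⟨C, hC⟩ := uniform_bound_of_weighted_sums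
    (u := fun i n => (g (s i) (t n) - g (s' i) (t n)) * (s i - s' i)⁻¹)
    (fun i => by
      obtain ⟨C, hC⟩ := hg.bounded (s i) R
      obtain ⟨D, hD⟩ := hg.bounded (s' i) R
      refine ⟨(C + D) * |(s i - s' i)⁻¹|, fun n => ?_⟩
      rw [abs_mul]
      refine mul_le_mul_of_nonneg_right ?_ (abs_nonneg _)
      exact (abs_sub _ _).trans (add_le_add (hC _ (ht n)) (hD _ (ht n))))
    (fun a ha => by
      have hφ := hg.smooth a t R ha ht
      set φ := fun s => ∑' n, a n * g s (t n) with hφd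
      have hsummable : ∀ s, Summable fun n => a n * g s (t n) := fun s => by
        obtain ⟨C, hC⟩ := hg.bounded s R
        refine Summable.of_norm_bounded (ha.mul_right C) fun n => ?_
        rw [Real.norm_eq_abs, abs_mul]
        exact mul_le_mul_of_nonneg_left (hC _ (ht n)) (abs_nonneg _)
      obtain ⟨D, hD⟩ := (isCompact_closedBall (0 : ℝ) R).exists_bound_of_continuousOn
        (hφ.continuous_deriv (by simp)).continuousOn
      refine ⟨D, fun i => ?_⟩
      have e : ∑' n, a n * ((g (s i) (t n) - g (s' i) (t n)) * (s i - s' i)⁻¹) =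
          (φ (s i) - φ (s' i)) * (s i - s' i)⁻¹ := by
        rw [hφd]
        simp only
        rw [← (hsummable (s i)).tsum_sub (hsummable (s' i)), ← tsum_mul_right]
        exact tsum_congr fun n => by ring
      rw [e, abs_mul, abs_inv, ← div_eq_mul_inv, div_le_iff₀ (hne i)]
      exact (convex_closedBall (0 : ℝ) R).norm_image_sub_le_of_norm_deriv_le
        (fun x _ => hφ.differentiable (by simp) x) hD (by simpa using hs' i) (by simpa using hs i))
  obtain ⟨n, hn⟩ := exists_nat_gt C
  have h1 := hC n n
  rw [abs_mul, abs_inv, ← div_eq_mul_inv, div_le_iff₀ (hne n)] at h1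
  have := hlarge n
  nlinarith [hne n]

theorem WeaklySmooth.locally_bounded {g : ℝ → ℝ → ℝ} (hg : WeaklySmooth g) (R : ℝ) :
    ∃ C : ℝ, ∀ s t, |s| ≤ R → |t| ≤ R → |g s t| ≤ C := by
  obtain ⟨C, hC⟩ := hg.lipschitz R
  obtain ⟨D, hD⟩ := hg.bounded 0 R
  refine ⟨|C| * R + D, fun s t hs ht => ?_⟩
  have h1 := hC s 0 t hs (by simpa using (abs_nonneg _).trans hs) ht
  have h2 := hD t ht
  rw [sub_zero] at h1
  have h3 : C * |s| ≤ |C| * R := mul_le_mul (le_abs_self C) hs (abs_nonneg _) (abs_nonneg _)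
  calc |g s t| = |(g s t - g 0 t) + g 0 t| := by rw [sub_add_cancel]
    _ ≤ |g s t - g 0 t| + |g 0 t| := abs_add_le _ _
    _ ≤ _ := by linarith

theorem WeaklySmooth.deriv_bounded {g : ℝ → ℝ → ℝ} (hg : WeaklySmooth g) (R : ℝ) :
    ∃ C : ℝ, ∀ s t, |s| ≤ R → |t| ≤ R → |deriv (fun s => g s t) s| ≤ C := by
  obtain ⟨C, hC⟩ := hg.lipschitz (R + 1)
  refine ⟨|C|, fun s t hs ht => ?_⟩
  have hev : ∀ᶠ x in nhds s, ‖g x t - g s t‖ ≤ |C| * ‖x - s‖ := by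
    filter_upwards [Metric.ball_mem_nhds s one_pos] with x hx
    rw [Metric.mem_ball, Real.dist_eq] at hx
    have hx' : |x| ≤ R + 1 := by
      calc |x| = |(x - s) + s| := by rw [sub_add_cancel]
        _ ≤ |x - s| + |s| := abs_add_le _ _
        _ ≤ R + 1 := by linarith
    exact (hC x s t hx' (by linarith) (by linarith)).trans
      (mul_le_mul_of_nonneg_right (le_abs_self C) (abs_nonneg _))
  exact norm_deriv_le_of_lip' (abs_nonneg C) hev

/-- The class is closed under `∂ₛ`, since weighted sums may be differentiated term by term. Hence all
derivatives in `s` are locally bounded. -/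
theorem WeaklySmooth.partialDeriv {g : ℝ → ℝ → ℝ} (hg : WeaklySmooth g) :
    WeaklySmooth fun s t => deriv (fun s => g s t) s where
  bounded s R := by
    obtain ⟨C, hC⟩ := hg.deriv_bounded (max |s| R)
    exact ⟨C, fun t ht => hC s t (le_max_left _ _) (ht.trans (le_max_right _ _))⟩
  smooth a t R ha ht := by
    have hd : ∀ s, HasDerivAt (fun s => ∑' n, a n * g s (t n))
        (∑' n, a n * deriv (fun s => g s (t n)) s) s := fun s =>
      hasDerivAt_weighted_sum (u := fun n s => g s (t n))
        (u' := fun n s => deriv (fun s => g s (t n)) s)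
        (fun n s => ((hg.contDiff_left (t n)).differentiable (by simp) s).hasDerivAt)
        (fun R' => by
          obtain ⟨C, hC⟩ := hg.locally_bounded (max R R')
          exact ⟨C, fun n s hs => hC s _ (hs.trans (le_max_right _ _))
            ((ht n).trans (le_max_left _ _))⟩)
        (fun R' => by
          obtain ⟨C, hC⟩ := hg.deriv_bounded (max R R')
          exact ⟨C, fun n s hs => hC s _ (hs.trans (le_max_right _ _))
            ((ht n).trans (le_max_left _ _))⟩) ha s
    have := contDiff_iteratedDeriv (hg.smooth a t R ha ht) 1
    rw [iteratedDeriv_one] at this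
    rwa [show deriv (fun s => ∑' n, a n * g s (t n)) =
      fun s => ∑' n, a n * deriv (fun s => g s (t n)) s from funext fun s => (hd s).deriv] at this

theorem WeaklySmooth.iteratedDeriv_bounded {g : ℝ → ℝ → ℝ} (hg : WeaklySmooth g) (k : ℕ) (R : ℝ) :
    ∃ C : ℝ, ∀ s t, |s| ≤ R → |t| ≤ R → |iteratedDeriv k (fun s => g s t) s| ≤ C := by
  have h : WeaklySmooth fun s t => iteratedDeriv k (fun s => g s t) s := by
    induction k with
    | zero => simpa using hg
    | succ k ih =>
      simp only [iteratedDeriv_succ]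
      exact ih.partialDeriv
  exact h.locally_bounded R

/-- Cartesian closedness: the structure curves of `[Y → X]` are exactly the curves `c` for which
`(s, y) ↦ c s y` is smooth. -/
theorem curves_exp {Y : Frol.{u}} {X : Frol.{v}} {c : ℝ → Y.exp X} (hc : c ∈ (Y.exp X).curves) :
    c ∈ expCurves Y X := by
  intro a ha b hb
  refine (X.mem_curves_iff _).2 fun h hh => ?_
  -- the test functionals that detect joint smoothness
  have htest : ∀ (k : ℕ) (w t : ℕ → ℝ) (R : ℝ), Summable (fun n => |w n|) → (∀ n, |t n| ≤ R) →
      (fun f : Y.exp X => ∑' n, w n * iteratedDeriv k (fun τ => h (f.1 (b τ))) (t n)) ∈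
        (Y.exp X).functions := by
    intro k w t R hw ht c' hc'
    have hF : ContDiff ℝ ∞ (Function.uncurry fun s τ => h ((c' s).1 (b τ))) :=
      boman fun α β hα hβ =>
        (X.mem_curves_iff _).1 (hc' α hα _ (Y.comp_mem hb hβ)) h hh
    exact contDiff_weighted_sum (contDiff_iteratedDeriv_right hF k) hw ht
  have hsm : ∀ s, ContDiff ℝ ∞ fun τ => h ((c s).1 (b τ)) := fun s =>
    (X.mem_curves_iff _).1 ((c s).2 b hb) h hh
  have hweak : ∀ k, WeaklySmooth fun s τ => iteratedDeriv k (fun τ => h ((c s).1 (b τ))) τ :=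
    fun k =>
    { bounded := fun s R => by
        obtain ⟨C, hC⟩ := (isCompact_closedBall (0 : ℝ) R).exists_bound_of_continuousOn
          (contDiff_iteratedDeriv (hsm s) k).continuous.continuousOn
        exact ⟨C, fun t ht => hC t (by simpa using ht)⟩
      smooth := fun w t R hw ht => ((Y.exp X).mem_curves_iff c).1 hc _ (htest k w t R hw ht) }
  have h0 : WeaklySmooth fun s τ => h ((c s).1 (b τ)) := by simpa using hweak 0
  have hjoint : ContDiff ℝ ∞ (Function.uncurry fun s τ => h ((c s).1 (b τ))) :=
    contDiff_of_separate h0.contDiff_left hsm h0.iteratedDeriv_bounded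
      fun k R => (hweak k).locally_bounded R
  exact hjoint.comp (ha.prodMk contDiff_id)

/-! ### Smoothness of the convolutions -/

theorem prod_curves {X : Frol.{u}} {Y : Frol.{v}} {c : ℝ → X.prod Y} (hc : c ∈ (X.prod Y).curves) :
    (fun t => (c t).1) ∈ X.curves ∧ (fun t => (c t).2) ∈ Y.curves :=
  ⟨(X.mem_curves_iff _).2 fun f hf => hc _ (Or.inl ⟨f, hf, rfl⟩),
    (Y.mem_curves_iff _).2 fun f hf => hc _ (Or.inr ⟨f, hf, rfl⟩)⟩

theorem isSmooth_prolMap_apply {N : Frol.{u}} {M : Frol.{v}} (W : Weil) (z : prol N W) :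
    IsSmooth (N.exp M) (prol M W) (fun η => prolMap W η.1 η.2 z) := by
  induction z using Quotient.inductionOn with
  | h g => exact (isSmooth_jet M W).comp (isSmooth_precomp M g.2)

/-- `f ⊗ id_W` applied to `z ∈ N ⊗ W` depends smoothly on `f` and `z` together. -/
theorem prolMap_mem_curves {N : Frol.{u}} {M : Frol.{v}} (W : Weil) {c : ℝ → N.exp M}
    (hc : c ∈ (N.exp M).curves) {z : ℝ → prol N W} (hz : z ∈ (prol N W).curves) :
    (fun t => prolMap W (c t).1 (c t).2 (z t)) ∈ (prol M W).curves := by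
  have hΨ : IsSmooth (prol N W) ((N.exp M).exp (prol M W))
      (fun z => ⟨fun η => prolMap W η.1 η.2 z, isSmooth_prolMap_apply W z⟩) := by
    refine isSmooth_prol (isSmooth_ofCurves fun g hg => Frol.mem_ofCurves fun a ha b hb => ?_)
    refine isSmooth_jet M W (fun t => ⟨fun x => (b t).1 ((g (a t)).1 x), (b t).2.comp (g (a t)).2⟩)
      (Frol.mem_ofCurves fun a' ha' b' hb' => ?_)
    exact curves_exp hb a' ha' _ (hg _ (ha.comp ha') b' hb')
  exact curves_exp (hΨ z hz) (fun t => t) contDiff_id c hc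

/-- By cartesian closedness, a curve of convolutions is smooth because `η₁ ⊗ id` and `η₂` may be
applied to a moving argument. -/
theorem isSmooth_convT {M : Frol.{u}} (hM : WeilExponentiable M) (p q : ℕ) :
    IsSmooth ((E M p).prod (E M q)) (E M (p + q)) (fun η => convT hM η.1 η.2) := by
  intro c hc
  obtain ⟨h1, h2⟩ := prod_curves hc
  refine Frol.mem_ofCurves fun a ha b hb => ?_
  have hs := isSmooth_split hM (D p) (D q) _ (isSmooth_prolSubst M
    (tensorSubst (p := p) (q := q) fun i => i) b hb)
  exact curves_exp h2 a ha _ (prolMap_mem_curves (D q) ((E M p).comp_mem h1 ha) hs)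

theorem isSmooth_conv {M : Frol.{u}} (hM : WeilExponentiable M) (p q : ℕ) :
    IsSmooth ((E M p).prod (E M q)) (E M (p + q)) (fun η => conv hM η.1 η.2) := by
  intro c hc
  obtain ⟨h1, h2⟩ := prod_curves hc
  refine Frol.mem_ofCurves fun a ha b hb => ?_
  have hs := isSmooth_split hM (D q) (D p) _ (isSmooth_prolSubst M
    (tensorSubst (finAddFlip : Fin (p + q) ≃ Fin (q + p))) b hb)
  exact curves_exp h1 a ha _ (prolMap_mem_curves (D p) ((E M q).comp_mem h2 ha) hs)

/-! ### Explicit formulas for the convolutions -/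

/-- The identification `split` may be computed on any representative. -/
theorem split_jet {X : Frol.{u}} (hX : WeilExponentiable X) (W₁ W₂ : Weil)
    (f : (Rn (W₁.tensor W₂).n).exp X) :
    split W₁ W₂ (jet (W₁.tensor W₂) f : prol X (W₁.tensor W₂)) = jet W₂ (slice W₁ W₂ f) := by
  let Y : Frol.{u} := Frol.ofCurves PUnit Set.univ
  obtain ⟨e, -, -, h⟩ := hX Y W₁ W₂
  let k : Y.exp (prol X (W₁.tensor W₂)) := ⟨fun _ => jet _ f, isSmooth_const _ _ _⟩
  have hk : (e (e.symm k)).1 PUnit.unit = jet (W₁.tensor W₂) f :=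
    congrArg (fun g : Y.exp (prol X (W₁.tensor W₂)) => g.1 PUnit.unit) (e.apply_symm_apply k)
  have h1 := (h (e.symm k) PUnit.unit f).1 hk
  have h2 := (h (e.symm k) PUnit.unit
    (Quotient.out (jet (W₁.tensor W₂) f))).1 (hk.trans (Quotient.out_eq _).symm)
  exact h2.symm.trans h1

/-- Freezing the last `q` of `p + q` variables. -/
def blockL {M : Frol.{u}} {p q : ℕ} (f : (Rn (p + q)).exp M) (y : Fin q → ℝ) : (Rn p).exp M :=
  ⟨fun x => f.1 (Fin.append x y : Fin (p + q) → ℝ), f.2.comp (isSmooth_appendL y)⟩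

theorem isSmooth_append_const {m n : ℕ} (v : Rn m) :
    IsSmooth (Rn n) (Rn (m + n)) (fun x => (Fin.append v x : Fin (m + n) → ℝ)) :=
  fun _ hc => append_mem ((Rn m).const_mem v) hc

/-- Freezing the first `p` of `p + q` variables. -/
def blockR {M : Frol.{u}} {p q : ℕ} (f : (Rn (p + q)).exp M) (x : Fin p → ℝ) : (Rn q).exp M :=
  ⟨fun y => f.1 (Fin.append x y : Fin (p + q) → ℝ), f.2.comp (isSmooth_append_const x)⟩

/-- The value of `η ∈ [M ⊗ W_{D^p} → M]` at the class of a smooth map `ℝᵖ → M`. -/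
def ev {M : Frol.{u}} {p : ℕ} (η : E M p) (f : (Rn p).exp M) : M := η.1 (jet (D p) f)

/-- Applying `η ∈ [M ⊗ W_{D^p} → M]` in the first `p` of `p + q` variables. -/
def applyL {M : Frol.{u}} {p q : ℕ} (η : E M p) (f : (Rn (p + q)).exp M) : (Rn q).exp M :=
  ⟨fun y => ev η (blockL f y), fun _ hc => η.2 _ (isSmooth_jet M (D p) _
    (Frol.mem_ofCurves fun _ ha _ hb => f.2 _ (append_mem hb ((Rn q).comp_mem hc ha))))⟩

/-- Applying `η ∈ [M ⊗ W_{D^q} → M]` in the last `q` of `p + q` variables. -/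
def applyR {M : Frol.{u}} {p q : ℕ} (η : E M q) (f : (Rn (p + q)).exp M) : (Rn p).exp M :=
  ⟨fun x => ev η (blockR f x), fun _ hc => η.2 _ (isSmooth_jet M (D q) _
    (Frol.mem_ofCurves fun _ ha _ hb => f.2 _ (append_mem ((Rn p).comp_mem hc ha) hb)))⟩

/-- On representatives, `(η₁ ∗~ η₂) f = η₂ (y ↦ η₁ (x ↦ f (x, y)))`. -/
theorem ev_convT {M : Frol.{u}} (hM : WeilExponentiable M) {p q : ℕ} (η₁ : E M p) (η₂ : E M q)
    (f : (Rn (p + q)).exp M) : ev (convT hM η₁ η₂) f = ev η₂ (applyL η₁ f) := by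
  have h := split_jet hM (D p) (D q) f
  change η₂.1 (prolMap (D q) η₁.1 η₁.2 (split (D p) (D q) (jet ((D p).tensor (D q)) f))) = _
  rw [h]
  rfl

theorem append_finAddFlip {p q : ℕ} (x : Fin p → ℝ) (y : Fin q → ℝ) :
    (fun i => (Fin.append y x : Fin (q + p) → ℝ) (finAddFlip i)) =
      (Fin.append x y : Fin (p + q) → ℝ) := by
  funext i
  refine Fin.addCases (fun i => ?_) (fun i => ?_) i <;> simp

/-- On representatives, `(η₁ ∗ η₂) f = η₁ (x ↦ η₂ (y ↦ f (x, y)))`. -/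
theorem ev_conv {M : Frol.{u}} (hM : WeilExponentiable M) {p q : ℕ} (η₁ : E M p) (η₂ : E M q)
    (f : (Rn (p + q)).exp M) : ev (conv hM η₁ η₂) f = ev η₁ (applyR η₂ f) := by
  let s := tensorSubst (p := q) (q := p) (finAddFlip : Fin (p + q) ≃ Fin (q + p))
  let f' : (Rn (q + p)).exp M := ⟨fun x => f.1 (s.φ x), f.2.comp s.smooth⟩
  have h := split_jet hM (D q) (D p) f'
  change η₁.1 (prolMap (D p) η₂.1 η₂.2 (split (D q) (D p) (jet ((D q).tensor (D p)) f'))) = _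
  rw [h]
  have e : ∀ x, blockL f' x = blockR f x := fun x => Subtype.ext (funext fun y =>
    congrArg f.1 (append_finAddFlip x y))
  exact congrArg (ev η₁) (Subtype.ext (funext fun x => congrArg (ev η₂) (e x)))

theorem E_ext {M : Frol.{u}} {p : ℕ} {η₁ η₂ : E M p} (h : ∀ f, ev η₁ f = ev η₂ f) : η₁ = η₂ := by
  refine Subtype.ext (funext fun x => ?_)
  induction x using Quotient.inductionOn with
  | h f => exact h f

theorem append_zero_left {p q : ℕ} :
    (Fin.append (0 : Fin p → ℝ) (0 : Fin q → ℝ) : Fin (p + q) → ℝ) = 0 := by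
  funext i
  refine Fin.addCases (fun i => ?_) (fun i => ?_) i <;> simp

theorem convT_dirac_right {M : Frol.{u}} (hM : WeilExponentiable M) {p : ℕ} (q : ℕ) (η : E M p) :
    convT hM η (dirac M q) = conv hM η (dirac M q) :=
  E_ext fun f => by rw [ev_convT, ev_conv]; rfl

theorem convT_dirac_left {M : Frol.{u}} (hM : WeilExponentiable M) {q : ℕ} (p : ℕ) (η : E M q) :
    convT hM (dirac M p) η = conv hM (dirac M p) η :=
  E_ext fun f => by rw [ev_convT, ev_conv]; rfl

theorem convT_dirac {M : Frol.{u}} (hM : WeilExponentiable M) (p q : ℕ) :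
    convT hM (dirac M p) (dirac M q) = dirac M (p + q) :=
  E_ext fun f => by
    rw [ev_convT]
    exact congrArg f.1 append_zero_left

/-! ### Associativity up to relabelling

Up to a relabelling of the variables, an iterated convolution of `a`, `b`, `c` is determined by the
order in which the three operators are applied to `f (x, y, z)`. Each of the six orders arises from two
of the twelve iterated convolutions in the Jacobi identity. -/

/-- Reindexing the variables of a smooth map. -/
def reindex {M : Frol.{u}} {m n : ℕ} (s : Fin n → Fin m) (f : (Rn n).exp M) : (Rn m).exp M :=
  ⟨fun x => f.1 (fun i => (x : Fin m → ℝ) (s i)), f.2.comp (coordSubst s).smooth⟩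

theorem ev_relabel {M : Frol.{u}} {m n : ℕ} (s : Fin n → Fin m) (η : E M m) (f : (Rn n).exp M) :
    ev (relabel s η) f = ev η (reindex s f) := rfl

theorem ev_congr {M : Frol.{u}} {n : ℕ} (η : E M n) {f g : (Rn n).exp M}
    (h : ∀ x : Fin n → ℝ, f.1 x = g.1 x) : ev η f = ev η g :=
  congrArg (ev η) (Subtype.ext (funext h))

theorem append_sigmaOne {p q r : ℕ} (x : Fin p → ℝ) (y : Fin q → ℝ) (z : Fin r → ℝ) :
    (fun i => (Fin.append y (Fin.append z x : Fin (r + p) → ℝ) : Fin (q + (r + p)) → ℝ)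
      (sigmaOne p q r i)) =
      (Fin.append x (Fin.append y z : Fin (q + r) → ℝ) : Fin (p + (q + r)) → ℝ) := by
  funext i
  refine Fin.addCases (fun i => ?_) (fun i => ?_) i
  · have e : sigmaOne p q r (Fin.castAdd (q + r) i) = Fin.natAdd q (Fin.natAdd r i) := by
      apply Fin.ext
      simp [sigmaOne, sigma, Nat.add_assoc]
    simp only [e, Fin.append_right, Fin.append_left]
  · refine Fin.addCases (fun i => ?_) (fun i => ?_) i
    · have e : sigmaOne p q r (Fin.natAdd p (Fin.castAdd r i)) = Fin.castAdd (r + p) i := by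
        apply Fin.ext
        simp [sigmaOne, sigma]
      simp only [e, Fin.append_right, Fin.append_left]
    · have e : sigmaOne p q r (Fin.natAdd p (Fin.natAdd q i)) = Fin.natAdd q (Fin.castAdd p i) := by
        apply Fin.ext
        simp [sigmaOne, sigma]
      simp only [e, Fin.append_right, Fin.append_left]

theorem append_sigmaTwo {p q r : ℕ} (x : Fin p → ℝ) (y : Fin q → ℝ) (z : Fin r → ℝ) :
    (fun i => (Fin.append z (Fin.append x y : Fin (p + q) → ℝ) : Fin (r + (p + q)) → ℝ)
      (sigmaTwo p q r i)) =
      (Fin.append x (Fin.append y z : Fin (q + r) → ℝ) : Fin (p + (q + r)) → ℝ) := by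
  funext i
  refine Fin.addCases (fun i => ?_) (fun i => ?_) i
  · have e : sigmaTwo p q r (Fin.castAdd (q + r) i) = Fin.natAdd r (Fin.castAdd q i) := by
      have : Fin.cast (Nat.add_assoc p q r).symm (Fin.castAdd (q + r) i) =
          Fin.castAdd r (Fin.castAdd q i) := Fin.ext rfl
      rw [sigmaTwo, this, sigma, finAddFlip_apply_castAdd]
    simp only [e, Fin.append_right, Fin.append_left]
  · refine Fin.addCases (fun i => ?_) (fun i => ?_) i
    · have e : sigmaTwo p q r (Fin.natAdd p (Fin.castAdd r i)) = Fin.natAdd r (Fin.natAdd p i) := by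
        have : Fin.cast (Nat.add_assoc p q r).symm (Fin.natAdd p (Fin.castAdd r i)) =
            Fin.castAdd r (Fin.natAdd p i) := Fin.ext rfl
        rw [sigmaTwo, this, sigma, finAddFlip_apply_castAdd]
      simp only [e, Fin.append_right, Fin.append_left]
    · have e : sigmaTwo p q r (Fin.natAdd p (Fin.natAdd q i)) = Fin.castAdd (p + q) i := by
        have : Fin.cast (Nat.add_assoc p q r).symm (Fin.natAdd p (Fin.natAdd q i)) =
            Fin.natAdd (p + q) i := Fin.ext (by simp [Nat.add_assoc])
        rw [sigmaTwo, this, sigma, finAddFlip_apply_natAdd]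
      simp only [e, Fin.append_right, Fin.append_left]

section Assoc

variable {M : Frol.{u}} (hM : WeilExponentiable M) {p q r : ℕ} (a : E M p) (b : E M q) (c : E M r)

theorem convT_convT_eq :
    convT hM a (convT hM b c) = relabel (sigmaTwo p q r) (conv hM c (convT hM a b)) :=
  E_ext fun f => by
    rw [ev_relabel, ev_convT, ev_convT, ev_conv]
    refine ev_congr c fun z => ?_
    refine Eq.trans ?_ (ev_convT hM a b _).symm
    refine ev_congr b fun y => ev_congr a fun x => ?_
    exact congrArg f.1 (append_sigmaTwo x y z).symm

theorem convT_conv_eq :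
    convT hM a (conv hM b c) = relabel (sigmaOne p q r) (conv hM b (conv hM c a)) :=
  E_ext fun f => by
    rw [ev_relabel, ev_convT, ev_conv, ev_conv]
    refine ev_congr b fun y => ?_
    refine Eq.trans ?_ (ev_conv hM c a _).symm
    refine ev_congr c fun z => ev_congr a fun x => ?_
    exact congrArg f.1 (append_sigmaOne x y z).symm

theorem conv_convT_eq :
    conv hM a (convT hM b c) = relabel (sigmaOne p q r) (convT hM b (convT hM c a)) :=
  E_ext fun f => by
    rw [ev_relabel, ev_convT, ev_convT, ev_conv]
    refine ev_congr a fun x => ?_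
    refine Eq.trans (ev_convT hM b c _) ?_
    refine ev_congr c fun z => ev_congr b fun y => ?_
    exact congrArg f.1 (append_sigmaOne x y z).symm

theorem conv_conv_eq :
    conv hM a (conv hM b c) = relabel (sigmaTwo p q r) (convT hM c (conv hM a b)) :=
  E_ext fun f => by
    rw [ev_relabel, ev_convT, ev_conv, ev_conv]
    refine ev_congr a fun x => ?_
    refine Eq.trans (ev_conv hM b c _) ?_
    refine ev_congr b fun y => ev_congr c fun z => ?_
    exact congrArg f.1 (append_sigmaTwo x y z).symm

theorem relabel_convT_conv_eq :
    relabel (sigmaOne p q r) (convT hM b (conv hM c a)) =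
      relabel (sigmaTwo p q r) (conv hM c (conv hM a b)) :=
  E_ext fun f => by
    rw [ev_relabel, ev_relabel, ev_convT, ev_conv, ev_conv]
    refine ev_congr c fun z => ?_
    refine Eq.trans ?_ (ev_conv hM a b _).symm
    refine ev_congr a fun x => ev_congr b fun y => ?_
    exact congrArg f.1 ((append_sigmaOne x y z).trans (append_sigmaTwo x y z).symm)

theorem relabel_conv_convT_eq :
    relabel (sigmaOne p q r) (conv hM b (convT hM c a)) =
      relabel (sigmaTwo p q r) (convT hM c (convT hM a b)) :=
  E_ext fun f => by
    rw [ev_relabel, ev_relabel, ev_convT, ev_convT, ev_conv]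
    refine ev_congr b fun y => ?_
    refine Eq.trans (ev_convT hM c a _) ?_
    refine ev_congr a fun x => ev_congr c fun z => ?_
    exact congrArg f.1 ((append_sigmaOne x y z).trans (append_sigmaTwo x y z).symm)

end Assoc

/-! ### Hadamard's lemma with parameters -/

/-- Functions on `X × ℝ` that are smooth along the structure curves. -/
def SmoothParam (X : Frol.{u}) (f : X → ℝ → ℝ) : Prop :=
  ∀ c ∈ X.curves, ∀ b : ℝ → ℝ, ContDiff ℝ ∞ b → ContDiff ℝ ∞ fun t => f (c t) (b t)

theorem SmoothParam.contDiff_uncurry {X : Frol.{u}} {f : X → ℝ → ℝ} (hf : SmoothParam X f)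
    {c : ℝ → X} (hc : c ∈ X.curves) : ContDiff ℝ ∞ (Function.uncurry fun τ s => f (c τ) s) :=
  boman fun _ b ha hb => hf _ (X.comp_mem hc ha) b hb

theorem SmoothParam.contDiff {X : Frol.{u}} {f : X → ℝ → ℝ} (hf : SmoothParam X f) (x : X) :
    ContDiff ℝ ∞ (f x) :=
  hf _ (X.const_mem x) _ contDiff_id

/-- Differentiation under the integral sign. -/
theorem contDiff_integral_of_contDiff {F : ℝ → ℝ → ℝ} (hF : ContDiff ℝ ∞ (Function.uncurry F)) :
    ContDiff ℝ ∞ fun t => ∫ u in (0 : ℝ)..1, F t u := by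
  have hd : ∀ G : ℝ → ℝ → ℝ, ContDiff ℝ ∞ (Function.uncurry G) → ∀ t,
      HasDerivAt (fun t => ∫ u in (0 : ℝ)..1, G t u)
        (∫ u in (0 : ℝ)..1, deriv (fun t => G t u) t) t := by
    intro G hG t
    obtain ⟨C, hC⟩ := exists_bound_of_continuous_uncurry (contDiff_deriv_left hG).continuous
      (|t| + 1)
    refine (intervalIntegral.hasDerivAt_integral_of_dominated_loc_of_deriv_le
      (F' := fun t u => deriv (fun t => G t u) t) (bound := fun _ => C)
      (Metric.ball_mem_nhds t one_pos)
      (Filter.Eventually.of_forall fun s => (contDiff_right hG s).continuous.aestronglyMeasurable)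
      ((contDiff_right hG t).continuous.intervalIntegrable _ _)
      (contDiff_right (contDiff_deriv_left hG) t).continuous.aestronglyMeasurable
      (Filter.Eventually.of_forall fun u hu s hs => ?_) intervalIntegrable_const
      (Filter.Eventually.of_forall fun u _ s _ =>
        ((contDiff_left hG u).differentiable (by simp) s).hasDerivAt)).2
    rw [Set.uIoc_of_le zero_le_one] at hu
    rw [Metric.mem_ball, Real.dist_eq] at hs
    refine hC s u ?_ ?_
    · calc |s| = |(s - t) + t| := by rw [sub_add_cancel]
        _ ≤ |s - t| + |t| := abs_add_le _ _
        _ ≤ |t| + 1 := by linarith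
    · rw [abs_of_pos hu.1]
      linarith [hu.2, abs_nonneg t]
  have key : ∀ (N : ℕ) (G : ℝ → ℝ → ℝ), ContDiff ℝ ∞ (Function.uncurry G) →
      ContDiff ℝ N fun t => ∫ u in (0 : ℝ)..1, G t u := by
    intro N
    induction N with
    | zero =>
      intro G hG
      rw [Nat.cast_zero, contDiff_zero]
      exact continuous_iff_continuousAt.2 fun t => (hd G hG t).continuousAt
    | succ N ih =>
      intro G hG
      rw [Nat.cast_succ, contDiff_succ_iff_deriv]
      refine ⟨fun t => (hd G hG t).differentiableAt, by simp, ?_⟩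
      rw [show deriv (fun t => ∫ u in (0 : ℝ)..1, G t u) =
        fun t => ∫ u in (0 : ℝ)..1, deriv (fun t => G t u) t from funext fun t => (hd G hG t).deriv]
      exact ih _ (contDiff_deriv_left hG)
  exact contDiff_infty.2 fun N => key N F hF

/-- Hadamard's lemma with parameters. -/
theorem SmoothParam.hadamard {X : Frol.{u}} {f : X → ℝ → ℝ} (hf : SmoothParam X f) :
    ∃ g : X → ℝ → ℝ, SmoothParam X g ∧ ∀ x t, f x t = f x 0 + t * g x t := by
  refine ⟨fun x t => ∫ u in (0 : ℝ)..1, _root_.deriv (f x) (t * u), fun c hc b hb => ?_,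
    fun x t => ?_⟩
  · have h := contDiff_deriv_right (hf.contDiff_uncurry hc)
    refine contDiff_integral_of_contDiff (F := fun t u => _root_.deriv (f (c t)) (b t * u)) ?_
    exact h.comp (contDiff_fst.prodMk ((hb.comp contDiff_fst).mul contDiff_snd))
  · have hd : ∀ u : ℝ, HasDerivAt (fun u => f x (t * u)) (_root_.deriv (f x) (t * u) * t) u := by
      intro u
      have h1 : HasDerivAt (fun u : ℝ => t * u) t u := by
        simpa using (hasDerivAt_id u).const_mul t
      exact (((hf.contDiff x).differentiable (by simp) (t * u)).hasDerivAt).comp u h1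
    have hc : Continuous fun u => _root_.deriv (f x) (t * u) * t :=
      (((hf.contDiff x).continuous_deriv (by simp)).comp (continuous_const.mul continuous_id)).mul
        continuous_const
    have := intervalIntegral.integral_eq_sub_of_hasDerivAt (fun u _ => hd u)
      (hc.intervalIntegrable 0 1)
    rw [intervalIntegral.integral_mul_const, mul_one, mul_zero] at this
    linarith

theorem update_mem_curves {n : ℕ} {c : ℝ → Rn n} (hc : c ∈ (Rn n).curves) (i : Fin n) {b : ℝ → ℝ}
    (hb : ContDiff ℝ ∞ b) :
    (fun t => (Function.update (c t : Fin n → ℝ) i (b t) : Fin n → ℝ)) ∈ (Rn n).curves := by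
  refine mem_Rn_curves.2 (contDiff_pi.2 fun j => ?_)
  rcases eq_or_ne j i with rfl | h
  · have e : (fun t => (Function.update (c t : Fin n → ℝ) j (b t) : Fin n → ℝ) j) = b :=
      funext fun t => Function.update_self ..
    exact (congrArg (ContDiff ℝ ∞) e).mpr hb
  · have e : (fun t => (Function.update (c t : Fin n → ℝ) i (b t) : Fin n → ℝ) j) =
        fun t => (c t : Fin n → ℝ) j := funext fun t => Function.update_of_ne h ..
    exact (congrArg (ContDiff ℝ ∞) e).mpr ((contDiff_pi.1 (mem_Rn_curves.1 hc)) j)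

theorem smoothParam_update {n : ℕ} (F : smoothRing n) (i : Fin n) :
    SmoothParam (Rn n) fun x s => F.1 (Function.update (x : Fin n → ℝ) i s) :=
  fun _ hc _ hb => F.2 _ (update_mem_curves hc i hb)

/-- Hadamard's lemma for the `i`-th coordinate on `ℝⁿ`. -/
theorem exists_eq_add_coord_mul {n : ℕ} (F : smoothRing n) (i : Fin n) :
    ∃ G : smoothRing n, ∀ x : Fin n → ℝ, F.1 x = F.1 (Function.update x i 0) + x i * G.1 x := by
  obtain ⟨g, hg, h⟩ := (smoothParam_update F i).hadamard
  refine ⟨⟨fun x => g x ((x : Fin n → ℝ) i), ((Rn n).mem_functions_iff _).2 fun c hc =>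
    hg c hc _ ((contDiff_pi.1 (mem_Rn_curves.1 hc)) i)⟩, fun x => ?_⟩
  have := h x (x i)
  rwa [Function.update_eq_self] at this

theorem smoothRing_contDiff {n : ℕ} (F : smoothRing n) {c : ℝ → Fin n → ℝ} (hc : ContDiff ℝ ∞ c) :
    ContDiff ℝ ∞ fun t => F.1 (c t) :=
  F.2 c (mem_Rn_curves.2 hc)

/-! ### The ideals of the infinitesimal objects -/

theorem mem_D_iff {n : ℕ} {f : smoothRing n} :
    f ∈ (D n).I ↔ ∃ c : Fin n → smoothRing n, ∀ x, f.1 x = ∑ i, (c i).1 x * (x i * x i) := by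
  have e : ({f | ∃ i, f = coord i * coord i} : Set (smoothRing n)) =
      Set.range fun i => coord i * coord i := by
    ext f
    exact exists_congr fun i => eq_comm
  change f ∈ Ideal.span _ ↔ _
  rw [e, Ideal.mem_span_range_iff_exists_fun]
  refine exists_congr fun c => ?_
  have hsum : ∀ x : Fin n → ℝ, (∑ i, c i * (coord i * coord i) : smoothRing n).1 x =
      ∑ i, (c i).1 x * (x i * x i) := by
    intro x
    rw [← Subalgebra.coe_val, map_sum, Finset.sum_apply]
    rfl
  constructor
  · rintro rfl x
    exact hsum x
  · intro h
    exact Subtype.ext (funext fun x => (hsum x).trans (h x).symm)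

theorem coord_mul_coord_mem_DTwo (i j : Fin 2) : coord i * coord j ∈ DTwo.I :=
  Ideal.subset_span ⟨i, j, rfl⟩

theorem coord_sq_mem_D {n : ℕ} (i : Fin n) : coord i * coord i ∈ (D n).I :=
  Ideal.subset_span ⟨i, rfl⟩

theorem mem_DOne_of_deriv {f : smoothRing 1} (h0 : f.1 0 = 0)
    (h1 : deriv (fun t => f.1 (fun _ => t)) 0 = 0) : f ∈ (D 1).I := by
  have hu : ∀ (x : Fin 1 → ℝ), Function.update x 0 (0 : ℝ) = 0 := fun x => by
    funext i
    fin_cases i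
    simp
  obtain ⟨g, hg⟩ := exists_eq_add_coord_mul f 0
  obtain ⟨k, hk⟩ := exists_eq_add_coord_mul g 0
  have hline : ContDiff ℝ ∞ fun t : ℝ => (fun _ => t : Fin 1 → ℝ) := contDiff_pi.2 fun _ => contDiff_id
  have hgd : HasDerivAt (fun t => f.1 (fun _ => t)) (g.1 0) 0 := by
    have e : (fun t => f.1 (fun _ => t)) = fun t => t * g.1 (fun _ => t) := by
      funext t
      rw [hg, hu, h0, zero_add]
    rw [e]
    have := (hasDerivAt_id (0 : ℝ)).mul
      ((smoothRing_contDiff g hline).differentiable (by simp) 0).hasDerivAt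
    simp only [id, one_mul, zero_mul, add_zero] at this
    exact this
  have hg0 : g.1 0 = 0 := hgd.deriv.symm.trans h1
  refine mem_D_iff.2 ⟨fun _ => k, fun x => ?_⟩
  rw [hg, hu, h0, hk, hu, hg0, Fin.sum_univ_one]
  ring

theorem value_and_deriv_of_mem_DOne {f : smoothRing 1} (hf : f ∈ (D 1).I) :
    f.1 0 = 0 ∧ deriv (fun t => f.1 (fun _ => t)) 0 = 0 := by
  obtain ⟨c, hc⟩ := mem_D_iff.1 hf
  refine ⟨(D 1).vanish f hf, ?_⟩
  have hline : ContDiff ℝ ∞ fun t : ℝ => (fun _ => t : Fin 1 → ℝ) := contDiff_pi.2 fun _ => contDiff_id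
  have e : (fun t => f.1 (fun _ => t)) = fun t => (c 0).1 (fun _ => t) * (t * t) := by
    funext t
    rw [hc, Fin.sum_univ_one]
  rw [e]
  have := (((smoothRing_contDiff (c 0) hline).differentiable (by simp) 0).hasDerivAt).mul
    ((hasDerivAt_id (0 : ℝ)).mul (hasDerivAt_id (0 : ℝ)))
  refine this.deriv.trans ?_
  simp

/-- A function on the plane that vanishes on both axes is divisible by the product of the
coordinates. -/
theorem exists_eq_mul_of_vanish_axes {f : smoothRing 2} (h0 : ∀ t, f.1 ![0, t] = 0)
    (h1 : ∀ t, f.1 ![t, 0] = 0) : ∃ k : smoothRing 2, ∀ x, f.1 x = k.1 x * (x 0 * x 1) := by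
  have hu0 : ∀ x : Fin 2 → ℝ, Function.update x 0 (0 : ℝ) = ![0, x 1] := fun x => by
    funext i
    fin_cases i <;> simp
  have hu1 : ∀ x : Fin 2 → ℝ, Function.update x 1 (0 : ℝ) = ![x 0, 0] := fun x => by
    funext i
    fin_cases i <;> simp
  obtain ⟨g, hg⟩ := exists_eq_add_coord_mul f 0
  obtain ⟨k, hk⟩ := exists_eq_add_coord_mul g 1
  have hline : ContDiff ℝ ∞ fun t : ℝ => (![t, 0] : Fin 2 → ℝ) := by
    refine contDiff_pi.2 fun i => ?_
    fin_cases i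
    · exact contDiff_id
    · exact contDiff_const
  have hgne : ∀ t : ℝ, t ≠ 0 → g.1 ![t, 0] = 0 := by
    intro t ht
    have := hg ![t, 0]
    rw [hu0, h1] at this
    simp only [Matrix.cons_val_zero, Matrix.cons_val_one] at this
    rw [h0, zero_add] at this
    exact (mul_eq_zero.1 this.symm).resolve_left ht
  -- the quotient vanishes on the punctured axis, hence by continuity at the origin as well
  have hg0 : ∀ t : ℝ, g.1 ![t, 0] = 0 := by
    have hc : Continuous fun t : ℝ => g.1 ![t, 0] := (smoothRing_contDiff g hline).continuous
    have : (fun t : ℝ => g.1 ![t, 0]) = fun _ => 0 :=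
      Continuous.ext_on (dense_compl_singleton (0 : ℝ)) hc continuous_const fun t ht => hgne t ht
    exact fun t => congrFun this t
  refine ⟨k, fun x => ?_⟩
  rw [hg, hu0, h0, hk, hu1, hg0]
  ring

theorem mem_DTwo_of_vanish_axes {f : smoothRing 2} (h0 : ∀ t, f.1 ![0, t] = 0)
    (h1 : ∀ t, f.1 ![t, 0] = 0) : f ∈ DTwo.I := by
  obtain ⟨k, hk⟩ := exists_eq_mul_of_vanish_axes h0 h1
  exact mem_of_eq_mul k (coord_mul_coord_mem_DTwo 0 1) hk

/-! ### Pullbacks of Weil algebras -/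

theorem Subst.hom_eq {V W : Weil} {s t : Subst V W}
    (h : ∀ f, pull s.φ s.smooth f - pull t.φ t.smooth f ∈ W.I) : s.hom = t.hom := by
  apply AlgHom.ext
  intro x
  obtain ⟨f, rfl⟩ := Ideal.Quotient.mk_surjective x
  exact Ideal.Quotient.eq.2 (h f)

/-- A commutative square of substitutions that is a pullback of the algebras `C^∞(ℝⁿ) / I`,
expressed on representatives. -/
structure IsWeilPullback {A B C D' : Weil} (s₁ : Subst A B) (s₂ : Subst A C) (t₁ : Subst B D')
    (t₂ : Subst C D') : Prop where
  comm : (s₁.comp t₁).hom = (s₂.comp t₂).hom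
  inj : ∀ f, pull s₁.φ s₁.smooth f ∈ B.I → pull s₂.φ s₂.smooth f ∈ C.I → f ∈ A.I
  surj : ∀ f g, pull t₁.φ t₁.smooth f - pull t₂.φ t₂.smooth g ∈ D'.I →
    ∃ k, pull s₁.φ s₁.smooth k - f ∈ B.I ∧ pull s₂.φ s₂.smooth k - g ∈ C.I

/-- The morphism of Weil algebras induced by a substitution. -/
def Subst.toHom {V W : Weil} (s : Subst V W) : V ⟶ W := ⟨s.hom, s, rfl⟩

theorem Subst.toHom_comp {U V W : Weil} (s : Subst U V) (t : Subst V W) :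
    s.toHom ≫ t.toHom = (s.comp t).toHom :=
  Subtype.ext (Subst.hom_comp s t).symm

theorem Subst.toHom_eq {V W : Weil} {s t : Subst V W} (h : s.hom = t.hom) : s.toHom = t.toHom :=
  Subtype.ext h

theorem prolFunctor_map_toHom (X : Frol.{u}) {V W : Weil} (s : Subst V W) (x : prol X V) :
    ((prolFunctor X).map s.toHom).1 x = prolSubst X s x :=
  congrFun (prolSubst_congr X s.toHom.2.choose_spec) x

/-- Lifting a pair of algebra homomorphisms along a jointly bijective pair. -/
theorem exists_algHom_lift {A B C D' R : Type*} [CommRing A] [CommRing B] [CommRing C]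
    [CommRing D'] [CommRing R] [Algebra ℝ A] [Algebra ℝ B] [Algebra ℝ C] [Algebra ℝ D']
    [Algebra ℝ R] (a₁ : A →ₐ[ℝ] B) (a₂ : A →ₐ[ℝ] C) (b₁ : B →ₐ[ℝ] D') (b₂ : C →ₐ[ℝ] D')
    (inj : ∀ x, a₁ x = 0 → a₂ x = 0 → x = 0)
    (surj : ∀ y z, b₁ y = b₂ z → ∃ x, a₁ x = y ∧ a₂ x = z)
    (c₁ : R →ₐ[ℝ] B) (c₂ : R →ₐ[ℝ] C) (hc : ∀ r, b₁ (c₁ r) = b₂ (c₂ r)) :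
    ∃ l : R →ₐ[ℝ] A, a₁.comp l = c₁ ∧ a₂.comp l = c₂ := by
  have inj' : ∀ x y, a₁ x = a₁ y → a₂ x = a₂ y → x = y := fun x y h1 h2 =>
    sub_eq_zero.1 (inj _ (by rw [map_sub, h1, sub_self]) (by rw [map_sub, h2, sub_self]))
  choose l h1 h2 using fun r => surj (c₁ r) (c₂ r) (hc r)
  refine ⟨{ toFun := l, map_one' := ?_, map_mul' := ?_, map_zero' := ?_, map_add' := ?_,
            commutes' := ?_ }, AlgHom.ext h1, AlgHom.ext h2⟩
  · exact inj' _ _ (by rw [h1, map_one, map_one]) (by rw [h2, map_one, map_one])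
  · exact fun r s => inj' _ _ (by rw [h1, map_mul, map_mul, h1, h1])
      (by rw [h2, map_mul, map_mul, h2, h2])
  · exact inj' _ _ (by rw [h1, map_zero, map_zero]) (by rw [h2, map_zero, map_zero])
  · exact fun r s => inj' _ _ (by rw [h1, map_add, map_add, h1, h1])
      (by rw [h2, map_add, map_add, h2, h2])
  · exact fun r => inj' _ _ (by rw [h1, AlgHom.commutes, AlgHom.commutes])
      (by rw [h2, AlgHom.commutes, AlgHom.commutes])

/-- A commutative square of algebras is a pullback as soon as it is one on underlying sets. -/
theorem nonempty_isLimit_pullbackCone {A B C D' : CommAlgCat.{0} ℝ} {a₁ : A ⟶ B} {a₂ : A ⟶ C}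
    {b₁ : B ⟶ D'} {b₂ : C ⟶ D'} (w : a₁ ≫ b₁ = a₂ ≫ b₂)
    (inj : ∀ x : A, a₁.hom x = 0 → a₂.hom x = 0 → x = 0)
    (surj : ∀ (y : B) (z : C), b₁.hom y = b₂.hom z → ∃ x : A, a₁.hom x = y ∧ a₂.hom x = z) :
    Nonempty (IsLimit (PullbackCone.mk a₁ a₂ w)) := by
  have lift : ∀ s : PullbackCone b₁ b₂, ∃ l : s.pt ⟶ A, l ≫ a₁ = s.fst ∧ l ≫ a₂ = s.snd := by
    intro s
    obtain ⟨l, h1, h2⟩ := exists_algHom_lift a₁.hom a₂.hom b₁.hom b₂.hom inj surj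
      s.fst.hom s.snd.hom fun r => congrArg (fun k : s.pt ⟶ D' => k.hom r) s.condition
    exact ⟨CommAlgCat.ofHom l, CommAlgCat.hom_ext h1, CommAlgCat.hom_ext h2⟩
  choose l h1 h2 using lift
  refine ⟨PullbackCone.IsLimit.mk _ l h1 h2 fun s m hm1 hm2 => ?_⟩
  refine CommAlgCat.hom_ext (AlgHom.ext fun r => ?_)
  have e1 : a₁.hom (m.hom r) = a₁.hom ((l s).hom r) :=
    congrArg (fun k : s.pt ⟶ B => k.hom r) (hm1.trans (h1 s).symm)
  have e2 : a₂.hom (m.hom r) = a₂.hom ((l s).hom r) :=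
    congrArg (fun k : s.pt ⟶ C => k.hom r) (hm2.trans (h2 s).symm)
  refine sub_eq_zero.1 (inj _ ?_ ?_)
  · rw [map_sub, e1, sub_self]
  · rw [map_sub, e2, sub_self]

theorem IsWeilPullback.w {A B C D' : Weil} {s₁ : Subst A B} {s₂ : Subst A C} {t₁ : Subst B D'}
    {t₂ : Subst C D'} (h : IsWeilPullback s₁ s₂ t₁ t₂) :
    s₁.toHom ≫ t₁.toHom = s₂.toHom ≫ t₂.toHom := by
  rw [Subst.toHom_comp, Subst.toHom_comp]
  exact Subst.toHom_eq h.comm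

theorem IsWeilPullback.isLimit {A B C D' : Weil} {s₁ : Subst A B} {s₂ : Subst A C}
    {t₁ : Subst B D'} {t₂ : Subst C D'} (h : IsWeilPullback s₁ s₂ t₁ t₂) :
    Nonempty (IsLimit (Weil.toAlg.mapCone (PullbackCone.mk s₁.toHom s₂.toHom h.w))) := by
  have inj : ∀ x : A.alg, s₁.hom x = 0 → s₂.hom x = 0 → x = 0 := by
    intro x h1 h2
    obtain ⟨f, rfl⟩ := Ideal.Quotient.mk_surjective x
    exact Ideal.Quotient.eq_zero_iff_mem.2 (h.inj f (Ideal.Quotient.eq_zero_iff_mem.1 h1)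
      (Ideal.Quotient.eq_zero_iff_mem.1 h2))
  have surj : ∀ (y : B.alg) (z : C.alg), t₁.hom y = t₂.hom z →
      ∃ x : A.alg, s₁.hom x = y ∧ s₂.hom x = z := by
    intro y z hyz
    obtain ⟨f, rfl⟩ := Ideal.Quotient.mk_surjective y
    obtain ⟨g, rfl⟩ := Ideal.Quotient.mk_surjective z
    obtain ⟨k, h1, h2⟩ := h.surj f g (Ideal.Quotient.eq.1 hyz)
    exact ⟨Ideal.Quotient.mk _ k, Ideal.Quotient.eq.2 h1, Ideal.Quotient.eq.2 h2⟩
  obtain ⟨hl⟩ := nonempty_isLimit_pullbackCone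
    (show Weil.toAlg.map s₁.toHom ≫ Weil.toAlg.map t₁.toHom =
      Weil.toAlg.map s₂.toHom ≫ Weil.toAlg.map t₂.toHom by
        rw [← Functor.map_comp, ← Functor.map_comp, h.w]) inj surj
  exact ⟨(isLimitMapConePullbackConeEquiv Weil.toAlg h.w).symm hl⟩

/-- A microlinear space turns a pullback of Weil algebras into a pullback of Frölicher spaces. -/
theorem Microlinear.exists_lift {X : Frol.{u}} (hX : Microlinear X) {A B C D' : Weil}
    {s₁ : Subst A B} {s₂ : Subst A C} {t₁ : Subst B D'} {t₂ : Subst C D'}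
    (h : IsWeilPullback s₁ s₂ t₁ t₂) {Y : Frol.{u}} {k₁ : Y → prol X B} {k₂ : Y → prol X C}
    (hk₁ : IsSmooth Y (prol X B) k₁) (hk₂ : IsSmooth Y (prol X C) k₂)
    (hk : ∀ y, prolSubst X t₁ (k₁ y) = prolSubst X t₂ (k₂ y)) :
    ∃ k : Y → prol X A, IsSmooth Y (prol X A) k ∧
      ∀ y, prolSubst X s₁ (k y) = k₁ y ∧ prolSubst X s₂ (k y) = k₂ y := by
  obtain ⟨hl⟩ := hX WalkingCospan _ _ h.isLimit
  have hl' := isLimitMapConePullbackConeEquiv (prolFunctor X) h.w hl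
  have hw : (⟨k₁, hk₁⟩ : Y ⟶ prol X B) ≫ (prolFunctor X).map t₁.toHom =
      (⟨k₂, hk₂⟩ : Y ⟶ prol X C) ≫ (prolFunctor X).map t₂.toHom := by
    refine Subtype.ext (funext fun y => ?_)
    exact (prolFunctor_map_toHom X t₁ (k₁ y)).trans
      ((hk y).trans (prolFunctor_map_toHom X t₂ (k₂ y)).symm)
  obtain ⟨l, h1, h2⟩ := PullbackCone.IsLimit.lift' hl' _ _ hw
  exact ⟨l.1, l.2, fun y =>
    ⟨(prolFunctor_map_toHom X s₁ (l.1 y)).symm.trans (congrFun (congrArg Subtype.val h1) y),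
      (prolFunctor_map_toHom X s₂ (l.1 y)).symm.trans (congrFun (congrArg Subtype.val h2) y)⟩⟩

theorem Microlinear.hom_ext {X : Frol.{u}} (hX : Microlinear X) {A B C D' : Weil}
    {s₁ : Subst A B} {s₂ : Subst A C} {t₁ : Subst B D'} {t₂ : Subst C D'}
    (h : IsWeilPullback s₁ s₂ t₁ t₂) {Y : Frol.{u}} {k l : Y → prol X A}
    (hk : IsSmooth Y (prol X A) k) (hl : IsSmooth Y (prol X A) l)
    (h₁ : ∀ y, prolSubst X s₁ (k y) = prolSubst X s₁ (l y))
    (h₂ : ∀ y, prolSubst X s₂ (k y) = prolSubst X s₂ (l y)) : k = l := by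
  obtain ⟨hlim⟩ := hX WalkingCospan _ _ h.isLimit
  have hl' := isLimitMapConePullbackConeEquiv (prolFunctor X) h.w hlim
  have e : (⟨k, hk⟩ : Y ⟶ prol X A) = ⟨l, hl⟩ := by
    refine PullbackCone.IsLimit.hom_ext hl' ?_ ?_
    · exact Subtype.ext (funext fun y => (prolFunctor_map_toHom X s₁ (k y)).trans
        ((h₁ y).trans (prolFunctor_map_toHom X s₁ (l y)).symm))
    · exact Subtype.ext (funext fun y => (prolFunctor_map_toHom X s₂ (k y)).trans
        ((h₂ y).trans (prolFunctor_map_toHom X s₂ (l y)).symm))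
  exact congrArg Subtype.val e

/-! ### Prolongations of function spaces -/

/-- Evaluation at `y`, prolonged: `[Y → M] ⊗ W → M ⊗ W`. -/
def evalAt {Y : Frol.{u}} {M : Frol.{v}} {W : Weil} (ξ : prol (Y.exp M) W) (y : Y) : prol M W :=
  prolMap (X := Y.exp M) W (fun η => η.1 y) (isSmooth_eval Y M y) ξ

theorem isSmooth_evalAt {Y : Frol.{u}} {M : Frol.{v}} {W : Weil} (ξ : prol (Y.exp M) W) :
    IsSmooth Y (prol M W) (evalAt ξ) := by
  intro b hb
  induction ξ using Quotient.inductionOn with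
  | h g =>
    refine isSmooth_jet M W (fun t => ⟨fun x => (g.1 x).1 (b t),
      (isSmooth_eval Y M (b t)).comp g.2⟩) (Frol.mem_ofCurves fun a ha b' hb' => ?_)
    exact curves_exp (g.2 b' hb') (fun t => t) contDiff_id _ (Y.comp_mem hb ha)

theorem evalAt_prolSubst {Y : Frol.{u}} {M : Frol.{v}} {V W : Weil} (s : Subst V W)
    (ξ : prol (Y.exp M) V) (y : Y) :
    evalAt (prolSubst (Y.exp M) s ξ) y = prolSubst M s (evalAt ξ y) := by
  induction ξ using Quotient.inductionOn with
  | h g => rfl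

/-- The map `[Y → M] ⊗ W → [Y → M ⊗ W₀] ⊗ W` induced by the constants `M → M ⊗ W₀`. -/
def toConst {Y : Frol.{u}} {M : Frol.{v}} (W₀ : Weil) {W : Weil} (ξ : prol (Y.exp M) W) :
    prol (Y.exp (prol M W₀)) W :=
  prolMap W _ (isSmooth_postcomp Y ((isSmooth_jet M W₀).comp (isSmooth_constMap (Rn W₀.n) M))) ξ

/-- The map `[Y → M ⊗ W₀] ⊗ W → [Y → M] ⊗ W` induced by the projection `M ⊗ W₀ → M`. -/
def ofConst {Y : Frol.{u}} {M : Frol.{v}} {W₀ W : Weil} (ξ : prol (Y.exp (prol M W₀)) W) :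
    prol (Y.exp M) W :=
  prolMap W _ (isSmooth_postcomp Y (isSmooth_foot M W₀)) ξ

theorem ofConst_toConst {Y : Frol.{u}} {M : Frol.{v}} (W₀ : Weil) {W : Weil}
    (ξ : prol (Y.exp M) W) : ofConst (toConst W₀ ξ) = ξ := by
  induction ξ using Quotient.inductionOn with
  | h g => rfl

theorem evalAt_toConst {Y : Frol.{u}} {M : Frol.{v}} (W₀ : Weil) {W : Weil}
    (ξ : prol (Y.exp M) W) (y : Y) : evalAt (toConst W₀ ξ) y =
      prolMap W _ ((isSmooth_jet M W₀).comp (isSmooth_constMap (Rn W₀.n) M)) (evalAt ξ y) := by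
  induction ξ using Quotient.inductionOn with
  | h g => rfl

theorem evalAt_ofConst {Y : Frol.{u}} {M : Frol.{v}} {W₀ W : Weil}
    (ξ : prol (Y.exp (prol M W₀)) W) (y : Y) :
    evalAt (ofConst ξ) y = prolMap W _ (isSmooth_foot M W₀) (evalAt ξ y) := by
  induction ξ using Quotient.inductionOn with
  | h g => rfl

/-- Elements of `[Y → M] ⊗ W` are determined by their values in `M ⊗ W`. -/
theorem evalAt_injective {M : Frol.{u}} (hM : WeilExponentiable M) {Y : Frol.{u}} {W : Weil}
    {ξ₁ ξ₂ : prol (Y.exp M) W} (h : ∀ y, evalAt ξ₁ y = evalAt ξ₂ y) : ξ₁ = ξ₂ := by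
  -- Weil exponentiability with `W₁ = W_{D⁰} = ℝ`
  obtain ⟨e, -, -, he⟩ := hM Y (D 0) W
  have h1 : e (toConst (D 0) ξ₁) = e (toConst (D 0) ξ₂) := by
    refine Subtype.ext (funext fun y => ?_)
    obtain ⟨f, hf⟩ := Quotient.exists_rep ((e (toConst (D 0) ξ₁)).1 y)
    have h2 : evalAt (toConst (D 0) ξ₁) y = jet W (slice (D 0) W f) := (he _ y f).1 hf.symm
    have h3 : evalAt (toConst (D 0) ξ₂) y = jet W (slice (D 0) W f) := by
      rw [← h2, evalAt_toConst, evalAt_toConst, h]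
    exact hf.symm.trans ((he _ y f).2 h3).symm
  rw [← ofConst_toConst (D 0) ξ₁, ← ofConst_toConst (D 0) ξ₂, e.injective h1]

/-- The inclusion of `W` as the second factor of `W₀ ⊗ W`. -/
def inclRight (W₀ W : Weil) : Subst W (W₀.tensor W) where
  φ := projR
  smooth := isSmooth_projR
  le := fun _ hf => Ideal.mem_sup_right (Ideal.mem_map_of_mem (pull projR isSmooth_projR) hf)

/-- Every smooth map `Y → M ⊗ W` comes from an element of `[Y → M] ⊗ W`. -/
theorem evalAt_surjective {M : Frol.{u}} (hM : WeilExponentiable M) {Y : Frol.{u}} {W : Weil}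
    {k : Y → prol M W} (hk : IsSmooth Y (prol M W) k) : ∃ ξ : prol (Y.exp M) W, evalAt ξ = k := by
  obtain ⟨e, -, -, he⟩ := hM Y (D 0) W
  let k' : Y.exp (prol M ((D 0).tensor W)) :=
    ⟨fun y => prolSubst M (inclRight (D 0) W) (k y), (isSmooth_prolSubst M _).comp hk⟩
  refine ⟨ofConst (e.symm k'), funext fun y => ?_⟩
  obtain ⟨g, hg⟩ := Quotient.exists_rep (k y)
  let f : (Rn ((D 0).tensor W).n).exp M := ⟨fun x => g.1 (projR x), g.2.comp isSmooth_projR⟩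
  have h1 : (e (e.symm k')).1 y = jet ((D 0).tensor W) f := by
    rw [e.apply_symm_apply]
    change prolSubst M (inclRight (D 0) W) (k y) = _
    rw [← hg]
    rfl
  have h2 : evalAt (e.symm k') y = jet W (slice (D 0) W f) := (he _ y f).1 h1
  rw [evalAt_ofConst, h2, ← hg]
  refine congrArg (jet W) (Subtype.ext (funext fun v => congrArg g.1 ?_))
  funext i
  exact Fin.append_right _ _ _

/-- Function spaces into a microlinear and Weil exponentiable space turn pullbacks of Weil algebras
into pullbacks of sets. -/
theorem existsUnique_prol_exp {M : Frol.{u}} (hmic : Microlinear M) (hM : WeilExponentiable M)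
    {A B C D' : Weil} {s₁ : Subst A B} {s₂ : Subst A C} {t₁ : Subst B D'} {t₂ : Subst C D'}
    (h : IsWeilPullback s₁ s₂ t₁ t₂) {Y : Frol.{u}} (ξ₁ : prol (Y.exp M) B)
    (ξ₂ : prol (Y.exp M) C) (hξ : prolSubst (Y.exp M) t₁ ξ₁ = prolSubst (Y.exp M) t₂ ξ₂) :
    ∃! γ : prol (Y.exp M) A,
      prolSubst (Y.exp M) s₁ γ = ξ₁ ∧ prolSubst (Y.exp M) s₂ γ = ξ₂ := by
  obtain ⟨k, hk, hk'⟩ := hmic.exists_lift h (isSmooth_evalAt ξ₁) (isSmooth_evalAt ξ₂) fun y => by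
    rw [← evalAt_prolSubst, ← evalAt_prolSubst, hξ]
  obtain ⟨γ, hγ⟩ := evalAt_surjective hM hk
  refine ⟨γ, ⟨evalAt_injective hM fun y => ?_, evalAt_injective hM fun y => ?_⟩, ?_⟩
  · rw [evalAt_prolSubst, hγ, (hk' y).1]
  · rw [evalAt_prolSubst, hγ, (hk' y).2]
  · rintro γ' ⟨h1, h2⟩
    refine evalAt_injective hM fun y => congrFun (hmic.hom_ext h (isSmooth_evalAt γ')
      (isSmooth_evalAt γ) (fun y => ?_) fun y => ?_) y
    · rw [← evalAt_prolSubst, h1, hγ, (hk' y).1]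
    · rw [← evalAt_prolSubst, h2, hγ, (hk' y).2]

/-! ### The two pullbacks behind sums and strong differences -/

/-- The inclusion of the base point into `D`. -/
def baseSubst : Subst (D 1) (D 0) :=
  Subst.ofGens (m := 0) (n := 1) (fun _ _ => 0) contDiff_const
    (by rintro _ ⟨i, rfl⟩; exact mem_of_eq_zero _ fun x => mul_zero (0 : ℝ))

/-- The `i`-th projection `D(2) → D`. -/
def projTwo (i : Fin 2) : Subst (D 1) DTwo :=
  Subst.ofGens (m := 2) (n := 1) (fun x _ => x i) (contDiff_pi.2 fun _ => contDiff_apply ℝ ℝ i)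
    (by rintro _ ⟨j, rfl⟩; exact Ideal.subset_span ⟨i, i, rfl⟩)

theorem vec_zero_two : (![0, 0] : Fin 2 → ℝ) = 0 := by
  funext i
  fin_cases i <;> rfl

theorem const_apply_zero (x : Fin 1 → ℝ) : (fun _ => x 0) = x := by
  funext i
  fin_cases i
  rfl

/-- `D(2)` is two copies of `D` glued at the base point. -/
theorem isWeilPullback_DTwo : IsWeilPullback axisOne axisTwo baseSubst baseSubst where
  comm := by
    refine Subst.hom_eq fun f => mem_of_eq_zero _ fun x => ?_
    exact sub_self (f.1 ![0, 0])
  inj := fun (f : smoothRing 2) h1 h2 => by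
    let f1 := pull axisOne.φ axisOne.smooth f
    let f2 := pull axisTwo.φ axisTwo.smooth f
    let g1 : smoothRing 2 := pull (projTwo 0).φ (projTwo 0).smooth f1
    let g2 : smoothRing 2 := pull (projTwo 1).φ (projTwo 1).smooth f2
    have hg1 : g1 ∈ DTwo.I := (projTwo 0).le h1
    have hg2 : g2 ∈ DTwo.I := (projTwo 1).le h2
    have h0 : f.1 ![0, 0] = 0 := (D 1).vanish f1 h1
    have e1 : ∀ x : Fin 2 → ℝ, g1.1 x = f.1 ![x 0, 0] := fun x => rfl
    have e2 : ∀ x : Fin 2 → ℝ, g2.1 x = f.1 ![0, x 1] := fun x => rfl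
    have e3 : ∀ x : Fin 2 → ℝ, (f - g1 - g2 : smoothRing 2).1 x = f.1 x - g1.1 x - g2.1 x :=
      fun x => rfl
    have h3 : (f - g1 - g2 : smoothRing 2) ∈ DTwo.I := by
      refine mem_DTwo_of_vanish_axes (fun t => ?_) fun t => ?_
      · rw [e3, e1, e2]
        simp [h0]
      · rw [e3, e1, e2]
        simp [h0]
    have e4 : f = (f - g1 - g2 : smoothRing 2) + g1 + g2 := by abel
    rw [e4]
    exact DTwo.I.add_mem (DTwo.I.add_mem h3 hg1) hg2
  surj f g h := by
    have h0 : f.1 0 - g.1 0 = 0 := (D 0).vanish _ h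
    let f1 : smoothRing 2 := pull (projTwo 0).φ (projTwo 0).smooth f
    let g1 : smoothRing 2 := pull (projTwo 1).φ (projTwo 1).smooth g
    refine ⟨f1 + g1 - algebraMap ℝ (smoothRing 2) (f.1 0),
      mem_of_eq_zero _ fun (x : Fin 1 → ℝ) => ?_, mem_of_eq_zero _ fun (x : Fin 1 → ℝ) => ?_⟩
    · have e : f.1 (fun _ => x 0) = f.1 x := congrArg f.1 (const_apply_zero x)
      change f.1 (fun _ => x 0) + g.1 0 - f.1 0 - f.1 x = 0
      linarith
    · have e : g.1 (fun _ => x 0) = g.1 x := congrArg g.1 (const_apply_zero x)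
      change f.1 0 + g.1 (fun _ => x 0) - f.1 0 - g.1 x = 0
      linarith

theorem exists_eq_sum_of_mem_DTwo {f : smoothRing 2} (hf : f ∈ DTwo.I) :
    ∃ c : Fin 2 × Fin 2 → smoothRing 2, ∀ x, f.1 x = ∑ i, (c i).1 x * (x i.1 * x i.2) := by
  have e : ({f | ∃ i j, f = coord i * coord j} : Set (smoothRing 2)) =
      Set.range fun i : Fin 2 × Fin 2 => coord i.1 * coord i.2 := by
    ext f
    constructor
    · rintro ⟨i, j, rfl⟩
      exact ⟨(i, j), rfl⟩
    · rintro ⟨i, rfl⟩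
      exact ⟨i.1, i.2, rfl⟩
  change f ∈ Ideal.span _ at hf
  rw [e, Ideal.mem_span_range_iff_exists_fun] at hf
  obtain ⟨c, rfl⟩ := hf
  refine ⟨c, fun x => ?_⟩
  rw [← Subalgebra.coe_val, map_sum, Finset.sum_apply]
  rfl

/-- The projection `D² ⊕ D → D²`. -/
def projPlus : Subst (D 2) DPlus :=
  Subst.ofGens (m := 3) (n := 2) (fun x => ![x 0, x 1])
    (by
      refine contDiff_pi.2 fun i => ?_
      fin_cases i
      · exact contDiff_apply ℝ ℝ (0 : Fin 3)
      · exact contDiff_apply ℝ ℝ (1 : Fin 3))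
    (by
      rintro _ ⟨i, rfl⟩
      fin_cases i
      · exact Ideal.subset_span (Or.inl ⟨0, rfl⟩)
      · exact Ideal.subset_span (Or.inl ⟨1, rfl⟩))

theorem psiMap_φ (x : Fin 2 → ℝ) : psiMap.φ x = ![x 0, x 1, x 0 * x 1] := rfl

theorem update_two (x : Fin 3 → ℝ) : Function.update x 2 (0 : ℝ) = ![x 0, x 1, 0] := by
  funext i
  fin_cases i <;> simp

/-- Restricting along `(d₁, d₂) ↦ (d₁, d₂, d₁ d₂)` and along `(d₁, d₂) ↦ (d₁, d₂, 0)` differs by a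
multiple of `d₁ d₂`. -/
theorem exists_psi_eq_phi_add (f : smoothRing 3) : ∃ g : smoothRing 3,
    (∀ x : Fin 3 → ℝ, f.1 x = f.1 ![x 0, x 1, 0] + x 2 * g.1 x) ∧
    ∀ x : Fin 2 → ℝ, f.1 (psiMap.φ x) = f.1 (phiMap.φ x) + g.1 (psiMap.φ x) * (x 0 * x 1) := by
  obtain ⟨g, hg⟩ := exists_eq_add_coord_mul f 2
  simp only [update_two] at hg
  refine ⟨g, hg, fun x => ?_⟩
  rw [psiMap_φ, hg, mul_comm (g.1 _)]
  rfl

/-- The product `d₁ d₂` does not vanish on `D²`. -/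
theorem apply_zero_eq_zero_of_mul_mem {k f : smoothRing 2} (hf : f ∈ (D 2).I)
    (h : ∀ x, f.1 x = k.1 x * (x 0 * x 1)) : k.1 0 = 0 := by
  obtain ⟨c, hc⟩ := mem_D_iff.1 hf
  have h1 : ContDiff ℝ ∞ fun t : ℝ => (![t, t] : Fin 2 → ℝ) := by
    refine contDiff_pi.2 fun i => ?_
    fin_cases i <;> exact contDiff_id
  have h2 : ContDiff ℝ ∞ fun t : ℝ => (![t, -t] : Fin 2 → ℝ) := by
    refine contDiff_pi.2 fun i => ?_
    fin_cases i
    · exact contDiff_id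
    · exact contDiff_id.neg
  -- compare along the two diagonals `x₁ = ± x₀`
  have e1 : (fun t : ℝ => k.1 ![t, t]) = fun t => (c 0).1 ![t, t] + (c 1).1 ![t, t] := by
    refine Continuous.ext_on (dense_compl_singleton (0 : ℝ)) (smoothRing_contDiff k h1).continuous
      ((smoothRing_contDiff (c 0) h1).continuous.add (smoothRing_contDiff (c 1) h1).continuous)
      fun t ht => ?_
    have := (h ![t, t]).symm.trans (hc _)
    rw [Fin.sum_univ_two] at this
    simp only [Matrix.cons_val_zero, Matrix.cons_val_one] at this
    have hne : t * t ≠ 0 := mul_ne_zero ht ht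
    apply mul_right_cancel₀ hne
    linarith
  have e2 : (fun t : ℝ => k.1 ![t, -t]) = fun t => -((c 0).1 ![t, -t] + (c 1).1 ![t, -t]) := by
    refine Continuous.ext_on (dense_compl_singleton (0 : ℝ)) (smoothRing_contDiff k h2).continuous
      ((smoothRing_contDiff (c 0) h2).continuous.add
        (smoothRing_contDiff (c 1) h2).continuous).neg fun t ht => ?_
    have := (h ![t, -t]).symm.trans (hc _)
    rw [Fin.sum_univ_two] at this
    simp only [Matrix.cons_val_zero, Matrix.cons_val_one] at this
    have hne : t * t ≠ 0 := mul_ne_zero ht ht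
    apply mul_right_cancel₀ hne
    linarith
  have a1 := congrFun e1 0
  have a2 := congrFun e2 0
  simp only [neg_zero, vec_zero_two] at a1 a2
  linarith

/-- `D² ⊕ D` is two copies of `D²` glued along `D(2)`. -/
theorem isWeilPullback_DPlus : IsWeilPullback psiMap phiMap inclTwo inclTwo where
  comm := by
    refine Subst.hom_eq fun f => ?_
    obtain ⟨g, -, hg⟩ := exists_psi_eq_phi_add f
    refine mem_of_eq_mul (pull psiMap.φ psiMap.smooth g) (coord_mul_coord_mem_DTwo 0 1)
      fun (x : Fin 2 → ℝ) => ?_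
    change f.1 (psiMap.φ x) - f.1 (phiMap.φ x) = g.1 (psiMap.φ x) * (x 0 * x 1)
    rw [hg]
    ring
  inj := fun (f : smoothRing 3) h1 h2 => by
    obtain ⟨g, hg, hg'⟩ := exists_psi_eq_phi_add f
    have hg0 : g.1 0 = 0 := by
      have := apply_zero_eq_zero_of_mul_mem (k := pull psiMap.φ psiMap.smooth g)
        ((D 2).I.sub_mem h1 h2) fun x => by
          change f.1 (psiMap.φ x) - f.1 (phiMap.φ x) = g.1 (psiMap.φ x) * (x 0 * x 1)
          rw [hg']
          ring
      have e : psiMap.φ (0 : Fin 2 → ℝ) = (0 : Fin 3 → ℝ) := psiMap.map_zero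
      change g.1 (psiMap.φ (0 : Fin 2 → ℝ)) = 0 at this
      rwa [e] at this
    obtain ⟨a, ha⟩ := exists_eq_add_coord_mul g 0
    obtain ⟨b, hb⟩ := exists_eq_add_coord_mul g 1
    obtain ⟨c, hc⟩ := exists_eq_add_coord_mul g 2
    -- expand `g` one coordinate at a time, setting the earlier coordinates to zero
    have s1 : ContDiff ℝ ∞ fun x : Fin 3 → ℝ => (![0, x 1, x 2] : Fin 3 → ℝ) := by
      refine contDiff_pi.2 fun i => ?_
      fin_cases i
      · exact contDiff_const
      · exact contDiff_apply ℝ ℝ (1 : Fin 3)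
      · exact contDiff_apply ℝ ℝ (2 : Fin 3)
    have s2 : ContDiff ℝ ∞ fun x : Fin 3 → ℝ => (![0, 0, x 2] : Fin 3 → ℝ) := by
      refine contDiff_pi.2 fun i => ?_
      fin_cases i
      · exact contDiff_const
      · exact contDiff_const
      · exact contDiff_apply ℝ ℝ (2 : Fin 3)
    let b' : smoothRing 3 := pull _ (isSmooth_of_contDiff s1) b
    let c' : smoothRing 3 := pull _ (isSmooth_of_contDiff s2) c
    have u0 : ∀ x : Fin 3 → ℝ, Function.update x 0 (0 : ℝ) = ![0, x 1, x 2] := fun x => by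
      funext i
      fin_cases i <;> simp
    have u1 : ∀ x : Fin 3 → ℝ, Function.update (![0, x 1, x 2] : Fin 3 → ℝ) 1 (0 : ℝ) =
        ![0, 0, x 2] := fun x => by
      funext i
      fin_cases i <;> simp
    have u2 : ∀ x : Fin 3 → ℝ, Function.update (![0, 0, x 2] : Fin 3 → ℝ) 2 (0 : ℝ) = 0 :=
      fun x => by
        funext i
        fin_cases i <;> simp
    have hexp : ∀ x : Fin 3 → ℝ, g.1 x = x 0 * a.1 x + x 1 * b'.1 x + x 2 * c'.1 x := by
      intro x
      have e1 := ha x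
      have e2 := hb ![0, x 1, x 2]
      have e3 := hc ![0, 0, x 2]
      rw [u0] at e1
      rw [u1] at e2
      rw [u2, hg0] at e3
      have e4 : b'.1 x = b.1 ![0, x 1, x 2] := rfl
      have e5 : c'.1 x = c.1 ![0, 0, x 2] := rfl
      simp only [Matrix.cons_val_one, Matrix.cons_val_zero, Matrix.cons_val] at e2 e3
      rw [e1, e2, e3, e4, e5]
      ring
    let f0 : smoothRing 3 := pull projPlus.φ projPlus.smooth (pull phiMap.φ phiMap.smooth f)
    have hf0 : f0 ∈ DPlus.I := projPlus.le h2
    have m02 : (coord 0 * coord 2 : smoothRing 3) ∈ DPlus.I :=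
      Ideal.subset_span (Or.inr (Or.inl rfl))
    have m12 : (coord 1 * coord 2 : smoothRing 3) ∈ DPlus.I :=
      Ideal.subset_span (Or.inr (Or.inr rfl))
    have m22 : (coord 2 * coord 2 : smoothRing 3) ∈ DPlus.I := Ideal.subset_span (Or.inl ⟨2, rfl⟩)
    have e : f = f0 + a * (coord 0 * coord 2) + b' * (coord 1 * coord 2) +
        c' * (coord 2 * coord 2) := by
      refine Subtype.ext (funext fun (x : Fin 3 → ℝ) => ?_)
      change f.1 x = f.1 ![x 0, x 1, 0] + a.1 x * (x 0 * x 2) + b'.1 x * (x 1 * x 2) +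
        c'.1 x * (x 2 * x 2)
      rw [hg, hexp]
      ring
    rw [e]
    exact DPlus.I.add_mem (DPlus.I.add_mem (DPlus.I.add_mem hf0 (DPlus.I.mul_mem_left a m02))
      (DPlus.I.mul_mem_left b' m12)) (DPlus.I.mul_mem_left c' m22)
  surj f g h := by
    obtain ⟨c, hc⟩ := exists_eq_sum_of_mem_DTwo h
    let g' : smoothRing 3 := pull projPlus.φ projPlus.smooth g
    let k : smoothRing 3 := pull projPlus.φ projPlus.smooth (c (0, 1) + c (1, 0))
    refine ⟨g' + coord 2 * k, ?_, mem_of_eq_zero _ fun (x : Fin 2 → ℝ) => ?_⟩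
    · refine mem_D_iff.2 ⟨![-c (0, 0), -c (1, 1)], fun (x : Fin 2 → ℝ) => ?_⟩
      have h1 : f.1 x - g.1 x = _ := hc x
      rw [Fintype.sum_prod_type, Fin.sum_univ_two, Fin.sum_univ_two, Fin.sum_univ_two] at h1
      have e : (![x 0, x 1] : Fin 2 → ℝ) = x := by
        funext i
        fin_cases i <;> rfl
      change g.1 ![x 0, x 1] + x 0 * x 1 * ((c (0, 1)).1 ![x 0, x 1] + (c (1, 0)).1 ![x 0, x 1]) -
        f.1 x = _
      rw [e, Fin.sum_univ_two]
      change _ = -(c (0, 0)).1 x * (x 0 * x 0) + -(c (1, 1)).1 x * (x 1 * x 1)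
      linarith
    · have e : (![x 0, x 1] : Fin 2 → ℝ) = x := by
        funext i
        fin_cases i <;> rfl
      change g.1 ![x 0, x 1] + 0 * _ - g.1 x = 0
      rw [e]
      ring

/-! ### Pairs of jets over `D²` -/

/-- Taylor's formula to second order in one coordinate. -/
theorem exists_taylor_two {n : ℕ} (F : smoothRing n) (i : Fin n) :
    ∃ A P : smoothRing n, ∀ x : Fin n → ℝ, F.1 x = F.1 (Function.update x i 0) +
      x i * A.1 (Function.update x i 0) + x i * x i * P.1 x := by
  obtain ⟨A, hA⟩ := exists_eq_add_coord_mul F i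
  obtain ⟨P, hP⟩ := exists_eq_add_coord_mul A i
  refine ⟨A, P, fun x => ?_⟩
  rw [hA x, hP x]
  ring

/-- The monomials `1, x₀, x₁, x₀ x₁` are independent modulo `(x₀², x₁²)`. -/
theorem coeff_eq_zero_of_mem {f : smoothRing 2} {a b c d : ℝ} (hf : f ∈ (D 2).I)
    (h : ∀ x, f.1 x = a + x 1 * b + x 0 * (c + x 1 * d)) : a = 0 ∧ b = 0 ∧ c = 0 ∧ d = 0 := by
  have ha : a = 0 := by
    have h0 := (D 2).vanish f hf
    have h1 := h 0
    simp only [Pi.zero_apply, zero_mul, add_zero] at h1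
    exact h1.symm.trans h0
  obtain ⟨k, hk⟩ := mem_D_iff.1 hf
  have hb : b = 0 := by
    have hl : ContDiff ℝ ∞ fun t : ℝ => (![0, t] : Fin 2 → ℝ) := by
      refine contDiff_pi.2 fun i => ?_
      fin_cases i
      · exact contDiff_const
      · exact contDiff_id
    have e : (fun _ : ℝ => b) = fun t => t * (k 1).1 ![0, t] := by
      refine Continuous.ext_on (dense_compl_singleton (0 : ℝ)) continuous_const
        (continuous_id.mul (smoothRing_contDiff (k 1) hl).continuous) fun t ht => ?_
      have := (h ![0, t]).symm.trans (hk _)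
      rw [Fin.sum_univ_two, ha] at this
      simp only [Matrix.cons_val_zero, Matrix.cons_val_one] at this
      apply mul_left_cancel₀ (show t ≠ 0 from ht)
      linarith
    simpa using congrFun e 0
  have hc : c = 0 := by
    have hl : ContDiff ℝ ∞ fun t : ℝ => (![t, 0] : Fin 2 → ℝ) := by
      refine contDiff_pi.2 fun i => ?_
      fin_cases i
      · exact contDiff_id
      · exact contDiff_const
    have e : (fun _ : ℝ => c) = fun t => t * (k 0).1 ![t, 0] := by
      refine Continuous.ext_on (dense_compl_singleton (0 : ℝ)) continuous_const
        (continuous_id.mul (smoothRing_contDiff (k 0) hl).continuous) fun t ht => ?_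
      have := (h ![t, 0]).symm.trans (hk _)
      rw [Fin.sum_univ_two, ha] at this
      simp only [Matrix.cons_val_zero, Matrix.cons_val_one] at this
      apply mul_left_cancel₀ (show t ≠ 0 from ht)
      linarith
    simpa using congrFun e 0
  refine ⟨ha, hb, hc, ?_⟩
  exact apply_zero_eq_zero_of_mul_mem (k := algebraMap ℝ (smoothRing 2) d) hf fun x => by
    rw [h, ha, hb, hc]
    change _ = d * (x 0 * x 1)
    ring

/-- If `F(·, y)` lies in `(x₀², x₁²)` for every `y`, then so does the diagonal `x ↦ F(x, x)`. -/
theorem mem_D_of_forall_mem {F : smoothRing 4} {u : smoothRing 2} {v : (Fin 2 → ℝ) → smoothRing 2}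
    (hv : ∀ x y : Fin 2 → ℝ, (v y).1 x = F.1 ![x 0, x 1, y 0, y 1]) (hm : ∀ y, v y ∈ (D 2).I)
    (hu : ∀ x, u.1 x = F.1 ![x 0, x 1, x 0, x 1]) : u ∈ (D 2).I := by
  obtain ⟨A, P, hP⟩ := exists_taylor_two F 0
  obtain ⟨B, Q, hQ⟩ := exists_taylor_two F 1
  obtain ⟨C, R, hR⟩ := exists_taylor_two A 1
  have u0 : ∀ a b c d e : ℝ, Function.update (![a, b, c, d] : Fin 4 → ℝ) 0 e = ![e, b, c, d] := by
    intro a b c d e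
    funext i
    fin_cases i <;> rfl
  have u1 : ∀ a b c d e : ℝ, Function.update (![a, b, c, d] : Fin 4 → ℝ) 1 e = ![a, e, c, d] := by
    intro a b c d e
    funext i
    fin_cases i <;> rfl
  have hexp : ∀ a b c d : ℝ, F.1 ![a, b, c, d] = (F.1 ![0, 0, c, d] + b * B.1 ![0, 0, c, d] +
      a * (A.1 ![0, 0, c, d] + b * C.1 ![0, 0, c, d])) + (P.1 ![a, b, c, d] * (a * a) +
      (Q.1 ![0, b, c, d] + a * R.1 ![0, b, c, d]) * (b * b)) := by
    intro a b c d
    have e1 := hP ![a, b, c, d]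
    have e2 := hQ ![0, b, c, d]
    have e3 := hR ![0, b, c, d]
    simp only [u0, u1, Matrix.cons_val_zero, Matrix.cons_val_one] at e1 e2 e3
    rw [e1, e2, e3]
    ring
  have cd : ∀ y : Fin 2 → ℝ, ContDiff ℝ ∞ fun x : Fin 2 → ℝ => (![x 0, x 1, y 0, y 1] : Fin 4 → ℝ) := by
    intro y
    refine contDiff_pi.2 fun i => ?_
    fin_cases i
    · exact contDiff_apply ℝ ℝ (0 : Fin 2)
    · exact contDiff_apply ℝ ℝ (1 : Fin 2)
    · exact contDiff_const
    · exact contDiff_const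
  have cd0 : ∀ y : Fin 2 → ℝ, ContDiff ℝ ∞ fun x : Fin 2 → ℝ => (![0, x 1, y 0, y 1] : Fin 4 → ℝ) := by
    intro y
    refine contDiff_pi.2 fun i => ?_
    fin_cases i
    · exact contDiff_const
    · exact contDiff_apply ℝ ℝ (1 : Fin 2)
    · exact contDiff_const
    · exact contDiff_const
  have dd : ContDiff ℝ ∞ fun x : Fin 2 → ℝ => (![x 0, x 1, x 0, x 1] : Fin 4 → ℝ) := by
    refine contDiff_pi.2 fun i => ?_
    fin_cases i
    · exact contDiff_apply ℝ ℝ (0 : Fin 2)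
    · exact contDiff_apply ℝ ℝ (1 : Fin 2)
    · exact contDiff_apply ℝ ℝ (0 : Fin 2)
    · exact contDiff_apply ℝ ℝ (1 : Fin 2)
  have dd0 : ContDiff ℝ ∞ fun x : Fin 2 → ℝ => (![0, x 1, x 0, x 1] : Fin 4 → ℝ) := by
    refine contDiff_pi.2 fun i => ?_
    fin_cases i
    · exact contDiff_const
    · exact contDiff_apply ℝ ℝ (1 : Fin 2)
    · exact contDiff_apply ℝ ℝ (0 : Fin 2)
    · exact contDiff_apply ℝ ℝ (1 : Fin 2)
  have hzero : ∀ y : Fin 2 → ℝ, F.1 ![0, 0, y 0, y 1] = 0 ∧ B.1 ![0, 0, y 0, y 1] = 0 ∧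
      A.1 ![0, 0, y 0, y 1] = 0 ∧ C.1 ![0, 0, y 0, y 1] = 0 := by
    intro y
    let k : smoothRing 2 := pull _ (isSmooth_of_contDiff (cd y)) P
    let l : smoothRing 2 := pull _ (isSmooth_of_contDiff (cd0 y)) Q +
      coord 0 * pull _ (isSmooth_of_contDiff (cd0 y)) R
    have hkl : k * (coord 0 * coord 0) + l * (coord 1 * coord 1) ∈ (D 2).I :=
      (D 2).I.add_mem ((D 2).I.mul_mem_left k (coord_sq_mem_D 0))
        ((D 2).I.mul_mem_left l (coord_sq_mem_D 1))
    refine coeff_eq_zero_of_mem ((D 2).I.sub_mem (hm y) hkl) fun (x : Fin 2 → ℝ) => ?_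
    change (v y).1 x - (P.1 ![x 0, x 1, y 0, y 1] * (x 0 * x 0) + (Q.1 ![0, x 1, y 0, y 1] +
      x 0 * R.1 ![0, x 1, y 0, y 1]) * (x 1 * x 1)) = _
    rw [hv, hexp]
    ring
  refine mem_D_iff.2 ⟨![pull _ (isSmooth_of_contDiff dd) P, pull _ (isSmooth_of_contDiff dd0) Q +
    coord 0 * pull _ (isSmooth_of_contDiff dd0) R], fun (x : Fin 2 → ℝ) => ?_⟩
  obtain ⟨h1, h2, h3, h4⟩ := hzero x
  rw [hu, hexp, h1, h2, h3, h4, Fin.sum_univ_two]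
  change _ = P.1 ![x 0, x 1, x 0, x 1] * (x 0 * x 0) + (Q.1 ![0, x 1, x 0, x 1] +
    x 0 * R.1 ![0, x 1, x 0, x 1]) * (x 1 * x 1)
  ring

/-- The function `(x, y) ↦ h(f(x), g(y))` on `ℝ⁴`. -/
def pairFun {A : Frol.{u}} {B : Frol.{v}} (f : (Rn 2).exp A) (g : (Rn 2).exp B)
    (h : A.prod B → ℝ) (hh : h ∈ (A.prod B).functions) : smoothRing 4 :=
  ⟨fun x => h (f.1 (![x 0, x 1] : Fin 2 → ℝ), g.1 (![x 2, x 3] : Fin 2 → ℝ)),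
    ((Rn 4).mem_functions_iff _).2 fun c hc => ((A.prod B).mem_functions_iff h).1 hh _
      (Frol.pair_mem
        (f.2 (fun t => (![(c t : Fin 4 → ℝ) 0, (c t : Fin 4 → ℝ) 1] : Fin 2 → ℝ))
          (mem_Rn_curves.2 (contDiff_pi.2 fun i => by
            fin_cases i
            · exact contDiff_pi.1 (mem_Rn_curves.1 hc) 0
            · exact contDiff_pi.1 (mem_Rn_curves.1 hc) 1)))
        (g.2 (fun t => (![(c t : Fin 4 → ℝ) 2, (c t : Fin 4 → ℝ) 3] : Fin 2 → ℝ))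
          (mem_Rn_curves.2 (contDiff_pi.2 fun i => by
            fin_cases i
            · exact contDiff_pi.1 (mem_Rn_curves.1 hc) 2
            · exact contDiff_pi.1 (mem_Rn_curves.1 hc) 3))))⟩

theorem vec_eta_two (x : Fin 2 → ℝ) : ![x 0, x 1] = x := by
  funext i
  fin_cases i <;> rfl

/-- Over `D²`, the pair of two jets is the jet of the pair of any representatives. -/
theorem prolPair_jet {A : Frol.{u}} {B : Frol.{v}} (f : (Rn 2).exp A) (g : (Rn 2).exp B) :
    prolPair (jet (D 2) f) (jet (D 2) g) =
      jet (X := A.prod B) (D 2) ⟨fun x => (f.1 x, g.1 x), f.2.pair g.2⟩ := by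
  let f' : (Rn 2).exp A := Quotient.out (jet (D 2) f)
  let g' : (Rn 2).exp B := Quotient.out (jet (D 2) g)
  have hf : (weilSetoid A (D 2)).r f' f := Quotient.exact (Quotient.out_eq (jet (D 2) f))
  have hg : (weilSetoid B (D 2)).r g' g := Quotient.exact (Quotient.out_eq (jet (D 2) g))
  refine Quotient.sound ⟨Prod.ext hf.1 hg.1, fun h hh => ?_⟩
  have key1 : ((⟨fun x => h (f'.1 x, g'.1 x), (f'.2.pair g'.2).comp_functions hh⟩ : smoothRing 2) -
      ⟨fun x => h (f.1 x, g'.1 x), (f.2.pair g'.2).comp_functions hh⟩) ∈ (D 2).I := by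
    refine mem_D_of_forall_mem (F := pairFun f' g' h hh - pairFun f g' h hh)
      (v := fun y => (⟨fun x => h (f'.1 x, g'.1 y),
        (f'.2.pair (isSmooth_const _ _ _)).comp_functions hh⟩ : smoothRing 2) -
        ⟨fun x => h (f.1 x, g'.1 y), (f.2.pair (isSmooth_const _ _ _)).comp_functions hh⟩)
      (fun x y => ?_) (fun y => ?_) fun x => ?_
    · change h (f'.1 x, g'.1 y) - h (f.1 x, g'.1 y) =
        h (f'.1 (![x 0, x 1] : Fin 2 → ℝ), g'.1 (![y 0, y 1] : Fin 2 → ℝ)) -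
        h (f.1 (![x 0, x 1] : Fin 2 → ℝ), g'.1 (![y 0, y 1] : Fin 2 → ℝ))
      rw [vec_eta_two, vec_eta_two]
    · exact hf.2 (fun a => h (a, g'.1 y))
        (((IsSmooth.id A).pair (isSmooth_const A B (g'.1 y))).comp_functions hh)
    · change h (f'.1 x, g'.1 x) - h (f.1 x, g'.1 x) =
        h (f'.1 (![x 0, x 1] : Fin 2 → ℝ), g'.1 (![x 0, x 1] : Fin 2 → ℝ)) -
        h (f.1 (![x 0, x 1] : Fin 2 → ℝ), g'.1 (![x 0, x 1] : Fin 2 → ℝ))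
      rw [vec_eta_two]
  have key2 : ((⟨fun x => h (f.1 x, g'.1 x), (f.2.pair g'.2).comp_functions hh⟩ : smoothRing 2) -
      ⟨fun x => h (f.1 x, g.1 x), (f.2.pair g.2).comp_functions hh⟩) ∈ (D 2).I := by
    have hs : h ∘ Prod.swap ∈ (B.prod A).functions :=
      IsSmooth.comp_functions (X := B.prod A) (Y := A.prod B) (f := Prod.swap)
        (fun c hc => Frol.pair_mem (prod_curves hc).2 (prod_curves hc).1) hh
    refine mem_D_of_forall_mem (F := pairFun g' f _ hs - pairFun g f _ hs)
      (v := fun y => (⟨fun x => h (f.1 y, g'.1 x),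
        ((isSmooth_const _ _ _).pair g'.2).comp_functions hh⟩ : smoothRing 2) -
        ⟨fun x => h (f.1 y, g.1 x), ((isSmooth_const _ _ _).pair g.2).comp_functions hh⟩)
      (fun x y => ?_) (fun y => ?_) fun x => ?_
    · change h (f.1 y, g'.1 x) - h (f.1 y, g.1 x) =
        h (f.1 (![y 0, y 1] : Fin 2 → ℝ), g'.1 (![x 0, x 1] : Fin 2 → ℝ)) -
        h (f.1 (![y 0, y 1] : Fin 2 → ℝ), g.1 (![x 0, x 1] : Fin 2 → ℝ))
      rw [vec_eta_two, vec_eta_two]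
    · exact hg.2 (fun b => h (f.1 y, b))
        (((isSmooth_const B A (f.1 y)).pair (IsSmooth.id B)).comp_functions hh)
    · change h (f.1 x, g'.1 x) - h (f.1 x, g.1 x) =
        h (f.1 (![x 0, x 1] : Fin 2 → ℝ), g'.1 (![x 0, x 1] : Fin 2 → ℝ)) -
        h (f.1 (![x 0, x 1] : Fin 2 → ℝ), g.1 (![x 0, x 1] : Fin 2 → ℝ))
      rw [vec_eta_two]
  exact (congrArg (fun k : smoothRing 2 => k ∈ (D 2).I) (sub_add_sub_cancel (_ : smoothRing 2) _ _)).mp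
    ((D 2).I.add_mem key1 key2)

/-! ### Tangent vectors as classes of curves -/

/-- The tangent vector represented by a structure curve. -/
def tangent {X : Frol.{u}} (c : ℝ → X) (hc : c ∈ X.curves) : prol X (D 1) :=
  jet (D 1) ⟨fun x : Fin 1 → ℝ => c (x 0), fun _ hb =>
    X.comp_mem hc ((contDiff_pi.1 (mem_Rn_curves.1 hb)) (0 : Fin 1))⟩

theorem contDiff_line : ContDiff ℝ ∞ fun t : ℝ => (fun _ => t : Fin 1 → ℝ) :=
  contDiff_pi.2 fun _ => contDiff_id

/-- Every tangent vector is represented by a curve, namely by a representative on the line. -/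
theorem exists_eq_tangent {X : Frol.{u}} (ξ : prol X (D 1)) :
    ∃ (c : ℝ → X) (hc : c ∈ X.curves), ξ = tangent c hc := by
  induction ξ using Quotient.inductionOn with
  | h f =>
    refine ⟨fun t => f.1 (fun _ => t : Fin 1 → ℝ), f.2 _ (mem_Rn_curves.2 contDiff_line), ?_⟩
    refine congrArg (jet (D 1)) (Subtype.ext (funext fun x => ?_))
    exact congrArg f.1 (const_apply_zero x).symm

/-- The derivative of a structure function `Φ` along a tangent vector. -/
noncomputable def der {X : Frol.{u}} (Φ : X → ℝ) (hΦ : Φ ∈ X.functions) (ξ : prol X (D 1)) : ℝ :=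
  Quotient.lift (fun f : (Rn 1).exp X => deriv (fun t => Φ (f.1 (fun _ => t : Fin 1 → ℝ))) 0)
    (fun f g H => by
      have h := (value_and_deriv_of_mem_DOne (H.2 Φ hΦ)).2
      have hd : ∀ f : (Rn 1).exp X,
          DifferentiableAt ℝ (fun t => Φ (f.1 (fun _ => t : Fin 1 → ℝ))) 0 := fun f =>
        (smoothRing_contDiff ⟨fun x => Φ (f.1 x), f.2.comp_functions hΦ⟩
          contDiff_line).differentiable (by simp) 0
      exact sub_eq_zero.1 ((deriv_fun_sub (hd f) (hd g)).symm.trans h)) ξ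

theorem der_tangent {X : Frol.{u}} {Φ : X → ℝ} (hΦ : Φ ∈ X.functions) {c : ℝ → X}
    (hc : c ∈ X.curves) : der Φ hΦ (tangent c hc) = deriv (fun t => Φ (c t)) 0 :=
  rfl

theorem der_zeroProl {X : Frol.{u}} {Φ : X → ℝ} (hΦ : Φ ∈ X.functions) (x : X) :
    der Φ hΦ (zeroProl (D 1) x) = 0 :=
  deriv_const (0 : ℝ) (Φ x)

theorem der_prolMap {X : Frol.{u}} {Y : Frol.{v}} {F : X → Y} (hF : IsSmooth X Y F) {Φ : Y → ℝ}
    (hΦ : Φ ∈ Y.functions) (ξ : prol X (D 1)) :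
    der Φ hΦ (prolMap (D 1) F hF ξ) = der (fun x => Φ (F x)) (hF.comp_functions hΦ) ξ := by
  induction ξ using Quotient.inductionOn with
  | h f => rfl

/-- A tangent vector is determined by its foot point and its action on structure functions. -/
theorem tangent_ext {X : Frol.{u}} {ξ ξ' : prol X (D 1)} (h0 : foot ξ = foot ξ')
    (h : ∀ Φ (hΦ : Φ ∈ X.functions), der Φ hΦ ξ = der Φ hΦ ξ') : ξ = ξ' := by
  induction ξ using Quotient.inductionOn with
  | h f =>
    induction ξ' using Quotient.inductionOn with
    | h g =>
      refine Quotient.sound ⟨h0, fun Φ hΦ => mem_DOne_of_deriv ?_ ?_⟩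
      · exact sub_eq_zero.2 (congrArg Φ h0)
      · have hd : ∀ f : (Rn 1).exp X,
            DifferentiableAt ℝ (fun t => Φ (f.1 (fun _ => t : Fin 1 → ℝ))) 0 := fun f =>
          (smoothRing_contDiff ⟨fun x => Φ (f.1 x), f.2.comp_functions hΦ⟩
            contDiff_line).differentiable (by simp) 0
        exact (deriv_fun_sub (hd f) (hd g)).trans (sub_eq_zero.2 (h Φ hΦ))

/-! ### Mixed second derivatives -/

theorem hasDerivAt_id_mul {g : ℝ → ℝ} (hg : ContDiff ℝ ∞ g) :
    HasDerivAt (fun t => t * g t) (g 0) 0 := by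
  have := (hasDerivAt_id (0 : ℝ)).mul (hg.differentiable (by simp) 0).hasDerivAt
  simp only [id, one_mul, zero_mul, add_zero] at this
  exact this

/-- The mixed second derivative `∂₁ ∂₂ F` at the origin. -/
noncomputable def mixed (F : ℝ → ℝ → ℝ) : ℝ := deriv (fun s => deriv (F s) 0) 0

theorem mixed_add {F G : ℝ → ℝ → ℝ} (hF : ContDiff ℝ ∞ (Function.uncurry F))
    (hG : ContDiff ℝ ∞ (Function.uncurry G)) :
    mixed (fun s t => F s t + G s t) = mixed F + mixed G := by
  have hd : ∀ F : ℝ → ℝ → ℝ, ContDiff ℝ ∞ (Function.uncurry F) →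
      (∀ s, DifferentiableAt ℝ (F s) 0) ∧ DifferentiableAt ℝ (fun s => deriv (F s) 0) 0 :=
    fun F hF => ⟨fun s => (contDiff_right hF s).differentiable (by simp) 0,
      (contDiff_left (contDiff_deriv_right hF) 0).differentiable (by simp) 0⟩
  have e : (fun s => deriv (fun t => F s t + G s t) 0) = fun s => deriv (F s) 0 + deriv (G s) 0 :=
    funext fun s => deriv_fun_add ((hd F hF).1 s) ((hd G hG).1 s)
  rw [mixed, e]
  exact deriv_fun_add (hd F hF).2 (hd G hG).2

theorem contDiff_vec_two {E : Type*} [NormedAddCommGroup E] [NormedSpace ℝ E] {a b : E → ℝ}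
    (ha : ContDiff ℝ ∞ a) (hb : ContDiff ℝ ∞ b) :
    ContDiff ℝ ∞ fun z => (![a z, b z] : Fin 2 → ℝ) := by
  refine contDiff_pi.2 fun i => ?_
  fin_cases i
  · exact ha
  · exact hb

theorem contDiff_plane (u : smoothRing 2) : ContDiff ℝ ∞ (Function.uncurry fun s t => u.1 ![s, t]) :=
  boman fun _ _ ha hb => smoothRing_contDiff u (contDiff_vec_two ha hb)

theorem mixed_mul {k : ℝ → ℝ → ℝ} (hk : ContDiff ℝ ∞ (Function.uncurry k)) :
    mixed (fun s t => k s t * (s * t)) = k 0 0 := by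
  have e : (fun s => deriv (fun t => k s t * (s * t)) 0) = fun s => k s 0 * s := by
    funext s
    have h1 : HasDerivAt (fun t : ℝ => s * t) s 0 := by
      simpa using (hasDerivAt_id (0 : ℝ)).const_mul s
    have := ((contDiff_right hk s).differentiable (by simp) 0).hasDerivAt.mul h1
    refine this.deriv.trans ?_
    simp
  rw [mixed, e]
  have := ((contDiff_left hk 0).differentiable (by simp) 0).hasDerivAt.mul (hasDerivAt_id (0 : ℝ))
  refine this.deriv.trans ?_
  simp

theorem mixed_eq_zero_of_mem {u : smoothRing 2} (hu : u ∈ (D 2).I) :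
    mixed (fun s t => u.1 ![s, t]) = 0 := by
  obtain ⟨c, hc⟩ := mem_D_iff.1 hu
  have e : ∀ s, deriv (fun t => u.1 ![s, t]) 0 = deriv (fun t => (c 0).1 ![s, t]) 0 * (s * s) := by
    intro s
    have e1 : (fun t => u.1 ![s, t]) =
        fun t => (c 0).1 ![s, t] * (s * s) + (c 1).1 ![s, t] * (t * t) := by
      funext t
      rw [hc, Fin.sum_univ_two]
      rfl
    rw [e1]
    have h0 := ((contDiff_right (contDiff_plane (c 0)) s).differentiable (by simp) 0).hasDerivAt
    have h1 := ((contDiff_right (contDiff_plane (c 1)) s).differentiable (by simp) 0).hasDerivAt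
    have := (h0.mul_const (s * s)).add
      (h1.mul ((hasDerivAt_id (0 : ℝ)).mul (hasDerivAt_id (0 : ℝ))))
    refine this.deriv.trans ?_
    simp
  rw [mixed, funext e]
  have h := ((contDiff_left (contDiff_deriv_right (contDiff_plane (c 0))) 0).differentiable
    (by simp) 0).hasDerivAt
  have := h.mul ((hasDerivAt_id (0 : ℝ)).mul (hasDerivAt_id (0 : ℝ)))
  refine this.deriv.trans ?_
  simp

/-- The second order part of an element of `X ⊗ W_{D²}`, tested by a structure function. -/
noncomputable def cross {X : Frol.{u}} (Φ : X → ℝ) (hΦ : Φ ∈ X.functions) (γ : prol X (D 2)) : ℝ :=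
  Quotient.lift (fun f : (Rn 2).exp X => mixed fun s t => Φ (f.1 (![s, t] : Fin 2 → ℝ)))
    (fun f g H => by
      let a : smoothRing 2 := ⟨fun x => Φ (f.1 x), f.2.comp_functions hΦ⟩
      let b : smoothRing 2 := ⟨fun x => Φ (g.1 x), g.2.comp_functions hΦ⟩
      have h : mixed (fun s t => (a - b : smoothRing 2).1 ![s, t]) = 0 :=
        mixed_eq_zero_of_mem (H.2 Φ hΦ)
      have e : (fun s t => a.1 ![s, t]) =
          fun s t => (a - b : smoothRing 2).1 ![s, t] + b.1 ![s, t] := by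
        funext s t
        exact (sub_add_cancel (a.1 ![s, t]) (b.1 ![s, t])).symm
      change mixed (fun s t => a.1 ![s, t]) = mixed (fun s t => b.1 ![s, t])
      rw [e, mixed_add (contDiff_plane _) (contDiff_plane _), h, zero_add]) γ

/-- A strong difference acts on structure functions as a difference of mixed derivatives. -/
theorem IsDiffWitness.der_eq {X : Frol.{u}} {γ₁ γ₂ : prol X (D 2)} {γ : prol X DPlus}
    (h : IsDiffWitness γ₁ γ₂ γ) {Φ : X → ℝ} (hΦ : Φ ∈ X.functions) :
    der Φ hΦ (prolSubst X epsMap γ) = cross Φ hΦ γ₁ - cross Φ hΦ γ₂ := by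
  obtain ⟨rfl, rfl⟩ := h
  induction γ using Quotient.inductionOn with
  | h f =>
    obtain ⟨g, hg, hg'⟩ := exists_psi_eq_phi_add ⟨fun x => Φ (f.1 x), f.2.comp_functions hΦ⟩
    let F : smoothRing 3 := ⟨fun x => Φ (f.1 x), f.2.comp_functions hΦ⟩
    let p : smoothRing 2 := pull phiMap.φ phiMap.smooth F
    let k : smoothRing 2 := pull psiMap.φ psiMap.smooth g
    change deriv (fun t => F.1 ![0, 0, t]) 0 =
      mixed (fun s t => F.1 (psiMap.φ (![s, t] : Fin 2 → ℝ))) - mixed (fun s t => p.1 ![s, t])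
    have e : (fun s t => F.1 (psiMap.φ (![s, t] : Fin 2 → ℝ))) =
        fun s t => p.1 ![s, t] + k.1 ![s, t] * (s * t) := by
      funext s t
      exact hg' ![s, t]
    have hk : ContDiff ℝ ∞ (Function.uncurry fun s t => k.1 ![s, t] * (s * t)) :=
      (contDiff_plane k).mul (contDiff_fst.mul contDiff_snd)
    have hz : (![0, 0, 0 * 0] : Fin 3 → ℝ) = ![0, 0, 0] := by rw [mul_zero]
    have hk0 : k.1 ![0, 0] = g.1 ![0, 0, 0] := congrArg g.1 hz
    rw [e, mixed_add (contDiff_plane p) hk, mixed_mul (contDiff_plane k), add_sub_cancel_left, hk0]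
    have hl : ContDiff ℝ ∞ fun t : ℝ => (![0, 0, t] : Fin 3 → ℝ) := by
      refine contDiff_pi.2 fun i => ?_
      fin_cases i
      · exact contDiff_const
      · exact contDiff_const
      · exact contDiff_id
    have e2 : (fun t => F.1 ![0, 0, t]) = fun t => F.1 ![0, 0, 0] + t * g.1 ![0, 0, t] := by
      funext t
      exact hg ![0, 0, t]
    rw [e2]
    exact ((hasDerivAt_id_mul (smoothRing_contDiff g hl)).const_add _).deriv

/-- A sum of tangent vectors acts on structure functions as the sum of their derivatives. -/
theorem IsAddWitness.der_eq {X : Frol.{u}} {t₁ t₂ : prol X (D 1)} {γ : prol X DTwo}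
    (h : IsAddWitness t₁ t₂ γ) {Φ : X → ℝ} (hΦ : Φ ∈ X.functions) :
    der Φ hΦ (prolSubst X diagonal γ) = der Φ hΦ t₁ + der Φ hΦ t₂ := by
  obtain ⟨rfl, rfl⟩ := h
  induction γ using Quotient.inductionOn with
  | h f =>
    let F : smoothRing 2 := ⟨fun x => Φ (f.1 x), f.2.comp_functions hΦ⟩
    change deriv (fun t => F.1 (fun _ => t)) 0 =
      deriv (fun t => F.1 ![t, 0]) 0 + deriv (fun t => F.1 ![0, t]) 0
    obtain ⟨a, ha⟩ := exists_eq_add_coord_mul F 0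
    have h0 : ∀ s t : ℝ, Function.update (![s, t] : Fin 2 → ℝ) 0 0 = ![0, t] := by
      intro s t
      funext i
      fin_cases i <;> rfl
    have hF : ∀ s t : ℝ, F.1 ![s, t] = F.1 ![0, t] + s * a.1 ![s, t] := by
      intro s t
      have := ha ![s, t]
      rw [h0] at this
      exact this
    have hdiag : ∀ t : ℝ, (fun _ => t) = (![t, t] : Fin 2 → ℝ) := by
      intro t
      funext i
      fin_cases i <;> rfl
    have d1 : HasDerivAt (fun t => t * a.1 ![t, t]) (a.1 ![0, 0]) 0 :=
      hasDerivAt_id_mul (smoothRing_contDiff a (contDiff_vec_two contDiff_id contDiff_id))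
    have d2 : HasDerivAt (fun t => t * a.1 ![t, 0]) (a.1 ![0, 0]) 0 :=
      hasDerivAt_id_mul (smoothRing_contDiff a (contDiff_vec_two contDiff_id contDiff_const))
    have d3 : DifferentiableAt ℝ (fun t => F.1 ![0, t]) 0 :=
      (smoothRing_contDiff F (contDiff_vec_two contDiff_const contDiff_id)).differentiable (by simp) 0
    have e1 : (fun t => F.1 (fun _ => t)) = fun t => F.1 ![0, t] + t * a.1 ![t, t] := by
      funext t
      rw [hdiag, hF]
    have e2 : (fun t => F.1 ![t, 0]) = fun t => F.1 ![0, 0] + t * a.1 ![t, 0] := by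
      funext t
      rw [hF]
    rw [e1, e2, (d3.hasDerivAt.fun_add d1).deriv, (d2.const_add _).deriv, add_comm]

/-! ### The bracket of icons -/

/-- The two-parameter family `(s, t) ↦ F (a s, b t)` as a smooth map on the plane. -/
def family {A : Frol.{u}} {B : Frol.{v}} {C : Frol.{w}} {F : A.prod B → C}
    (hF : IsSmooth (A.prod B) C F) {a : ℝ → A} (ha : a ∈ A.curves) {b : ℝ → B}
    (hb : b ∈ B.curves) : (Rn 2).exp C :=
  ⟨fun x : Fin 2 → ℝ => F (a (x 0), b (x 1)), fun _ hc => hF _ (Frol.pair_mem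
    (A.comp_mem ha ((contDiff_pi.1 (mem_Rn_curves.1 hc)) (0 : Fin 2)))
    (B.comp_mem hb ((contDiff_pi.1 (mem_Rn_curves.1 hc)) (1 : Fin 2))))⟩

/-- An operation on tangent vectors of two factors, over `D²`, is computed on any representing
curves. -/
theorem prolMapOf_joint {A : Frol.{u}} {B : Frol.{v}} {C : Frol.{w}} {F : A.prod B → C}
    (hF : IsSmooth (A.prod B) C F) {a : ℝ → A} (ha : a ∈ A.curves) {b : ℝ → B}
    (hb : b ∈ B.curves) :
    prolMapOf (X := A.prod B) (D 2) F (joint (m := 1) (n := 1) (tangent a ha) (tangent b hb)) =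
      jet (D 2) (family hF ha hb) := by
  have h : joint (m := 1) (n := 1) (tangent a ha) (tangent b hb) = _ := prolPair_jet _ _
  exact (congrArg (prolMapOf (X := A.prod B) (D 2) F) h).trans (dif_pos hF)

theorem starT_tangent {M : Frol.{u}} (hM : WeilExponentiable M) {p q : ℕ} {a : ℝ → E M p}
    (ha : a ∈ (E M p).curves) {b : ℝ → E M q} (hb : b ∈ (E M q).curves) :
    starT hM (tangent a ha) (tangent b hb) = jet (D 2) (family (isSmooth_convT hM p q) ha hb) :=
  prolMapOf_joint (isSmooth_convT hM p q) ha hb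

theorem star_tangent {M : Frol.{u}} (hM : WeilExponentiable M) {p q : ℕ} {a : ℝ → E M p}
    (ha : a ∈ (E M p).curves) {b : ℝ → E M q} (hb : b ∈ (E M q).curves) :
    star hM (tangent a ha) (tangent b hb) = jet (D 2) (family (isSmooth_conv hM p q) ha hb) :=
  prolMapOf_joint (isSmooth_conv hM p q) ha hb

/-- The two convolutions of icons agree on `D(2)`, because `η ∗~ δ = η ∗ δ` and
`δ ∗~ η = δ ∗ η`. -/
theorem starT_eq_star_on_DTwo {M : Frol.{u}} (hM : WeilExponentiable M) {p q : ℕ}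
    {ξ₁ : prol (E M p) (D 1)} {ξ₂ : prol (E M q) (D 1)} (h₁ : IsIcon ξ₁) (h₂ : IsIcon ξ₂) :
    prolSubst (E M (p + q)) inclTwo (starT hM ξ₁ ξ₂) =
      prolSubst (E M (p + q)) inclTwo (star hM ξ₁ ξ₂) := by
  obtain ⟨a, ha, rfl⟩ := exists_eq_tangent ξ₁
  obtain ⟨b, hb, rfl⟩ := exists_eq_tangent ξ₂
  have ha0 : a 0 = dirac M p := h₁
  have hb0 : b 0 = dirac M q := h₂
  have key0 : ∀ t, convT hM (a 0) (b t) = conv hM (a 0) (b t) := fun t => by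
    rw [ha0, convT_dirac_left]
  have key1 : ∀ t, convT hM (a t) (b 0) = conv hM (a t) (b 0) := fun t => by
    rw [hb0, convT_dirac_right]
  rw [starT_tangent, star_tangent]
  refine Quotient.sound ⟨key0 0, fun Φ hΦ => mem_DTwo_of_vanish_axes (fun t => ?_) fun t => ?_⟩
  · exact sub_eq_zero.2 (congrArg Φ (key0 t))
  · exact sub_eq_zero.2 (congrArg Φ (key1 t))

theorem existsUnique_isDiffWitness {M : Frol.{u}} (hmic : Microlinear M) (hM : WeilExponentiable M)
    {p q : ℕ} {ξ₁ : prol (E M p) (D 1)} {ξ₂ : prol (E M q) (D 1)} (h₁ : IsIcon ξ₁)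
    (h₂ : IsIcon ξ₂) :
    ∃! γ : prol (E M (p + q)) DPlus,
      IsDiffWitness (X := E M (p + q)) (starT hM ξ₁ ξ₂) (star hM ξ₁ ξ₂) γ :=
  existsUnique_prol_exp hmic hM isWeilPullback_DPlus _ _ (starT_eq_star_on_DTwo hM h₁ h₂)

theorem foot_prolSubst {X : Frol.{u}} {V W : Weil} (s : Subst V W) (x : prol X V) :
    foot (prolSubst X s x) = foot x := by
  induction x using Quotient.inductionOn with
  | h f => exact congrArg f.1 s.map_zero

theorem strongDiff_spec {X : Frol.{u}} {γ₁ γ₂ : prol X (D 2)}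
    (h : ∃ γ, IsDiffWitness γ₁ γ₂ γ) :
    ∃ γ, IsDiffWitness γ₁ γ₂ γ ∧ strongDiff γ₁ γ₂ = prolSubst X epsMap γ :=
  ⟨h.choose, h.choose_spec, dif_pos h⟩

theorem foot_starT {M : Frol.{u}} (hM : WeilExponentiable M) {p q : ℕ}
    {ξ₁ : prol (E M p) (D 1)} {ξ₂ : prol (E M q) (D 1)} (h₁ : IsIcon ξ₁) (h₂ : IsIcon ξ₂) :
    foot (starT hM ξ₁ ξ₂) = dirac M (p + q) := by
  obtain ⟨a, ha, rfl⟩ := exists_eq_tangent ξ₁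
  obtain ⟨b, hb, rfl⟩ := exists_eq_tangent ξ₂
  have ha0 : a 0 = dirac M p := h₁
  have hb0 : b 0 = dirac M q := h₂
  rw [starT_tangent]
  change convT hM (a 0) (b 0) = _
  rw [ha0, hb0, convT_dirac]

theorem IsIcon.lieBracket {M : Frol.{u}} (hmic : Microlinear M) (hM : WeilExponentiable M)
    {p q : ℕ} {ξ₁ : prol (E M p) (D 1)} {ξ₂ : prol (E M q) (D 1)} (h₁ : IsIcon ξ₁)
    (h₂ : IsIcon ξ₂) : IsIcon (lieBracket hM ξ₁ ξ₂) := by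
  obtain ⟨γ, hγ, e⟩ := strongDiff_spec (existsUnique_isDiffWitness hmic hM h₁ h₂).exists
  have h : foot (X := E M (p + q)) (Frolicher.lieBracket hM ξ₁ ξ₂) = foot γ :=
    (congrArg foot e).trans (foot_prolSubst epsMap γ)
  exact h.trans ((foot_prolSubst psiMap γ).symm.trans
    ((congrArg foot hγ.1).trans (foot_starT hM h₁ h₂)))

/-- The bracket of icons represented by curves `a` and `b`, as an operator on structure
functions. -/
theorem der_lieBracket {M : Frol.{u}} (hmic : Microlinear M) (hM : WeilExponentiable M) {p q : ℕ}
    {a : ℝ → E M p} (ha : a ∈ (E M p).curves) {b : ℝ → E M q} (hb : b ∈ (E M q).curves)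
    (h₁ : IsIcon (tangent a ha)) (h₂ : IsIcon (tangent b hb)) {Φ : E M (p + q) → ℝ}
    (hΦ : Φ ∈ (E M (p + q)).functions) :
    der Φ hΦ (lieBracket hM (tangent a ha) (tangent b hb)) =
      mixed (fun s t => Φ (convT hM (a s) (b t))) - mixed (fun s t => Φ (conv hM (a s) (b t))) := by
  obtain ⟨γ, hγ, e⟩ := strongDiff_spec (existsUnique_isDiffWitness hmic hM h₁ h₂).exists
  rw [starT_tangent, star_tangent] at hγ
  exact (congrArg (der Φ hΦ) e).trans (hγ.der_eq hΦ)

/-! ### The sum of icons -/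

theorem existsUnique_isAddWitness {M : Frol.{u}} (hmic : Microlinear M) (hM : WeilExponentiable M)
    {p : ℕ} {t₁ t₂ : prol (E M p) (D 1)} (h₁ : IsIcon t₁) (h₂ : IsIcon t₂) :
    ∃! γ : prol (E M p) DTwo, IsAddWitness t₁ t₂ γ := by
  refine existsUnique_prol_exp hmic hM isWeilPullback_DTwo t₁ t₂ ?_
  have h : foot (X := E M p) t₁ = foot (X := E M p) t₂ := h₁.trans h₂.symm
  revert h
  clear h₁ h₂
  induction t₁ using Quotient.inductionOn with
  | h f =>
    induction t₂ using Quotient.inductionOn with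
    | h g =>
      intro h
      exact congrArg (jet (D 0)) (Subtype.ext (funext fun x => h))

theorem tadd_spec {X : Frol.{u}} {t₁ t₂ : prol X (D 1)} (h : ∃ γ, IsAddWitness t₁ t₂ γ) :
    ∃ γ, IsAddWitness t₁ t₂ γ ∧ tadd t₁ t₂ = prolSubst X diagonal γ :=
  ⟨h.choose, h.choose_spec, dif_pos h⟩

theorem IsIcon.tadd {M : Frol.{u}} (hmic : Microlinear M) (hM : WeilExponentiable M)
    {p : ℕ} {t₁ t₂ : prol (E M p) (D 1)} (h₁ : IsIcon t₁) (h₂ : IsIcon t₂) :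
    IsIcon (tadd t₁ t₂) := by
  obtain ⟨γ, hγ, e⟩ := tadd_spec (existsUnique_isAddWitness hmic hM h₁ h₂).exists
  have h : foot (X := E M p) (Frolicher.tadd t₁ t₂) = foot γ :=
    (congrArg foot e).trans (foot_prolSubst diagonal γ)
  exact h.trans ((foot_prolSubst axisOne γ).symm.trans ((congrArg foot hγ.1).trans h₁))

theorem der_tadd {M : Frol.{u}} (hmic : Microlinear M) (hM : WeilExponentiable M)
    {p : ℕ} {t₁ t₂ : prol (E M p) (D 1)} (h₁ : IsIcon t₁) (h₂ : IsIcon t₂) {Φ : E M p → ℝ}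
    (hΦ : Φ ∈ (E M p).functions) : der Φ hΦ (tadd t₁ t₂) = der Φ hΦ t₁ + der Φ hΦ t₂ := by
  obtain ⟨γ, hγ, e⟩ := tadd_spec (existsUnique_isAddWitness hmic hM h₁ h₂).exists
  exact (congrArg (der Φ hΦ) e).trans (hγ.der_eq hΦ)

theorem relabel_dirac (M : Frol.{u}) {m n : ℕ} (s : Fin n → Fin m) :
    relabel s (dirac M m) = dirac M n :=
  Subtype.ext (funext fun x => foot_prolSubst (coordSubst s) x)

theorem IsIcon.iconRelabel {M : Frol.{u}} {m n : ℕ} (s : Fin n → Fin m)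
    {ξ : prol (E M m) (D 1)} (h : IsIcon ξ) : IsIcon (iconRelabel s ξ) := by
  obtain ⟨a, ha, rfl⟩ := exists_eq_tangent ξ
  have ha0 : a 0 = dirac M m := h
  change relabel s (a 0) = dirac M n
  rw [ha0, relabel_dirac]

/-! ### Third derivatives -/

/-- Functions of three real variables that are smooth along smooth curves. -/
def SmoothThree (F : ℝ → ℝ → ℝ → ℝ) : Prop :=
  ∀ a b c : ℝ → ℝ, ContDiff ℝ ∞ a → ContDiff ℝ ∞ b → ContDiff ℝ ∞ c →
    ContDiff ℝ ∞ fun t => F (a t) (b t) (c t)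

theorem SmoothThree.contDiff_inner {F : ℝ → ℝ → ℝ → ℝ} (hF : SmoothThree F) (s : ℝ) :
    ContDiff ℝ ∞ (Function.uncurry (F s)) :=
  boman fun b c hb hc => hF _ b c contDiff_const hb hc

theorem SmoothThree.contDiff_deriv {F : ℝ → ℝ → ℝ → ℝ} (hF : SmoothThree F) :
    ContDiff ℝ ∞ (Function.uncurry fun s t => deriv (F s t) 0) :=
  boman fun a b ha hb => by
    have h : ContDiff ℝ ∞ (Function.uncurry fun τ r => F (a τ) (b τ) r) :=
      boman fun τ c hτ hc => hF _ _ c (ha.comp hτ) (hb.comp hτ) hc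
    exact contDiff_left (contDiff_deriv_right h) 0

/-- The mixed third derivative `∂₁ ∂₂ ∂₃ F` at the origin. -/
noncomputable def triple (F : ℝ → ℝ → ℝ → ℝ) : ℝ := deriv (fun s => mixed (F s)) 0

theorem SmoothThree.differentiableAt_mixed {F : ℝ → ℝ → ℝ → ℝ} (hF : SmoothThree F) :
    DifferentiableAt ℝ (fun s => mixed (F s)) 0 :=
  (contDiff_left (contDiff_deriv_right hF.contDiff_deriv) 0).differentiable (by simp) 0

theorem mixed_comm {F : ℝ → ℝ → ℝ} (hF : ContDiff ℝ ∞ (Function.uncurry F)) :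
    mixed (fun t s => F s t) = mixed F := by
  let f := Function.uncurry F
  have hsymm : IsSymmSndFDerivAt ℝ f ((0 : ℝ), (0 : ℝ)) :=
    hF.contDiffAt.isSymmSndFDerivAt (by
      rw [minSmoothness_of_isRCLikeNormedField]
      exact WithTop.coe_le_coe.2 (le_top : (2 : ℕ∞) ≤ ⊤))
  have hd2 : HasFDerivAt (fderiv ℝ f) (fderiv ℝ (fderiv ℝ f) (0, 0)) ((0 : ℝ), (0 : ℝ)) :=
    ((hF.fderiv_right (m := ∞) (by simp)).differentiable (by simp) _).hasFDerivAt
  have e1 : ∀ s t : ℝ, HasDerivAt (fun s : ℝ => (s, t)) ((1 : ℝ), (0 : ℝ)) s := fun s t =>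
    (hasDerivAt_id s).prodMk (hasDerivAt_const s t)
  have e2 : ∀ s t : ℝ, HasDerivAt (fun t : ℝ => (s, t)) ((0 : ℝ), (1 : ℝ)) t := fun s t =>
    (hasDerivAt_const t s).prodMk (hasDerivAt_id t)
  have hfd : ∀ z, HasFDerivAt f (fderiv ℝ f z) z := fun z =>
    (hF.differentiable (by simp) z).hasFDerivAt
  have f1 : ∀ t, deriv (fun s => F s t) 0 = fderiv ℝ f (0, t) (1, 0) := fun t =>
    (HasFDerivAt.comp_hasDerivAt (f := fun s : ℝ => (s, t)) (0 : ℝ) (hfd (0, t)) (e1 0 t)).deriv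
  have f2 : ∀ s, deriv (F s) 0 = fderiv ℝ f (s, 0) (0, 1) := fun s =>
    (HasFDerivAt.comp_hasDerivAt (f := fun t : ℝ => (s, t)) (0 : ℝ) (hfd (s, 0)) (e2 s 0)).deriv
  have g1 : deriv (fun t : ℝ => fderiv ℝ f (0, t) (1, 0)) 0 =
      fderiv ℝ (fderiv ℝ f) (0, 0) (0, 1) (1, 0) := by
    have := (HasFDerivAt.comp_hasDerivAt (f := fun t : ℝ => ((0 : ℝ), t)) (0 : ℝ) hd2
      (e2 0 0)).clm_apply (hasDerivAt_const (0 : ℝ) ((1 : ℝ), (0 : ℝ)))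
    simpa [Function.comp_def] using this.deriv
  have g2 : deriv (fun s : ℝ => fderiv ℝ f (s, 0) (0, 1)) 0 =
      fderiv ℝ (fderiv ℝ f) (0, 0) (1, 0) (0, 1) := by
    have := (HasFDerivAt.comp_hasDerivAt (f := fun s : ℝ => (s, (0 : ℝ))) (0 : ℝ) hd2
      (e1 0 0)).clm_apply (hasDerivAt_const (0 : ℝ) ((0 : ℝ), (1 : ℝ)))
    simpa [Function.comp_def] using this.deriv
  unfold mixed
  rw [funext f1, funext f2, g1, g2]
  exact hsymm _ _

theorem SmoothThree.triple_swap_right {F : ℝ → ℝ → ℝ → ℝ} (hF : SmoothThree F) :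
    triple (fun s r t => F s t r) = triple F := by
  unfold triple
  exact congrArg (fun f : ℝ → ℝ => deriv f 0)
    (funext fun s => mixed_comm (F := F s) (hF.contDiff_inner s))

theorem SmoothThree.triple_swap_left {F : ℝ → ℝ → ℝ → ℝ} (hF : SmoothThree F) :
    triple (fun t s r => F s t r) = triple F :=
  mixed_comm hF.contDiff_deriv

/-- Third derivatives do not depend on the order of differentiation. -/
theorem SmoothThree.triple_cycle {F : ℝ → ℝ → ℝ → ℝ} (hF : SmoothThree F) :
    triple F = triple fun x y z => F y z x := by
  have h₁ : SmoothThree fun x y z => F y z x := fun a b c ha hb hc => hF b c a hb hc ha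
  have h₂ : SmoothThree fun y x z => F y z x := fun a b c ha hb hc => hF a c b ha hc hb
  exact h₂.triple_swap_right.trans h₁.triple_swap_left

theorem SmoothThree.triple_cycle' {F : ℝ → ℝ → ℝ → ℝ} (hF : SmoothThree F) :
    triple F = triple fun x y z => F z x y :=
  hF.triple_cycle.trans (SmoothThree.triple_cycle fun a b c ha hb hc => hF b c a hb hc ha)

/-! ### The Jacobi identity -/

theorem smoothThree_comp {A : Frol.{u}} {B : Frol.{u}} {C : Frol.{u}} {X : Frol.{u}} {Z : Frol.{u}}
    {G : B.prod C → X} (hG : IsSmooth (B.prod C) X G) {F : A.prod X → Z}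
    (hF : IsSmooth (A.prod X) Z F) {Φ : Z → ℝ} (hΦ : Φ ∈ Z.functions) {a : ℝ → A}
    (ha : a ∈ A.curves) {b : ℝ → B} (hb : b ∈ B.curves) {c : ℝ → C} (hc : c ∈ C.curves) :
    SmoothThree fun x y z => Φ (F (a x, G (b y, c z))) := fun _ _ _ hα hβ hγ =>
  (Z.mem_functions_iff Φ).1 hΦ _ (hF _ (Frol.pair_mem (A.comp_mem ha hα)
    (hG _ (Frol.pair_mem (B.comp_mem hb hβ) (C.comp_mem hc hγ)))))

/-- An iterated bracket of icons represented by curves `a`, `b`, `c`, as an alternating sum of third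
derivatives of the four iterated convolutions. -/
theorem der_lieBracket_lieBracket {M : Frol.{u}} (hmic : Microlinear M) (hM : WeilExponentiable M)
    {p q r : ℕ} {a : ℝ → E M p} (ha : a ∈ (E M p).curves) {b : ℝ → E M q}
    (hb : b ∈ (E M q).curves) {c : ℝ → E M r} (hc : c ∈ (E M r).curves)
    (h₁ : IsIcon (tangent a ha)) (h₂ : IsIcon (tangent b hb)) (h₃ : IsIcon (tangent c hc))
    {Φ : E M (p + (q + r)) → ℝ} (hΦ : Φ ∈ (E M (p + (q + r))).functions) :
    der Φ hΦ (lieBracket hM (tangent a ha) (lieBracket hM (tangent b hb) (tangent c hc))) =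
      (triple (fun x y z => Φ (convT hM (a x) (convT hM (b y) (c z)))) -
        triple (fun x y z => Φ (convT hM (a x) (conv hM (b y) (c z))))) -
      (triple (fun x y z => Φ (conv hM (a x) (convT hM (b y) (c z)))) -
        triple (fun x y z => Φ (conv hM (a x) (conv hM (b y) (c z))))) := by
  have hi := IsIcon.lieBracket hmic hM h₂ h₃
  obtain ⟨e, he, heq⟩ := exists_eq_tangent (lieBracket hM (tangent b hb) (tangent c hc))
  rw [heq] at hi ⊢
  -- the inner bracket acts on the functions `Φ ∘ F(η, ·)` obtained by fixing the first argument
  have key : ∀ F : (E M p).prod (E M (q + r)) → E M (p + (q + r)), IsSmooth _ _ F →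
      mixed (fun s t => Φ (F (a s, e t))) =
        triple (fun x y z => Φ (F (a x, convT hM (b y) (c z)))) -
          triple (fun x y z => Φ (F (a x, conv hM (b y) (c z)))) := by
    intro F hF
    have hfun : ∀ s, (fun η => Φ (F (a s, η))) ∈ (E M (q + r)).functions := fun s =>
      IsSmooth.comp_functions (hF.comp ((isSmooth_const _ _ (a s)).pair (IsSmooth.id _))) hΦ
    have hin : ∀ s, deriv (fun t => Φ (F (a s, e t))) 0 =
        mixed (fun y z => Φ (F (a s, convT hM (b y) (c z)))) -
          mixed (fun y z => Φ (F (a s, conv hM (b y) (c z)))) := fun s =>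
      ((der_tangent (hfun s) he).symm.trans (congrArg (der _ (hfun s)) heq.symm)).trans
        (der_lieBracket hmic hM hb hc h₂ h₃ (hfun s))
    rw [mixed, funext hin]
    exact deriv_fun_sub
      (smoothThree_comp (isSmooth_convT hM q r) hF hΦ ha hb hc).differentiableAt_mixed
      (smoothThree_comp (isSmooth_conv hM q r) hF hΦ ha hb hc).differentiableAt_mixed
  rw [der_lieBracket hmic hM ha he h₁ hi hΦ]
  exact congrArg₂ _ (key _ (isSmooth_convT hM p (q + r))) (key _ (isSmooth_conv hM p (q + r)))

/-- The Jacobi identity for icons. -/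
theorem lieBracket_jacobi {M : Frol.{u}} (hmic : Microlinear M) (hM : WeilExponentiable M)
    {p q r : ℕ} {ξ₁ : prol (E M p) (D 1)} {ξ₂ : prol (E M q) (D 1)} {ξ₃ : prol (E M r) (D 1)}
    (h₁ : IsIcon ξ₁) (h₂ : IsIcon ξ₂) (h₃ : IsIcon ξ₃) :
    tadd (tadd (lieBracket hM ξ₁ (lieBracket hM ξ₂ ξ₃))
      (iconRelabel (sigmaOne p q r) (lieBracket hM ξ₂ (lieBracket hM ξ₃ ξ₁))))
      (iconRelabel (sigmaTwo p q r) (lieBracket hM ξ₃ (lieBracket hM ξ₁ ξ₂))) =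
        zeroProl (D 1) (dirac M (p + (q + r))) := by
  have iA := IsIcon.lieBracket hmic hM h₁ (IsIcon.lieBracket hmic hM h₂ h₃)
  have iB := IsIcon.iconRelabel (sigmaOne p q r)
    (IsIcon.lieBracket hmic hM h₂ (IsIcon.lieBracket hmic hM h₃ h₁))
  have iC := IsIcon.iconRelabel (sigmaTwo p q r)
    (IsIcon.lieBracket hmic hM h₃ (IsIcon.lieBracket hmic hM h₁ h₂))
  have iAB := IsIcon.tadd hmic hM iA iB
  refine tangent_ext (IsIcon.tadd hmic hM iAB iC) fun Φ hΦ => ?_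
  rw [der_tadd hmic hM iAB iC, der_tadd hmic hM iA iB, iconRelabel, iconRelabel, der_prolMap,
    der_prolMap]
  obtain ⟨a, ha, rfl⟩ := exists_eq_tangent ξ₁
  obtain ⟨b, hb, rfl⟩ := exists_eq_tangent ξ₂
  obtain ⟨c, hc, rfl⟩ := exists_eq_tangent ξ₃
  rw [der_lieBracket_lieBracket hmic hM ha hb hc h₁ h₂ h₃,
    der_lieBracket_lieBracket hmic hM hb hc ha h₂ h₃ h₁,
    der_lieBracket_lieBracket hmic hM hc ha hb h₃ h₁ h₂]
  have hz : der Φ hΦ (zeroProl (D 1) (dirac M (p + (q + r)))) = 0 := der_zeroProl hΦ _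
  refine Eq.trans ?_ hz.symm
  have hσ₁ : (fun η => Φ (relabel (sigmaOne p q r) η)) ∈ (E M (q + (r + p))).functions :=
    (isSmooth_relabel (sigmaOne p q r)).comp_functions hΦ
  have hσ₂ : (fun η => Φ (relabel (sigmaTwo p q r) η)) ∈ (E M (r + (p + q))).functions :=
    (isSmooth_relabel (sigmaTwo p q r)).comp_functions hΦ
  -- bring all derivatives into the order of the parameters of `a`, `b`, `c`
  have T := isSmooth_convT hM
  have S := isSmooth_conv hM
  rw [(smoothThree_comp (T r p) (T q _) hσ₁ hb hc ha).triple_cycle,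
    (smoothThree_comp (S r p) (T q _) hσ₁ hb hc ha).triple_cycle,
    (smoothThree_comp (T r p) (S q _) hσ₁ hb hc ha).triple_cycle,
    (smoothThree_comp (S r p) (S q _) hσ₁ hb hc ha).triple_cycle,
    (smoothThree_comp (T p q) (T r _) hσ₂ hc ha hb).triple_cycle',
    (smoothThree_comp (S p q) (T r _) hσ₂ hc ha hb).triple_cycle',
    (smoothThree_comp (T p q) (S r _) hσ₂ hc ha hb).triple_cycle',
    (smoothThree_comp (S p q) (S r _) hσ₂ hc ha hb).triple_cycle']
  -- the twelve terms cancel in pairs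
  have e₁ := fun x y z => convT_convT_eq hM (a x) (b y) (c z)
  have e₂ := fun x y z => convT_conv_eq hM (a x) (b y) (c z)
  have e₃ := fun x y z => conv_convT_eq hM (a x) (b y) (c z)
  have e₄ := fun x y z => conv_conv_eq hM (a x) (b y) (c z)
  have e₅ := fun x y z => relabel_convT_conv_eq hM (a x) (b y) (c z)
  have e₆ := fun x y z => relabel_conv_convT_eq hM (a x) (b y) (c z)
  simp only [e₁, e₂, e₃, e₄, e₅, e₆]
  ring

end Frolicher

/-- The Jacobi identity for the Lie bracket of icons, together with the facts that the operations in
it are meaningful. -/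
theorem theorem4p1p10 (M : Frolicher.Frol.{u}) (hmic : Frolicher.Microlinear M)
    (hM : Frolicher.WeilExponentiable M) :
    -- the two convolutions are smooth, as their prolongations require
    (∀ p q : ℕ,
      Frolicher.IsSmooth ((Frolicher.E M p).prod (Frolicher.E M q)) (Frolicher.E M (p + q))
        (fun η => Frolicher.conv hM η.1 η.2) ∧
      Frolicher.IsSmooth ((Frolicher.E M p).prod (Frolicher.E M q)) (Frolicher.E M (p + q))
        (fun η => Frolicher.convT hM η.1 η.2)) ∧
    -- the strong difference of `ξ₁ ⊛~ ξ₂` and `ξ₁ ⊛ ξ₂` is defined, and the bracket is an icon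
    (∀ (p q : ℕ) (ξ₁ : Frolicher.prol (Frolicher.E M p) (Frolicher.D 1))
      (ξ₂ : Frolicher.prol (Frolicher.E M q) (Frolicher.D 1)),
      Frolicher.IsIcon ξ₁ → Frolicher.IsIcon ξ₂ →
        (∃! γ : Frolicher.prol (Frolicher.E M (p + q)) Frolicher.DPlus,
          Frolicher.IsDiffWitness (X := Frolicher.E M (p + q)) (Frolicher.starT hM ξ₁ ξ₂)
            (Frolicher.star hM ξ₁ ξ₂) γ) ∧
        Frolicher.IsIcon (Frolicher.lieBracket hM ξ₁ ξ₂)) ∧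
    -- the sum of two tangent vectors to `[M ⊗ W_{D^p} → M]` at the Dirac distribution is defined
    (∀ (p : ℕ) (t₁ t₂ : Frolicher.prol (Frolicher.E M p) (Frolicher.D 1)),
      Frolicher.IsIcon t₁ → Frolicher.IsIcon t₂ →
        (∃! γ : Frolicher.prol (Frolicher.E M p) Frolicher.DTwo,
          Frolicher.IsAddWitness t₁ t₂ γ) ∧
        Frolicher.IsIcon (Frolicher.tadd t₁ t₂)) ∧
    -- the Jacobi identity
    (∀ (p q r : ℕ) (ξ₁ : Frolicher.prol (Frolicher.E M p) (Frolicher.D 1))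
      (ξ₂ : Frolicher.prol (Frolicher.E M q) (Frolicher.D 1))
      (ξ₃ : Frolicher.prol (Frolicher.E M r) (Frolicher.D 1)),
      Frolicher.IsIcon ξ₁ → Frolicher.IsIcon ξ₂ → Frolicher.IsIcon ξ₃ →
        Frolicher.tadd
          (Frolicher.tadd
            (Frolicher.lieBracket hM ξ₁ (Frolicher.lieBracket hM ξ₂ ξ₃))
            (Frolicher.iconRelabel (Frolicher.sigmaOne p q r)
              (Frolicher.lieBracket hM ξ₂ (Frolicher.lieBracket hM ξ₃ ξ₁))))
          (Frolicher.iconRelabel (Frolicher.sigmaTwo p q r)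
            (Frolicher.lieBracket hM ξ₃ (Frolicher.lieBracket hM ξ₁ ξ₂))) =
        Frolicher.zeroProl (Frolicher.D 1) (Frolicher.dirac M (p + (q + r)))) := by
  refine ⟨fun p q => ⟨Frolicher.isSmooth_conv hM p q, Frolicher.isSmooth_convT hM p q⟩,
    fun p q ξ₁ ξ₂ h₁ h₂ => ⟨Frolicher.existsUnique_isDiffWitness hmic hM h₁ h₂,
      Frolicher.IsIcon.lieBracket hmic hM h₁ h₂⟩,
    fun p t₁ t₂ h₁ h₂ => ⟨Frolicher.existsUnique_isAddWitness hmic hM h₁ h₂,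
      Frolicher.IsIcon.tadd hmic hM h₁ h₂⟩,
    fun p q r ξ₁ ξ₂ ξ₃ h₁ h₂ h₃ => Frolicher.lieBracket_jacobi hmic hM h₁ h₂ h₃⟩
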